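/- **Setting.** Work in max-times algebra on $\mathbb R_+$ ($a\oplus b=\max(a,b)$, $a\otimes b=ab$); matrix products, powers ($A^0=I$) and the Kleene star $A^*=I\oplus A\oplus A^2\oplus\cdots$ are taken in this sense. For $A\in\mathbb R_+^{n\times n}$ let $D(A)$ be the digraph with edges $(i,j)$, $a_{ij}\ne 0$; let $\lambda(A)$ be the maximum of $(a_{i_1i_2}a_{i_2i_3}\cdots a_{i_ki_1})^{1/k}$ over the cycles of length $k\in\{1,\dots,n\}$ in $D(A)$ ($0$ if there are none); let the critical digraph $\mathcal C(A)$ consist of the nodes and edges lying on cycles of $D(A)$ that attain $\lambda(A)$. A digraph is completely reducible if it is a disjoint union of strongly connected components, each containing at least one edge, with no edges between different components. Its cyclicity is the l.c.m., over the components, of the g.c.d. of the lengths of the simple cycles of the component. **CSR products.** For $\lambda=\lambda(A)>0$ and a nonempty completely reducible subdigraph $\mathcal G=(N_{\mathcal G},E_{\mathcal G})$ of $\mathcal C(A)$ with cyclicity $\gamma$, let $B=((A/\lambda)^\gamma)^*$. Let $C$ (resp. $R$) be obtained from $B$ by replacing the columns (resp. rows) with index outside $N_{\mathcal G}$ by zero,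 and let $S$ be obtained from $A/\lambda$ by replacing the entries outside $E_{\mathcal G}$ by zero. The associated products are $CS^tR$, $t\ge 0$. **Nachtigall expansion.** Put $K_1=\{1,\dots,n\}$. At step $\mu$ let $A_\mu$ be $A$ with all entries outside $K_\mu\times K_\mu$ replaced by zero. If $\lambda(A_\mu)=0$, stop. Otherwise select a nonempty completely reducible subdigraph $\mathcal G_\mu=(N_\mu,E_\mu)$ of $\mathcal C(A_\mu)$, and put $K_{\mu+1}=K_\mu\setminus N_\mu$. A selection rule prescribes $\mathcal G_\mu$ as a function of $A$ and $\mathcal G_1,\dots,\mathcal G_{\mu-1}$. The terms of the expansion for given $t$ are the products $C_\mu S_\mu^tR_\mu$ associated with $A_\mu$ and $\mathcal G_\mu$. **Ultimate expansion.** Put $K_1^\circ=\{1,\dots,n\}$. At step $\mu$ let $A_\mu^\circ$ be $A$ with all entries outside $K_\mu^\circ\times K_\mu^\circ$ replaced by zero. If $\lambda(A_\mu^\circ)=0$, stop. Otherwise put $\mathcal G_\mu^\circ=\mathcal C(A_\mu^\circ)$, and let $K_{\mu+1}^\circ$ be $K_\mu^\circ$ without the nodes of all strongly connected components of $D(A)$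 that contain a node of $\mathcal G_\mu^\circ$. The terms for given $t$ are the products $C_\mu^\circ(S_\mu^\circ)^tR_\mu^\circ$ associated with $A_\mu^\circ$ and $\mathcal G_\mu^\circ$. **Cost model.** Algorithms are programs for a random access machine with arrays of integers and of nonnegative reals. The following count as one operation each: on reals, $\max$, product, quotient, extraction of a $k$-th root ($k\ge1$ an integer) and comparison; on nonnegative integers, addition, truncated subtraction, remainder and comparison; access to an array cell. A single program handles all $n$, $A$ and $t$. **Theorem.** (P1) For every selection rule whose selections are carried out by a program in $O(n^3)$ operations each, there is a program which, for all $n$, all $A\in\mathbb R_+^{n\times n}$ and all integers $t\ge0$, computes all terms $C_\mu S_\mu^tR_\mu$ of the Nachtigall expansion of $A$ determined by this rule, in $O(n^4\log n)$ operations. (P2) There is a program which, for all $n$, all $A\in\mathbb R_+^{n\times n}$ and all integers $t\ge0$, computes all terms $C_\mu^\circ(S_\mu^\circ)^tR_\mu^\circ$ of the ultimate expansion of $A$, in $O(n^4\log n)$ operations. The $O$-constants do not depend on $A$ and $t$ (for $n\le1$ the number of operations is bounded by a constant). -/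

import Mathlib

open scoped NNReal

namespace MaxAlg

/-! ### Max-times linear algebra over the nonnegative reals -/

/-- Square matrices with nonnegative real entries. -/
abbrev Mat (n : ℕ) := Matrix (Fin n) (Fin n) ℝ≥0

/-- Max-algebraic product: `(A ⊗ B) i j = max_k A i k * B k j`. -/
noncomputable def mul {n : ℕ} (A B : Mat n) : Mat n :=
  fun i j => Finset.univ.sup fun k => A i k * B k j

/-- The identity matrix. -/
noncomputable def one (n : ℕ) : Mat n := fun i j => if i = j then 1 else 0

/-- Max-algebraic powers. -/
noncomputable def pow {n : ℕ} (A : Mat n) : ℕ → Mat n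
  | 0 => one n
  | k + 1 => mul (pow A k) A

/-- Kleene star `I ⊕ A ⊕ A² ⊕ ⋯`. It is used only for matrices whose maximum cycle geometric
mean is at most `1`; for these all the suprema are finite. -/
noncomputable def star {n : ℕ} (A : Mat n) : Mat n := fun i j => ⨆ k : ℕ, pow A k i j

/-- Entrywise division by a scalar. -/
noncomputable def divBy {n : ℕ} (A : Mat n) (c : ℝ≥0) : Mat n := fun i j => A i j / c

/-- The matrix with all entries outside `K × K` replaced by zero. -/
noncomputable def restrict {n : ℕ} (A : Mat n) (K : Finset (Fin n)) : Mat n :=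
  fun i j => if i ∈ K ∧ j ∈ K then A i j else 0

/-! ### Digraphs and walks -/

/-- The digraph of `A`: the edges are the positions of the nonzero entries. -/
def support {n : ℕ} (A : Mat n) : Digraph (Fin n) := ⟨fun i j => A i j ≠ 0⟩

/-- Weight of the walk `c 0, c 1, …, c k` (of length `k`). -/
noncomputable def weight {n k : ℕ} (A : Mat n) (c : Fin (k + 1) → Fin n) : ℝ≥0 :=
  ∏ e : Fin k, A (c e.castSucc) (c e.succ)

/-- `c 0, c 1, …, c k` is a closed walk (a cycle, possibly with repeated nodes) of `G`. -/
def IsCycle {n k : ℕ} (G : Digraph (Fin n)) (c : Fin (k + 1) → Fin n) : Prop :=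
  c 0 = c (Fin.last k) ∧ ∀ e : Fin k, G.Adj (c e.castSucc) (c e.succ)

/-- `j` is reachable from `i` (by a walk of length `≥ 0`). -/
def Reach {n : ℕ} (G : Digraph (Fin n)) (i j : Fin n) : Prop :=
  Relation.ReflTransGen G.Adj i j

/-- `i` and `j` belong to the same strongly connected component. -/
def SameComp {n : ℕ} (G : Digraph (Fin n)) (i j : Fin n) : Prop :=
  Reach G i j ∧ Reach G j i

open scoped Classical in
/-- The nodes of a subdigraph that is given by its edges. -/
noncomputable def nodes {n : ℕ} (G : Digraph (Fin n)) : Finset (Fin n) :=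
  Finset.univ.filter fun i => ∃ j, G.Adj i j ∨ G.Adj j i

/-- Maximum cycle geometric mean: the maximum of `w(c)^(1/k)` over the cycles of length
`k = 1, …, n`, and `0` if there is no cycle. (A closed sequence of nodes that uses a
non-edge has weight `0` and does not affect the maximum.) -/
noncomputable def mcgm {n : ℕ} (A : Mat n) : ℝ≥0 :=
  (Finset.Icc 1 n).sup fun k =>
    (Finset.univ.filter fun c : Fin (k + 1) → Fin n => c 0 = c (Fin.last k)).sup fun c =>
      weight A c ^ (1 / (k : ℝ))

/-- The critical digraph: all edges that lie on a cycle whose geometric mean is `mcgm A`. -/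
def critical {n : ℕ} (A : Mat n) : Digraph (Fin n) where
  Adj i j := ∃ (k : ℕ) (c : Fin (k + 1) → Fin n), 1 ≤ k ∧ IsCycle (support A) c ∧
    weight A c ^ (1 / (k : ℝ)) = mcgm A ∧ ∃ e : Fin k, c e.castSucc = i ∧ c e.succ = j

open scoped Classical in
/-- Cyclicity of the strongly connected component of `i`: the g.c.d. of the lengths of its
simple cycles. -/
noncomputable def nodeCyclicity {n : ℕ} (G : Digraph (Fin n)) (i : Fin n) : ℕ :=
  ((Finset.Icc 1 n).filter fun k => ∃ c : Fin (k + 1) → Fin n, IsCycle G c ∧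
    (Function.Injective fun e : Fin k => c e.castSucc) ∧ SameComp G i (c 0)).gcd id

/-- Cyclicity of a digraph: the l.c.m. of the cyclicities of its components. -/
noncomputable def cyclicity {n : ℕ} (G : Digraph (Fin n)) : ℕ :=
  (nodes G).lcm (nodeCyclicity G)

/-- `G` consists of nontrivial strongly connected components that are not connected with
each other: every edge can be closed to a cycle. -/
def CompletelyReducible {n : ℕ} (G : Digraph (Fin n)) : Prop :=
  ∀ i j, G.Adj i j → Reach G j i

/-! ### CSR products -/

/-- `B = ((A / λ(A))^γ)^*`, where `γ` is the cyclicity of `G`. -/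
noncomputable def csrB {n : ℕ} (A : Mat n) (G : Digraph (Fin n)) : Mat n :=
  star (pow (divBy A (mcgm A)) (cyclicity G))

/-- `C`: the columns of `B` with indices in `G`. -/
noncomputable def csrC {n : ℕ} (A : Mat n) (G : Digraph (Fin n)) : Mat n :=
  fun i j => if j ∈ nodes G then csrB A G i j else 0

/-- `R`: the rows of `B` with indices in `G`. -/
noncomputable def csrR {n : ℕ} (A : Mat n) (G : Digraph (Fin n)) : Mat n :=
  fun i j => if i ∈ nodes G then csrB A G i j else 0

open scoped Classical in
/-- `S`: the entries of `A / λ(A)` on the edges of `G`. -/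
noncomputable def csrS {n : ℕ} (A : Mat n) (G : Digraph (Fin n)) : Mat n :=
  fun i j => if G.Adj i j then A i j / mcgm A else 0

/-- The product `C ⊗ S^t ⊗ R`. -/
noncomputable def csr {n : ℕ} (A : Mat n) (G : Digraph (Fin n)) (t : ℕ) : Mat n :=
  mul (mul (csrC A G) (pow (csrS A G) t)) (csrR A G)

/-! ### Nachtigall expansions -/

open scoped Classical in
/-- `A_μ`, where `h` lists the digraphs selected before step `μ`: the rows and columns of
all their nodes are replaced by zero. -/
noncomputable def residual {n : ℕ} (A : Mat n) (h : List (Digraph (Fin n))) : Mat n :=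
  restrict A (Finset.univ.filter fun i => ∀ G ∈ h, i ∉ nodes G)

/-- The admissible choices at a step with matrix `A`: the nonempty completely reducible
subdigraphs of the critical digraph of `A`. -/
def Admissible {n : ℕ} (A : Mat n) (G : Digraph (Fin n)) : Prop :=
  G ≤ critical A ∧ (nodes G).Nonempty ∧ CompletelyReducible G

/-- A rule that proposes the next digraph, given the matrix and the list of the digraphs
selected so far. -/
abbrev Rule := (n : ℕ) → Mat n → List (Digraph (Fin n)) → Digraph (Fin n)

/-- `h` lists the digraphs selected by the rule `σ` in the first `h.length` steps; the
procedure stops when the maximum cycle geometric mean becomes zero. -/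
def Selected (σ : Rule) {n : ℕ} (A : Mat n) (h : List (Digraph (Fin n))) : Prop :=
  ∀ (k : ℕ) (hk : k < h.length),
    mcgm (residual A (h.take k)) ≠ 0 ∧ h[k] = σ n A (h.take k)

/-- The rule makes an admissible choice at every step. -/
def IsSelectionRule (σ : Rule) : Prop :=
  ∀ (n : ℕ) (A : Mat n) (h : List (Digraph (Fin n))), Selected σ A h →
    mcgm (residual A h) ≠ 0 → Admissible (residual A h) (σ n A h)

/-- `h` is the complete list of the digraphs of the Nachtigall expansion of `A` that is
determined by the rule `σ`. -/
def IsExpansion (σ : Rule) {n : ℕ} (A : Mat n) (h : List (Digraph (Fin n))) : Prop :=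
  Selected σ A h ∧ mcgm (residual A h) = 0

/-! ### The ultimate expansion (steps are numbered from `0`) -/

open scoped Classical in
/-- The node sets `K_μ`: at each step one removes all components of the digraph of `A` that
contain a critical node of the current matrix. -/
noncomputable def ultNodes {n : ℕ} (A : Mat n) : ℕ → Finset (Fin n)
  | 0 => Finset.univ
  | k + 1 => ultNodes A k \ Finset.univ.filter fun i =>
      ∃ j ∈ nodes (critical (restrict A (ultNodes A k))), SameComp (support A) i j

/-- The matrices `A_μ` of the ultimate expansion. -/
noncomputable def ultMat {n : ℕ} (A : Mat n) (k : ℕ) : Mat n := restrict A (ultNodes A k)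

/-- The terms `C_μ S_μ^t R_μ` of the ultimate expansion. -/
noncomputable def ultTerm {n : ℕ} (A : Mat n) (k t : ℕ) : Mat n :=
  csr (ultMat A k) (critical (ultMat A k)) t

/-! ### Machine model

A random access machine for nonnegative real data, with structured programs. Its memory
consists of three-dimensional arrays of natural numbers and of nonnegative reals, addressed
by computed natural numbers; a scalar variable is the cell `(0, 0, 0)` of an array.
Every arithmetic operation, comparison, memory access and constant counts as one step. -/

/-- Contents of the memory: `nat a i j k` and `real a i j k` are the cells `(i, j, k)` of the
arrays number `a`. -/
structure Store where
  nat : ℕ → ℕ → ℕ → ℕ → ℕ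
  real : ℕ → ℕ → ℕ → ℕ → ℝ≥0

/-- Writing to a cell of an array of natural numbers. -/
def Store.setNat (s : Store) (a i j k v : ℕ) : Store :=
  { s with nat := fun b x y z => if b = a ∧ x = i ∧ y = j ∧ z = k then v else s.nat b x y z }

/-- Writing to a cell of an array of reals. -/
noncomputable def Store.setReal (s : Store) (a i j k : ℕ) (v : ℝ≥0) : Store :=
  { s with real := fun b x y z => if b = a ∧ x = i ∧ y = j ∧ z = k then v else s.real b x y z }

/-- Integer expressions: addition, truncated subtraction, remainder. -/
inductive NExpr where
  | lit (c : ℕ)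
  | get (a : ℕ) (i j k : NExpr)
  | add (x y : NExpr)
  | sub (x y : NExpr)
  | mod (x y : NExpr)

/-- Real expressions: maximum, product, quotient, and `x^(1/k)` for an integer `k`. -/
inductive RExpr where
  | zero
  | one
  | get (a : ℕ) (i j k : NExpr)
  | max (x y : RExpr)
  | mul (x y : RExpr)
  | div (x y : RExpr)
  | root (x : RExpr) (k : NExpr)

/-- Tests. -/
inductive Test where
  | natLe (x y : NExpr)
  | realLe (x y : RExpr)
  | not (b : Test)
  | and (b c : Test)

def NExpr.eval (s : Store) : NExpr → ℕ
  | .lit c => c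
  | .get a i j k => s.nat a (i.eval s) (j.eval s) (k.eval s)
  | .add x y => x.eval s + y.eval s
  | .sub x y => x.eval s - y.eval s
  | .mod x y => x.eval s % y.eval s

def NExpr.cost : NExpr → ℕ
  | .lit _ => 1
  | .get _ i j k => i.cost + j.cost + k.cost + 1
  | .add x y => x.cost + y.cost + 1
  | .sub x y => x.cost + y.cost + 1
  | .mod x y => x.cost + y.cost + 1

noncomputable def RExpr.eval (s : Store) : RExpr → ℝ≥0
  | .zero => 0
  | .one => 1
  | .get a i j k => s.real a (i.eval s) (j.eval s) (k.eval s)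
  | .max x y => x.eval s ⊔ y.eval s
  | .mul x y => x.eval s * y.eval s
  | .div x y => x.eval s / y.eval s
  | .root x k => x.eval s ^ (1 / (k.eval s : ℝ))

def RExpr.cost : RExpr → ℕ
  | .zero => 1
  | .one => 1
  | .get _ i j k => i.cost + j.cost + k.cost + 1
  | .max x y => x.cost + y.cost + 1
  | .mul x y => x.cost + y.cost + 1
  | .div x y => x.cost + y.cost + 1
  | .root x k => x.cost + k.cost + 1

def Test.Holds (s : Store) : Test → Prop
  | .natLe x y => x.eval s ≤ y.eval s
  | .realLe x y => x.eval s ≤ y.eval s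
  | .not b => ¬ b.Holds s
  | .and b c => b.Holds s ∧ c.Holds s

def Test.cost : Test → ℕ
  | .natLe x y => x.cost + y.cost + 1
  | .realLe x y => x.cost + y.cost + 1
  | .not b => b.cost + 1
  | .and b c => b.cost + c.cost + 1

/-- Programs. -/
inductive Prog where
  | skip
  | setNat (a : ℕ) (i j k e : NExpr)
  | setReal (a : ℕ) (i j k : NExpr) (e : RExpr)
  | seq (p q : Prog)
  | ite (b : Test) (p q : Prog)
  | loop (b : Test) (p : Prog)

/-- `Exec p s T s'`: started in the memory contents `s`, the program `p` halts after exactly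
`T` steps in the memory contents `s'`. Here `loop b p` is the loop "while `b` do `p`". -/
inductive Exec : Prog → Store → ℕ → Store → Prop where
  | skip (s : Store) : Exec .skip s 1 s
  | setNat (s : Store) (a : ℕ) (i j k e : NExpr) :
      Exec (.setNat a i j k e) s (i.cost + j.cost + k.cost + e.cost + 1)
        (s.setNat a (i.eval s) (j.eval s) (k.eval s) (e.eval s))
  | setReal (s : Store) (a : ℕ) (i j k : NExpr) (e : RExpr) :
      Exec (.setReal a i j k e) s (i.cost + j.cost + k.cost + e.cost + 1)
        (s.setReal a (i.eval s) (j.eval s) (k.eval s) (e.eval s))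
  | seq {p q : Prog} {s s' s'' : Store} {T T' : ℕ} :
      Exec p s T s' → Exec q s' T' s'' → Exec (.seq p q) s (T + T') s''
  | ite_true {b : Test} {p q : Prog} {s s' : Store} {T : ℕ} :
      b.Holds s → Exec p s T s' → Exec (.ite b p q) s (b.cost + T + 1) s'
  | ite_false {b : Test} {p q : Prog} {s s' : Store} {T : ℕ} :
      ¬ b.Holds s → Exec q s T s' → Exec (.ite b p q) s (b.cost + T + 1) s'
  | loop_false {b : Test} {p : Prog} {s : Store} :
      ¬ b.Holds s → Exec (.loop b p) s (b.cost + 1) s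
  | loop_true {b : Test} {p : Prog} {s s' s'' : Store} {T T' : ℕ} :
      b.Holds s → Exec p s T s' → Exec (.loop b p) s' T' s'' →
        Exec (.loop b p) s (b.cost + T + T' + 1) s''

/-! ### The computational problems

Nothing is assumed about the memory outside the cells that hold the input. -/

/-- Size and matrix are stored: `n` in the integer array `0`, `A` in the real array `0`. -/
def HoldsMatrix {n : ℕ} (s : Store) (A : Mat n) : Prop :=
  s.nat 0 0 0 0 = n ∧ ∀ i j : Fin n, s.real 0 i j 0 = A i j

/-- Input of the two main problems: `A`, and `t` in the integer array `1`. -/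
def HoldsInput {n : ℕ} (s : Store) (A : Mat n) (t : ℕ) : Prop :=
  HoldsMatrix s A ∧ s.nat 1 0 0 0 = t

/-- Output of the two main problems: the number `m` of terms in the integer array `2`, and
the entries of the terms in the real array `1`. -/
def HoldsTerms {n : ℕ} (s : Store) (m : ℕ) (X : Fin m → Mat n) : Prop :=
  s.nat 2 0 0 0 = m ∧ ∀ (μ : Fin m) (i j : Fin n), s.real 1 μ i j = X μ i j

open scoped Classical in
/-- Input of a selection: `A`, the number of the digraphs selected so far in the integer
array `1`, and their incidence matrices in the integer array `2`. -/
def HoldsHistory {n : ℕ} (s : Store) (A : Mat n) (h : List (Digraph (Fin n))) : Prop :=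
  HoldsMatrix s A ∧ s.nat 1 0 0 0 = h.length ∧
    ∀ (μ : Fin h.length) (i j : Fin n), s.nat 2 μ i j = if (h[μ]).Adj i j then 1 else 0

open scoped Classical in
/-- Output of a selection: the incidence matrix in the integer array `3`. -/
def HoldsDigraph {n : ℕ} (s : Store) (G : Digraph (Fin n)) : Prop :=
  ∀ i j : Fin n, s.nat 3 i j 0 = if G.Adj i j then 1 else 0

/-- The selections prescribed by the rule `σ` can be carried out in `O(n³)` operations. -/
def CubicSelection (σ : Rule) : Prop :=
  ∃ (Q : Prog) (κ : ℕ), ∀ (n : ℕ) (A : Mat n) (h : List (Digraph (Fin n))),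
    Selected σ A h → mcgm (residual A h) ≠ 0 →
      ∀ s : Store, HoldsHistory s A h → ∃ (T : ℕ) (s' : Store),
        Exec Q s T s' ∧ T ≤ κ * n ^ 3 ∧ HoldsDigraph s' (σ n A h)

/-- The program `P` solves the first problem for the rule `σ` in at most `bound n` steps: for
all `n`, `A`, `t` it computes all terms `C_μ S_μ^t R_μ` of the Nachtigall expansion of `A`
that is determined by `σ`. -/
def SolvesNachtigall (σ : Rule) (P : Prog) (bound : ℕ → ℝ) : Prop :=
  ∀ (n : ℕ) (A : Mat n) (t : ℕ) (s : Store), HoldsInput s A t →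
    ∃ (T : ℕ) (s' : Store) (h : List (Digraph (Fin n))),
      Exec P s T s' ∧ (T : ℝ) ≤ bound n ∧ IsExpansion σ A h ∧
        HoldsTerms s' h.length fun μ => csr (residual A (h.take μ)) h[μ] t

/-- The program `P` solves the second problem in at most `bound n` steps: for all `n`, `A`,
`t` it computes all terms of the ultimate expansion of `A`. -/
def SolvesUltimate (P : Prog) (bound : ℕ → ℝ) : Prop :=
  ∀ (n : ℕ) (A : Mat n) (t : ℕ) (s : Store), HoldsInput s A t →
    ∃ (T : ℕ) (s' : Store) (m : ℕ),
      Exec P s T s' ∧ (T : ℝ) ≤ bound n ∧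
        (∀ k < m, mcgm (ultMat A k) ≠ 0) ∧ mcgm (ultMat A m) = 0 ∧
        HoldsTerms s' m fun μ => ultTerm A μ t

end MaxAlg

/-! Evaluating `C S^t R` from its definition is too expensive: γ is an l.c.m. over components and
can grow faster than any polynomial in n, while t is arbitrary. Both difficulties vanish when a term
is read through one node per component. Put M = A/λ(A), let p be a node of a component of G, and let
m ≥ 1 be the length of some closed walk of G through p. Then the contribution of this component to
the entry (i, j) of the term is the maximum of (M^a)_{ip} (M^b)_{pj} over all a, b with a + b ≡ t
mod m. The two inequalities are `le_csr` and `walk_through_le` (used together with `csr_le`).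

They hold because closed walks have weight at most 1 in M and exactly 1 when they run inside G
(`pow_csrS_mul_eq_one`), so detours inside G are free; and because the lengths of closed walks of G
through p represent, modulo any given number, all multiples of the cyclicity of the component
(`exists_closed_modEq`). Hence lengths can be adjusted modulo γ or modulo m without changing
weights.

By the pigeonhole principle for pairs (node, length mod m), only exponents below mn matter
(`Bounded.exists_short`). So one needs row p and column p of M^k for k < mn, obtained by
vector-matrix products in O(m n³) operations. After the columns have been folded by residue modulo
m, combining them with the rows costs O(m n³) as well. The least possible m is at most the number of
nodes of the component (`length_le_card`), so a term costs O(n³) times the number of nodes of G. The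
node sets of the successive digraphs are disjoint, and the total is O(n⁴); the factor log n enters
only in the last estimate `quartic_le`.

The remaining work is cubic per step. λ is given by Karp's formula (`karp`). An edge (i, j) is
critical iff M_ij (M^*)_ji ≥ 1 (`critical_adj_iff`), so the critical digraph needs one Kleene star,
computed by Floyd–Warshall. The components of D(A) come from the Kleene star of a 0/1 matrix
(`star_indicator_ne_zero`).

Programs are verified with `Runs`, a total-correctness triple with a time bound. Framing is
syntactic (`Exec.agree`), and the loop over the nodes of G is amortized against the number of
unmarked nodes. A given selection program is relocated to a separate block of arrays. -/

namespace MaxAlg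

/-! ### A program logic with time bounds -/

/-- The numbers of the integer arrays to which a program writes. -/
def Prog.natWrites : Prog → List ℕ
  | .skip => []
  | .setNat a _ _ _ _ => [a]
  | .setReal _ _ _ _ _ => []
  | .seq p q => p.natWrites ++ q.natWrites
  | .ite _ p q => p.natWrites ++ q.natWrites
  | .loop _ p => p.natWrites

/-- The numbers of the real arrays to which a program writes. -/
def Prog.realWrites : Prog → List ℕ
  | .skip => []
  | .setNat _ _ _ _ _ => []
  | .setReal a _ _ _ _ => [a]
  | .seq p q => p.realWrites ++ q.realWrites
  | .ite _ p q => p.realWrites ++ q.realWrites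
  | .loop _ p => p.realWrites

/-- The two memory contents agree outside the integer arrays in `N` and the real arrays
in `R`. -/
structure Agree (N R : List ℕ) (s s' : Store) : Prop where
  nat : ∀ a, a ∉ N → s'.nat a = s.nat a
  real : ∀ a, a ∉ R → s'.real a = s.real a

theorem Agree.refl (N R : List ℕ) (s : Store) : Agree N R s s := ⟨fun _ _ => rfl, fun _ _ => rfl⟩

theorem Agree.trans {N R : List ℕ} {s s' s'' : Store} (h : Agree N R s s')
    (h' : Agree N R s' s'') : Agree N R s s'' :=
  ⟨fun a ha => (h'.nat a ha).trans (h.nat a ha), fun a ha => (h'.real a ha).trans (h.real a ha)⟩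

theorem Agree.mono {N R N' R' : List ℕ} {s s' : Store} (h : Agree N R s s')
    (hN : N ⊆ N') (hR : R ⊆ R') : Agree N' R' s s' :=
  ⟨fun a ha => h.nat a fun h' => ha (hN h'), fun a ha => h.real a fun h' => ha (hR h')⟩

@[simp] theorem Store.setNat_real (s : Store) (a i j k v : ℕ) :
    (s.setNat a i j k v).real = s.real := rfl

@[simp] theorem Store.setReal_nat (s : Store) (a i j k : ℕ) (v : ℝ≥0) :
    (s.setReal a i j k v).nat = s.nat := rfl

theorem Store.setNat_nat (s : Store) (a i j k v b x y z : ℕ) :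
    (s.setNat a i j k v).nat b x y z =
      if b = a ∧ x = i ∧ y = j ∧ z = k then v else s.nat b x y z := rfl

theorem Store.setReal_real (s : Store) (a i j k : ℕ) (v : ℝ≥0) (b x y z : ℕ) :
    (s.setReal a i j k v).real b x y z =
      if b = a ∧ x = i ∧ y = j ∧ z = k then v else s.real b x y z := rfl

theorem Store.setNat_nat_of_ne (s : Store) {a b : ℕ} (h : b ≠ a) (i j k v : ℕ) :
    (s.setNat a i j k v).nat b = s.nat b := by
  funext x y z; simp [Store.setNat, h]

theorem Store.setReal_real_of_ne (s : Store) {a b : ℕ} (h : b ≠ a) (i j k : ℕ) (v : ℝ≥0) :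
    (s.setReal a i j k v).real b = s.real b := by
  funext x y z; simp [Store.setReal, h]

@[simp] theorem Store.setNat_nat_self (s : Store) (a i j k v : ℕ) :
    (s.setNat a i j k v).nat a i j k = v := by simp [Store.setNat]

@[simp] theorem Store.setReal_real_self (s : Store) (a i j k : ℕ) (v : ℝ≥0) :
    (s.setReal a i j k v).real a i j k = v := by simp [Store.setReal]

/-- Frame rule: only arrays that occur syntactically as targets of assignments can change. For
concrete programs, preservation of an array thus reduces to a decidable check on lists. -/
theorem Exec.agree {p : Prog} {s s' : Store} {T : ℕ} (h : Exec p s T s') :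
    Agree p.natWrites p.realWrites s s' := by
  induction h with
  | skip s => exact .refl _ _ _
  | setNat s a i j k e =>
    exact ⟨fun b hb => s.setNat_nat_of_ne (by simpa [Prog.natWrites] using hb) _ _ _ _,
      fun _ _ => rfl⟩
  | setReal s a i j k e =>
    exact ⟨fun _ _ => rfl,
      fun b hb => s.setReal_real_of_ne (by simpa [Prog.realWrites] using hb) _ _ _ _⟩
  | seq _ _ ih ih' =>
    exact (ih.mono (List.subset_append_left _ _) (List.subset_append_left _ _)).trans
      (ih'.mono (List.subset_append_right _ _) (List.subset_append_right _ _))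
  | ite_true _ _ ih =>
    exact ih.mono (List.subset_append_left _ _) (List.subset_append_left _ _)
  | ite_false _ _ ih =>
    exact ih.mono (List.subset_append_right _ _) (List.subset_append_right _ _)
  | loop_false _ => exact .refl _ _ _
  | loop_true _ _ _ ih ih' => exact ih.trans ih'

/-- Started in `s`, the program `p` halts after at most `b` steps in a store with the
property `Q`. -/
def Runs (p : Prog) (s : Store) (b : ℕ) (Q : Store → Prop) : Prop :=
  ∃ (T : ℕ) (s' : Store), Exec p s T s' ∧ T ≤ b ∧ Q s'

theorem Runs.mono {p : Prog} {s : Store} {b b' : ℕ} {Q Q' : Store → Prop} (h : Runs p s b Q)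
    (hb : b ≤ b') (hQ : ∀ s', Agree p.natWrites p.realWrites s s' → Q s' → Q' s') :
    Runs p s b' Q' := by
  obtain ⟨T, s', he, hT, hq⟩ := h
  exact ⟨T, s', he, hT.trans hb, hQ s' he.agree hq⟩

theorem Runs.seq {p q : Prog} {s : Store} {b b' B : ℕ} {R Q : Store → Prop} (h : Runs p s b R)
    (h' : ∀ s', Agree p.natWrites p.realWrites s s' → R s' → Runs q s' b' Q)
    (hB : b + b' ≤ B) : Runs (.seq p q) s B Q := by
  obtain ⟨T, s', he, hT, hq⟩ := h
  obtain ⟨T', s'', he', hT', hq'⟩ := h' s' he.agree hq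
  exact ⟨T + T', s'', .seq he he', by omega, hq'⟩

theorem Runs.ite {b : Test} {p q : Prog} {s : Store} {B B' : ℕ} {Q : Store → Prop}
    (h : b.Holds s → Runs p s B Q) (h' : ¬ b.Holds s → Runs q s B Q)
    (hB : b.cost + B + 1 ≤ B') : Runs (.ite b p q) s B' Q := by
  by_cases hb : b.Holds s
  · obtain ⟨T, s', he, hT, hq⟩ := h hb
    exact ⟨_, s', .ite_true hb he, by omega, hq⟩
  · obtain ⟨T, s', he, hT, hq⟩ := h' hb
    exact ⟨_, s', .ite_false hb he, by omega, hq⟩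

theorem Runs.skip {s : Store} {b : ℕ} {Q : Store → Prop} (hb : 1 ≤ b) (h : Q s) :
    Runs .skip s b Q := ⟨1, s, .skip s, hb, h⟩

theorem Runs.setNat {s : Store} {a : ℕ} {i j k e : NExpr} {b : ℕ} {Q : Store → Prop}
    (hb : i.cost + j.cost + k.cost + e.cost + 1 ≤ b)
    (h : Q (s.setNat a (i.eval s) (j.eval s) (k.eval s) (e.eval s))) :
    Runs (.setNat a i j k e) s b Q := ⟨_, _, .setNat s a i j k e, hb, h⟩

theorem Runs.setReal {s : Store} {a : ℕ} {i j k : NExpr} {e : RExpr} {b : ℕ}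
    {Q : Store → Prop} (hb : i.cost + j.cost + k.cost + e.cost + 1 ≤ b)
    (h : Q (s.setReal a (i.eval s) (j.eval s) (k.eval s) (e.eval s))) :
    Runs (.setReal a i j k e) s b Q := ⟨_, _, .setReal s a i j k e, hb, h⟩

/-- The scalar integer variable number `a`. -/
abbrev var (a : ℕ) : NExpr := .get a (.lit 0) (.lit 0) (.lit 0)

/-- The loop "for `v` from `0` to `w - 1` do `p`", where `v` and `w` are scalar variables. -/
def forLoop (v w : ℕ) (p : Prog) : Prog :=
  .seq (.setNat v (.lit 0) (.lit 0) (.lit 0) (.lit 0))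
    (.loop (.not (.natLe (var w) (var v)))
      (.seq p (.setNat v (.lit 0) (.lit 0) (.lit 0) (.add (var v) (.lit 1)))))

/-- Rule for counting loops, with a potential `φ` that pays for expensive passes. -/
theorem Runs.forLoop_potential {v w : ℕ} {p : Prog} {s : Store} {N b : ℕ}
    (I : ℕ → Store → Prop) (φ : Store → ℕ)
    (hN : s.nat w 0 0 0 = N) (hw : w ∉ p.natWrites) (hv : v ∉ p.natWrites) (hvw : w ≠ v)
    (hI : ∀ k s x, I k s → I k (s.setNat v 0 0 0 x))
    (hφ : ∀ s x, φ (s.setNat v 0 0 0 x) = φ s) (h0 : I 0 s)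
    (body : ∀ k, k < N → ∀ s', Agree (v :: p.natWrites) p.realWrites s s' →
      s'.nat v 0 0 0 = k → I k s' →
      ∃ b', Runs p s' b' fun s'' => I (k + 1) s'' ∧ b' + φ s'' ≤ b + φ s') :
    Runs (forLoop v w p) s (N * (b + 21) + 16 + φ s) (I N) := by
  -- Induction on the number j of remaining passes. Each pass adds 10 for the test, 10 for the
  -- increment and 1 for the loop itself (21 in all); the final failing test costs 11 and the
  -- initialization 5 (16 in all).
  have key : ∀ j k, k + j = N → ∀ s', Agree (v :: p.natWrites) p.realWrites s s' →
      s'.nat v 0 0 0 = k → I k s' →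
      Runs (.loop (.not (.natLe (var w) (var v)))
        (.seq p (.setNat v (.lit 0) (.lit 0) (.lit 0) (.add (var v) (.lit 1)))))
        s' (j * (b + 21) + 11 + φ s') (I N) := by
    intro j
    induction j with
    | zero =>
      intro k hk s' ha hkv hIk
      have hwv : s'.nat w 0 0 0 = N := by rw [ha.nat w (by simp [hvw, hw]), hN]
      obtain rfl : k = N := hk
      refine ⟨_, s', .loop_false ?_, ?_, hIk⟩
      · simp [Test.Holds, NExpr.eval, hwv, hkv]
      · simp [Test.cost, NExpr.cost]
    | succ j ih =>
      intro k hk s' ha hkv hIk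
      have hwv : s'.nat w 0 0 0 = N := by rw [ha.nat w (by simp [hvw, hw]), hN]
      obtain ⟨b', T, s'', he, hT, hIs, hb⟩ := body k (by omega) s' ha hkv hIk
      have hv' : s''.nat v 0 0 0 = k := by rw [he.agree.nat v hv, hkv]
      have ha2 : Agree (v :: p.natWrites) p.realWrites s (s''.setNat v 0 0 0 (k + 1)) := by
        refine (ha.trans (he.agree.mono (List.subset_cons_self _ _) (List.Subset.refl _))).trans
          ⟨fun a h => s''.setNat_nat_of_ne ?_ _ _ _ _, fun _ _ => rfl⟩
        rintro rfl; simp at h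
      obtain ⟨T', s3, he', hT', hq⟩ := ih (k + 1) (by omega) (s''.setNat v 0 0 0 (k + 1)) ha2
        (by simp) (hI _ _ _ hIs)
      have hset := Exec.setNat s'' v (.lit 0) (.lit 0) (.lit 0) (.add (var v) (.lit 1))
      simp only [NExpr.eval, hv'] at hset
      refine ⟨_, s3, .loop_true ?_ (.seq he hset) he', ?_, hq⟩
      · simp only [Test.Holds, NExpr.eval, hwv, hkv]; omega
      · rw [hφ] at hT'
        simp only [Test.cost, NExpr.cost]
        rw [add_mul]
        omega
  have h0' : Agree (v :: p.natWrites) p.realWrites s (s.setNat v 0 0 0 0) :=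
    ⟨fun a h => s.setNat_nat_of_ne (by rintro rfl; simp at h) _ _ _ _, fun _ _ => rfl⟩
  obtain ⟨T, s', he, hT, hq⟩ := key N 0 (by omega) _ h0' (by simp) (hI _ _ _ h0)
  refine ⟨_, s', .seq (.setNat s v _ _ _ _) he, ?_, hq⟩
  rw [hφ] at hT
  simp only [NExpr.cost]
  omega

/-- Rule for counting loops, with bounds of the form `constant * monomial`. -/
theorem Runs.forLoop {v w : ℕ} {p : Prog} {s : Store} {N c M c' M' : ℕ}
    (I : ℕ → Store → Prop) {Q : Store → Prop}
    (hN : s.nat w 0 0 0 = N) (hw : w ∉ p.natWrites) (hv : v ∉ p.natWrites) (hvw : w ≠ v)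
    (hI : ∀ k s x, I k s → I k (s.setNat v 0 0 0 x)) (h0 : I 0 s)
    (body : ∀ k, k < N → ∀ s', Agree (v :: p.natWrites) p.realWrites s s' →
      s'.nat v 0 0 0 = k → I k s' → Runs p s' (c * M) (I (k + 1)))
    (hQ : ∀ s', Agree (v :: p.natWrites) p.realWrites s s' → I N s' → Q s')
    (hM : 1 ≤ M) (hc : c + 37 ≤ c') (hM' : (N + 1) * M ≤ M') :
    Runs (MaxAlg.forLoop v w p) s (c' * M') Q := by
  -- With zero potential, the overheads 21 per pass and 16 once give the constant 37.
  have h := Runs.forLoop_potential (b := c * M) I (fun _ => 0) hN hw hv hvw hI (fun _ _ => rfl) h0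
    (fun k hk s' ha hkv hIk => ⟨c * M, (body k hk s' ha hkv hIk).mono le_rfl
      fun s'' _ h => ⟨h, le_rfl⟩⟩)
  refine h.mono ?_ fun s' ha hq => hQ s' (ha.mono ?_ ?_) hq
  · calc N * (c * M + 21) + 16 + 0 ≤ (c + 37) * ((N + 1) * M) := by nlinarith
      _ ≤ c' * M' := Nat.mul_le_mul hc hM'
  · intro a; simp [MaxAlg.forLoop, Prog.natWrites]; tauto
  · intro a; simp [MaxAlg.forLoop, Prog.realWrites]

/-! ### Relocation of the arrays of a program -/

/-- Add `d` to the numbers of all arrays. -/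
def NExpr.shift (d : ℕ) : NExpr → NExpr
  | .lit c => .lit c
  | .get a i j k => .get (a + d) (i.shift d) (j.shift d) (k.shift d)
  | .add x y => .add (x.shift d) (y.shift d)
  | .sub x y => .sub (x.shift d) (y.shift d)
  | .mod x y => .mod (x.shift d) (y.shift d)

/-- Add `d` to the numbers of all arrays. -/
def RExpr.shift (d : ℕ) : RExpr → RExpr
  | .zero => .zero
  | .one => .one
  | .get a i j k => .get (a + d) (i.shift d) (j.shift d) (k.shift d)
  | .max x y => .max (x.shift d) (y.shift d)
  | .mul x y => .mul (x.shift d) (y.shift d)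
  | .div x y => .div (x.shift d) (y.shift d)
  | .root x k => .root (x.shift d) (k.shift d)

/-- Add `d` to the numbers of all arrays. -/
def Test.shift (d : ℕ) : Test → Test
  | .natLe x y => .natLe (x.shift d) (y.shift d)
  | .realLe x y => .realLe (x.shift d) (y.shift d)
  | .not b => .not (b.shift d)
  | .and b c => .and (b.shift d) (c.shift d)

/-- Add `d` to the numbers of all arrays. -/
def Prog.shift (d : ℕ) : Prog → Prog
  | .skip => .skip
  | .setNat a i j k e => .setNat (a + d) (i.shift d) (j.shift d) (k.shift d) (e.shift d)
  | .setReal a i j k e => .setReal (a + d) (i.shift d) (j.shift d) (k.shift d) (e.shift d)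
  | .seq p q => .seq (p.shift d) (q.shift d)
  | .ite b p q => .ite (b.shift d) (p.shift d) (q.shift d)
  | .loop b p => .loop (b.shift d) (p.shift d)

/-- The memory that consists of the arrays with numbers at least `d`. -/
def Store.drop (d : ℕ) (s : Store) : Store := ⟨fun a => s.nat (a + d), fun a => s.real (a + d)⟩

theorem NExpr.shift_eval (d : ℕ) (s : Store) (e : NExpr) :
    (e.shift d).eval s = e.eval (s.drop d) := by
  induction e with
  | lit c => rfl
  | get a i j k hi hj hk => simp [NExpr.shift, NExpr.eval, hi, hj, hk, Store.drop]
  | add x y hx hy => simp [NExpr.shift, NExpr.eval, hx, hy]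
  | sub x y hx hy => simp [NExpr.shift, NExpr.eval, hx, hy]
  | mod x y hx hy => simp [NExpr.shift, NExpr.eval, hx, hy]

theorem NExpr.shift_cost (d : ℕ) (e : NExpr) : (e.shift d).cost = e.cost := by
  induction e <;> simp_all [NExpr.shift, NExpr.cost]

theorem RExpr.shift_eval (d : ℕ) (s : Store) (e : RExpr) :
    (e.shift d).eval s = e.eval (s.drop d) := by
  induction e with
  | zero => rfl
  | one => rfl
  | get a i j k => simp [RExpr.shift, RExpr.eval, NExpr.shift_eval, Store.drop]
  | max x y hx hy => simp [RExpr.shift, RExpr.eval, hx, hy]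
  | mul x y hx hy => simp [RExpr.shift, RExpr.eval, hx, hy]
  | div x y hx hy => simp [RExpr.shift, RExpr.eval, hx, hy]
  | root x k hx => simp [RExpr.shift, RExpr.eval, hx, NExpr.shift_eval]

theorem RExpr.shift_cost (d : ℕ) (e : RExpr) : (e.shift d).cost = e.cost := by
  induction e <;> simp_all [RExpr.shift, RExpr.cost, NExpr.shift_cost]

theorem Test.shift_holds (d : ℕ) (s : Store) (b : Test) :
    (b.shift d).Holds s ↔ b.Holds (s.drop d) := by
  induction b with
  | natLe x y => simp [Test.shift, Test.Holds, NExpr.shift_eval]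
  | realLe x y => simp [Test.shift, Test.Holds, RExpr.shift_eval]
  | not b hb => simp [Test.shift, Test.Holds, hb]
  | and b c hb hc => simp [Test.shift, Test.Holds, hb, hc]

theorem Test.shift_cost (d : ℕ) (b : Test) : (b.shift d).cost = b.cost := by
  induction b <;> simp_all [Test.shift, Test.cost, NExpr.shift_cost, RExpr.shift_cost]

theorem Store.drop_setNat (d : ℕ) (s : Store) (a i j k v : ℕ) :
    (s.setNat (a + d) i j k v).drop d = (s.drop d).setNat a i j k v := by
  simp [Store.drop, Store.setNat]

theorem Store.drop_setReal (d : ℕ) (s : Store) (a i j k : ℕ) (v : ℝ≥0) :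
    (s.setReal (a + d) i j k v).drop d = (s.drop d).setReal a i j k v := by
  simp [Store.drop, Store.setReal]

/-- A relocated program simulates the original one. -/
theorem Exec.shift (d : ℕ) {p : Prog} {s₀ s₁ : Store} {T : ℕ} (h : Exec p s₀ T s₁) :
    ∀ s : Store, s.drop d = s₀ → ∃ s', Exec (p.shift d) s T s' ∧ s'.drop d = s₁ := by
  induction h with
  | skip s₀ => exact fun s hs => ⟨s, .skip s, hs⟩
  | setNat s₀ a i j k e =>
    intro s hs
    have := Exec.setNat s (a + d) (i.shift d) (j.shift d) (k.shift d) (e.shift d)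
    simp only [NExpr.shift_cost] at this
    exact ⟨_, this, by simp [Store.drop_setNat, NExpr.shift_eval, hs]⟩
  | setReal s₀ a i j k e =>
    intro s hs
    have := Exec.setReal s (a + d) (i.shift d) (j.shift d) (k.shift d) (e.shift d)
    simp only [NExpr.shift_cost, RExpr.shift_cost] at this
    exact ⟨_, this, by simp [Store.drop_setReal, NExpr.shift_eval, RExpr.shift_eval, hs]⟩
  | seq _ _ ih ih' =>
    intro s hs
    obtain ⟨s', he, hs'⟩ := ih s hs
    obtain ⟨s'', he', hs''⟩ := ih' s' hs'
    exact ⟨s'', .seq he he', hs''⟩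
  | @ite_true b p q _ _ T hb _ ih =>
    intro s hs
    obtain ⟨s', he, hs'⟩ := ih s hs
    have := Exec.ite_true (q := q.shift d) ((Test.shift_holds d s b).2 (hs ▸ hb)) he
    rw [Test.shift_cost] at this
    exact ⟨s', this, hs'⟩
  | @ite_false b p q _ _ T hb _ ih =>
    intro s hs
    obtain ⟨s', he, hs'⟩ := ih s hs
    have := Exec.ite_false (p := p.shift d) (mt (Test.shift_holds d s b).1 (hs ▸ hb)) he
    rw [Test.shift_cost] at this
    exact ⟨s', this, hs'⟩
  | @loop_false b p _ hb =>
    intro s hs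
    have := Exec.loop_false (p := p.shift d) (mt (Test.shift_holds d s b).1 (hs ▸ hb))
    rw [Test.shift_cost] at this
    exact ⟨s, this, hs⟩
  | @loop_true b p _ _ _ T T' hb _ _ ih ih' =>
    intro s hs
    obtain ⟨s', he, hs'⟩ := ih s hs
    obtain ⟨s'', he', hs''⟩ := ih' s' hs'
    have := Exec.loop_true ((Test.shift_holds d s b).2 (hs ▸ hb)) he he'
    rw [Test.shift_cost] at this
    exact ⟨s'', this, hs''⟩

/-- A relocated program cannot damage arrays below `d`; this protects the caller's data from a
selection program about whose writes nothing is known. -/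
theorem Prog.shift_natWrites (d : ℕ) (p : Prog) {a : ℕ} (h : a ∈ (p.shift d).natWrites) :
    d ≤ a := by
  induction p with
  | skip => simp [Prog.shift, Prog.natWrites] at h
  | setNat => simp only [Prog.shift, Prog.natWrites, List.mem_singleton] at h; omega
  | setReal => simp [Prog.shift, Prog.natWrites] at h
  | seq p q hp hq | ite _ p q hp hq =>
    exact (List.mem_append.1 h).elim hp hq
  | loop _ p hp => exact hp h

theorem Prog.shift_realWrites (d : ℕ) (p : Prog) {a : ℕ} (h : a ∈ (p.shift d).realWrites) :
    d ≤ a := by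
  induction p with
  | skip => simp [Prog.shift, Prog.realWrites] at h
  | setReal => simp only [Prog.shift, Prog.realWrites, List.mem_singleton] at h; omega
  | setNat => simp [Prog.shift, Prog.realWrites] at h
  | seq p q hp hq | ite _ p q hp hq =>
    exact (List.mem_append.1 h).elim hp hq
  | loop _ p hp => exact hp h

end MaxAlg

namespace MaxAlg

/-! ### Powers and walks -/

variable {n : ℕ}

theorem le_mul (A B : Mat n) (i k j : Fin n) : A i k * B k j ≤ mul A B i j :=
  Finset.le_sup (f := fun k => A i k * B k j) (Finset.mem_univ k)

theorem mul_le {A B : Mat n} {i j : Fin n} {x : ℝ≥0} (h : ∀ k, A i k * B k j ≤ x) :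
    mul A B i j ≤ x := Finset.sup_le fun k _ => h k

theorem exists_mul_eq (A B : Mat n) (i j : Fin n) : ∃ k, mul A B i j = A i k * B k j := by
  obtain ⟨k, -, hk⟩ := Finset.exists_mem_eq_sup Finset.univ ⟨i, Finset.mem_univ i⟩
    fun k => A i k * B k j
  exact ⟨k, hk⟩

theorem mul_assoc' (A B C : Mat n) : mul (mul A B) C = mul A (mul B C) := by
  funext i j
  apply le_antisymm
  · refine mul_le fun k => ?_
    obtain ⟨l, hl⟩ := exists_mul_eq A B i k
    rw [hl, mul_assoc]
    exact (mul_le_mul_right (le_mul B C l k j) _).trans (le_mul A _ i l j)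
  · refine mul_le fun k => ?_
    obtain ⟨l, hl⟩ := exists_mul_eq B C k j
    rw [hl, ← mul_assoc]
    exact (mul_le_mul_left (le_mul A B i k l) _).trans (le_mul _ C i l j)

theorem one_mul' (A : Mat n) : mul (one n) A = A := by
  funext i j
  apply le_antisymm
  · refine mul_le fun k => ?_
    by_cases h : i = k
    · subst h; simp [one]
    · simp [one, h]
  · simpa [one] using le_mul (one n) A i i j

theorem mul_one' (A : Mat n) : mul A (one n) = A := by
  funext i j
  apply le_antisymm
  · refine mul_le fun k => ?_
    by_cases h : k = j
    · subst h; simp [one]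
    · simp [one, h]
  · simpa [one] using le_mul A (one n) i j j

theorem pow_add' (A : Mat n) (a b : ℕ) : pow A (a + b) = mul (pow A a) (pow A b) := by
  induction b with
  | zero => simp [pow, mul_one']
  | succ b ih => rw [← add_assoc, pow, ih, pow, mul_assoc']

theorem pow_one' (A : Mat n) : pow A 1 = A := by simp [pow, one_mul']

theorem pow_succ'' (A : Mat n) (k : ℕ) : pow A (k + 1) = mul A (pow A k) := by
  rw [add_comm, pow_add', pow_one']

theorem pow_pow (A : Mat n) (m k : ℕ) : pow (pow A m) k = pow A (m * k) := by
  induction k with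
  | zero => simp [pow]
  | succ k ih => rw [pow, ih, mul_add, mul_one, pow_add']

theorem pow_mul_le (A : Mat n) (a b : ℕ) (i x j : Fin n) :
    pow A a i x * pow A b x j ≤ pow A (a + b) i j := by
  rw [pow_add']; exact le_mul _ _ _ _ _

theorem exists_pow_add (A : Mat n) (a b : ℕ) (i j : Fin n) :
    ∃ x, pow A (a + b) i j = pow A a i x * pow A b x j := by
  rw [pow_add']; exact exists_mul_eq _ _ _ _

theorem pow_zero_self (A : Mat n) (i : Fin n) : pow A 0 i i = 1 := by simp [pow, one]

/-- Used to obtain column p of the powers as row p of the powers of the transpose, so that one row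
iteration serves both. -/
theorem pow_transpose (A : Mat n) (k : ℕ) (i j : Fin n) :
    pow (fun x y => A y x) k i j = pow A k j i := by
  induction k generalizing i j with
  | zero => simp [pow, one, eq_comm]
  | succ k ih =>
    rw [pow_succ'' A]
    simp only [pow, mul, ih]
    simp only [mul_comm]

theorem pow_mono {A B : Mat n} (h : ∀ i j, A i j ≤ B i j) (k : ℕ) (i j : Fin n) :
    pow A k i j ≤ pow B k i j := by
  induction k generalizing i j with
  | zero => exact le_rfl
  | succ k ih =>
    exact mul_le fun x => (mul_le_mul' (ih i x) (h x j)).trans (le_mul _ _ _ x _)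

theorem pow_divBy (A : Mat n) (c : ℝ≥0) (k : ℕ) (i j : Fin n) :
    pow (divBy A c) k i j = pow A k i j / c ^ k := by
  induction k generalizing i j with
  | zero => simp [pow]
  | succ k ih =>
    simp only [pow, mul, ih, divBy]
    rw [NNReal.finset_sup_div]
    congr 1
    funext x
    rw [div_mul_div_comm, pow_succ]

/-- Weight of the walk `c 0, …, c k`. -/
noncomputable def wt (A : Mat n) (c : ℕ → Fin n) (k : ℕ) : ℝ≥0 :=
  ∏ e ∈ Finset.range k, A (c e) (c (e + 1))

theorem wt_add (A : Mat n) (c : ℕ → Fin n) (a b : ℕ) :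
    wt A c (a + b) = wt A c a * wt A (fun e => c (a + e)) b := by
  simp [wt, Finset.prod_range_add, add_assoc]

theorem wt_le_pow (A : Mat n) (c : ℕ → Fin n) (k : ℕ) : wt A c k ≤ pow A k (c 0) (c k) := by
  induction k with
  | zero => simp [wt, pow_zero_self]
  | succ k ih =>
    rw [wt, Finset.prod_range_succ]
    exact (mul_le_mul_left ih _).trans (le_mul _ _ _ _ _)

theorem wt_le_pow' (A : Mat n) (c : ℕ → Fin n) (a b : ℕ) :
    wt A (fun e => c (a + e)) b ≤ pow A b (c a) (c (a + b)) := by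
  simpa using wt_le_pow A (fun e => c (a + e)) b

/-- The maxima in the product are attained, which yields the walk step by step. Excluding zero
entries disposes of k = 0, i ≠ j, where no walk exists. -/
theorem exists_walk (A : Mat n) (k : ℕ) (i j : Fin n) (h : pow A k i j ≠ 0) :
    ∃ c : ℕ → Fin n, c 0 = i ∧ c k = j ∧ wt A c k = pow A k i j := by
  induction k generalizing j with
  | zero =>
    have : i = j := by
      by_contra hij; exact h (by simp [pow, one, hij])
    subst this
    exact ⟨fun _ => i, rfl, rfl, by simp [wt, pow_zero_self]⟩
  | succ k ih =>
    obtain ⟨x, hx⟩ := exists_mul_eq (pow A k) A i j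
    have hx' : pow A (k + 1) i j = pow A k i x * A x j := hx
    rw [hx'] at h
    obtain ⟨c, h0, hk, hw⟩ := ih x (left_ne_zero_of_mul h)
    refine ⟨fun e => if e ≤ k then c e else j, by simpa using h0, by simp, ?_⟩
    rw [hx', ← hw, wt, Finset.prod_range_succ, wt]
    simp only [le_refl, if_true, hk, Nat.succ_le_iff, lt_irrefl, if_false]
    congr 1
    refine Finset.prod_congr rfl fun e he => ?_
    rw [Finset.mem_range] at he
    simp [he, he.le]

/-- Removing a closed part from a walk. -/
theorem wt_le_cut (A : Mat n) (c : ℕ → Fin n) {a b k : ℕ} (hab : a ≤ b) (hbk : b ≤ k)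
    (h : c a = c b) :
    wt A c k ≤ pow A (k - (b - a)) (c 0) (c k) * pow A (b - a) (c a) (c a) := by
  obtain ⟨d, rfl⟩ := Nat.exists_eq_add_of_le hab
  obtain ⟨l, rfl⟩ := Nat.exists_eq_add_of_le hbk
  have e1 : a + d + l - (a + d - a) = a + l := by omega
  have e2 : a + d - a = d := by omega
  rw [wt_add, wt_add, e1, e2]
  have h1 := wt_le_pow A c a
  have h2 := wt_le_pow' A c a d
  have h3 := wt_le_pow' A c (a + d) l
  rw [← h] at h2 h3
  calc _ ≤ pow A a (c 0) (c a) * pow A d (c a) (c a) * pow A l (c a) (c (a + d + l)) := by gcongr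
    _ = (pow A a (c 0) (c a) * pow A l (c a) (c (a + d + l))) * pow A d (c a) (c a) := by ring
    _ ≤ _ := by gcongr; exact pow_mul_le _ _ _ _ _ _

theorem exists_repeat {α : Type*} [Fintype α] (f : ℕ → α) {k : ℕ} (hk : Fintype.card α ≤ k) :
    ∃ a b, a < b ∧ b ≤ k ∧ f a = f b := by
  obtain ⟨a, ha, b, hb, hne, hab⟩ := Finset.exists_ne_map_eq_of_card_lt_of_maps_to
    (s := Finset.range (k + 1)) (t := Finset.univ) (f := f)
    (by simpa using Nat.lt_succ_of_le hk) (fun _ _ => Finset.mem_univ _)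
  rw [Finset.mem_range] at ha hb
  rcases lt_or_gt_of_ne hne with h | h
  · exact ⟨a, b, h, by omega, hab⟩
  · exact ⟨b, a, h, by omega, hab.symm⟩

/-- Closed walks have weight at most one. -/
def Bounded (A : Mat n) : Prop := ∀ k x, pow A k x x ≤ 1

theorem Bounded.wt_le {A : Mat n} (hA : Bounded A) {c : ℕ → Fin n} {a b k : ℕ} (hab : a ≤ b)
    (hbk : b ≤ k) (h : c a = c b) : wt A c k ≤ pow A (k - (b - a)) (c 0) (c k) :=
  (wt_le_cut A c hab hbk h).trans (mul_le_of_le_one_right' (hA _ _))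

/-- Walks may be shortened without changing their length modulo `m`. -/
theorem Bounded.exists_short {A : Mat n} (hA : Bounded A) {m : ℕ} (hm : 0 < m) (k : ℕ)
    (i j : Fin n) : ∃ k', k' < n * m ∧ k' % m = k % m ∧ pow A k i j ≤ pow A k' i j := by
  induction k using Nat.strong_induction_on with
  | _ k ih =>
    have hn : 0 < n := i.pos
    rcases lt_or_ge k (n * m) with hk | hk
    · exact ⟨k, hk, rfl, le_rfl⟩
    by_cases h0 : pow A k i j = 0
    · exact ⟨k % m, (Nat.mod_lt _ hm).trans_le (Nat.le_mul_of_pos_left _ hn), Nat.mod_mod _ _,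
        by simp [h0]⟩
    obtain ⟨c, rfl, rfl, hw⟩ := exists_walk A k i j h0
    -- Pigeonhole on the n m pairs (node, position mod m). A repeated pair encloses a closed part of
    -- length divisible by m and weight at most 1, so cutting it out preserves the residue and loses
    -- no weight.
    obtain ⟨a, b, hab, hb, h⟩ := exists_repeat
      (fun e => (c e, (⟨e % m, Nat.mod_lt _ hm⟩ : Fin m))) (k := n * m) (by simp)
    simp only [Prod.mk.injEq, Fin.mk.injEq] at h
    obtain ⟨k', hk', hmod, hle⟩ := ih (k - (b - a)) (by omega)
    refine ⟨k', hk', ?_, ?_⟩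
    · rw [hmod]
      have h1 : m ∣ b - a := (Nat.modEq_iff_dvd' hab.le).1 h.2
      exact (Nat.modEq_iff_dvd' (by omega)).2 (by rwa [show k - (k - (b - a)) = b - a by omega])
    · rw [← hw]
      exact (hA.wt_le hab.le (hb.trans hk) h.1).trans hle

theorem Bounded.exists_lt {A : Mat n} (hA : Bounded A) (k : ℕ) (i j : Fin n) :
    ∃ k', k' < n ∧ pow A k i j ≤ pow A k' i j := by
  obtain ⟨k', h, -, h'⟩ := hA.exists_short one_pos k i j
  exact ⟨k', by simpa using h, h'⟩

/-- Every power is dominated entrywise by powers with exponent below n. This makes the `⨆` in `star`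
a genuine supremum instead of the default value of an unbounded one. -/
theorem Bounded.bddAbove {A : Mat n} (hA : Bounded A) (i j : Fin n) :
    BddAbove (Set.range fun k => pow A k i j) := by
  refine ⟨(Finset.range n).sup fun k => pow A k i j, ?_⟩
  rintro _ ⟨k, rfl⟩
  obtain ⟨k', hk', h⟩ := hA.exists_lt k i j
  exact h.trans (Finset.le_sup (f := fun k => pow A k i j) (Finset.mem_range.2 hk'))

theorem Bounded.pow_le_star {A : Mat n} (hA : Bounded A) (k : ℕ) (i j : Fin n) :
    pow A k i j ≤ star A i j := le_ciSup (hA.bddAbove i j) k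

theorem star_le {A : Mat n} {i j : Fin n} {x : ℝ≥0} (h : ∀ k, pow A k i j ≤ x) :
    star A i j ≤ x := ciSup_le h

theorem Bounded.exists_star_eq {A : Mat n} (hA : Bounded A) (i j : Fin n) :
    ∃ k, star A i j = pow A k i j := by
  obtain ⟨k, hk, hs⟩ := Finset.exists_mem_eq_sup (Finset.range n)
    ⟨0, Finset.mem_range.2 i.pos⟩ fun k => pow A k i j
  refine ⟨k, le_antisymm (star_le fun l => ?_) (hA.pow_le_star k i j)⟩
  obtain ⟨k', hk', h⟩ := hA.exists_lt l i j
  rw [← hs]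
  exact h.trans (Finset.le_sup (f := fun k => pow A k i j) (Finset.mem_range.2 hk'))

theorem Bounded.star_mul_star {A : Mat n} (hA : Bounded A) (i x j : Fin n) :
    star A i x * star A x j ≤ star A i j := by
  obtain ⟨a, ha⟩ := hA.exists_star_eq i x
  obtain ⟨b, hb⟩ := hA.exists_star_eq x j
  rw [ha, hb]
  exact (pow_mul_le _ _ _ _ _ _).trans (hA.pow_le_star _ _ _)

theorem Bounded.one_le_star {A : Mat n} (hA : Bounded A) (i : Fin n) : 1 ≤ star A i i := by
  simpa [pow_zero_self] using hA.pow_le_star 0 i i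

theorem Bounded.le_star {A : Mat n} (hA : Bounded A) (i j : Fin n) : A i j ≤ star A i j := by
  simpa [pow_one'] using hA.pow_le_star 1 i j

theorem Bounded.of_pow {A : Mat n} (hA : Bounded A) (m : ℕ) : Bounded (pow A m) := by
  intro k x; rw [pow_pow]; exact hA _ _

/-! ### The maximum cycle geometric mean -/

theorem weight_eq_wt (A : Mat n) {k : ℕ} (c : ℕ → Fin n) :
    weight A (fun e : Fin (k + 1) => c e) = wt A c k := by
  rw [wt, ← Fin.prod_univ_eq_prod_range (fun e => A (c e) (c (e + 1)))]
  rfl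

/-- The extension of a walk to a sequence. -/
def extend {k : ℕ} (c : Fin (k + 1) → Fin n) (e : ℕ) : Fin n := c ⟨min e k, by omega⟩

theorem extend_coe {k : ℕ} (c : Fin (k + 1) → Fin n) : (fun e : Fin (k + 1) => extend c e) = c := by
  funext e
  simp only [extend]
  congr
  omega

theorem extend_castSucc {k : ℕ} (c : Fin (k + 1) → Fin n) (e : Fin k) :
    c e.castSucc = extend c e := (congrFun (extend_coe c) e.castSucc).symm

theorem extend_succ {k : ℕ} (c : Fin (k + 1) → Fin n) (e : Fin k) :
    c e.succ = extend c (e + 1) := (congrFun (extend_coe c) e.succ).symm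

theorem extend_zero {k : ℕ} (c : Fin (k + 1) → Fin n) : c 0 = extend c 0 :=
  (congrFun (extend_coe c) 0).symm

theorem extend_last {k : ℕ} (c : Fin (k + 1) → Fin n) : c (Fin.last k) = extend c k :=
  (congrFun (extend_coe c) (Fin.last k)).symm

theorem weight_eq_wt_extend (A : Mat n) {k : ℕ} (c : Fin (k + 1) → Fin n) :
    weight A c = wt A (extend c) k := by
  conv_lhs => rw [← extend_coe c]
  exact weight_eq_wt A _

theorem rpow_inv_le_iff {x y : ℝ≥0} {k : ℕ} (hk : k ≠ 0) :
    x ^ (1 / (k : ℝ)) ≤ y ↔ x ≤ y ^ k := by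
  rw [one_div, NNReal.rpow_inv_le_iff (by positivity), NNReal.rpow_natCast]

theorem le_rpow_inv_iff {x y : ℝ≥0} {k : ℕ} (hk : k ≠ 0) :
    y ≤ x ^ (1 / (k : ℝ)) ↔ y ^ k ≤ x := by
  rw [one_div, NNReal.le_rpow_inv_iff (by positivity), NNReal.rpow_natCast]

theorem rpow_inv_eq_iff {x y : ℝ≥0} {k : ℕ} (hk : k ≠ 0) :
    x ^ (1 / (k : ℝ)) = y ↔ x = y ^ k := by
  rw [le_antisymm_iff, rpow_inv_le_iff hk, le_rpow_inv_iff hk, ← le_antisymm_iff]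

theorem wt_le_mcgm_pow (A : Mat n) {c : ℕ → Fin n} {k : ℕ} (hk : 1 ≤ k) (hkn : k ≤ n)
    (h : c 0 = c k) : wt A c k ≤ mcgm A ^ k := by
  rw [← rpow_inv_le_iff (by omega), ← weight_eq_wt]
  refine le_trans ?_ (Finset.le_sup (f := fun k => (Finset.univ.filter
    fun c : Fin (k + 1) → Fin n => c 0 = c (Fin.last k)).sup fun c =>
      weight A c ^ (1 / (k : ℝ))) (Finset.mem_Icc.2 ⟨hk, hkn⟩))
  exact Finset.le_sup (f := fun c : Fin (k + 1) → Fin n => weight A c ^ (1 / (k : ℝ)))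
    (Finset.mem_filter.2 ⟨Finset.mem_univ _, by simpa using h⟩)

/-- `mcgm` looks only at lengths up to n. A longer closed walk splits at a repeated node into two
shorter closed walks, to which strong induction applies. -/
theorem pow_self_le (A : Mat n) (k : ℕ) (x : Fin n) : pow A k x x ≤ mcgm A ^ k := by
  induction k using Nat.strong_induction_on generalizing x with
  | _ k ih =>
    by_cases h0 : pow A k x x = 0
    · simp [h0]
    rcases Nat.eq_zero_or_pos k with rfl | hk
    · simp [pow_zero_self]
    obtain ⟨c, hx, hx', hw⟩ := exists_walk A k x x h0
    rw [← hw]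
    rcases le_or_gt k n with hkn | hkn
    · exact wt_le_mcgm_pow A hk hkn (hx.trans hx'.symm)
    obtain ⟨a, b, hab, hb, h⟩ := exists_repeat c (k := n) (by simp)
    have h1 := wt_le_cut A c hab.le (hb.trans hkn.le) h
    rw [hx, hx'] at h1
    refine h1.trans ((mul_le_mul' (ih _ (by omega) _) (ih _ (by omega) _)).trans ?_)
    rw [← pow_add, show k - (b - a) + (b - a) = k by omega]

theorem exists_mcgm_eq (A : Mat n) (h : mcgm A ≠ 0) :
    ∃ (k : ℕ) (c : ℕ → Fin n), 1 ≤ k ∧ k ≤ n ∧ c 0 = c k ∧ wt A c k = mcgm A ^ k := by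
  have hne : (Finset.Icc 1 n).Nonempty := by
    rw [Finset.nonempty_iff_ne_empty]
    intro he
    exact h (by simp [mcgm, he])
  obtain ⟨k, hk, he⟩ := Finset.exists_mem_eq_sup _ hne fun k => (Finset.univ.filter
    fun c : Fin (k + 1) → Fin n => c 0 = c (Fin.last k)).sup fun c =>
      weight A c ^ (1 / (k : ℝ))
  rw [Finset.mem_Icc] at hk
  have hne' : (Finset.univ.filter
      fun c : Fin (k + 1) → Fin n => c 0 = c (Fin.last k)).Nonempty :=
    ⟨fun _ => ⟨0, by omega⟩, by simp⟩
  obtain ⟨c, hc, he'⟩ := Finset.exists_mem_eq_sup _ hne'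
    fun c : Fin (k + 1) → Fin n => weight A c ^ (1 / (k : ℝ))
  rw [he'] at he
  simp only [Finset.mem_filter, Finset.mem_univ, true_and] at hc
  refine ⟨k, extend c, hk.1, hk.2, by rw [← extend_zero, ← extend_last, hc], ?_⟩
  rw [← weight_eq_wt_extend, ← rpow_inv_eq_iff (by omega)]
  exact he.symm

/-- The matrix `A / λ(A)`. -/
noncomputable def normalize (A : Mat n) : Mat n := divBy A (mcgm A)

theorem normalize_bounded (A : Mat n) : Bounded (normalize A) := by
  intro k x
  rw [normalize, pow_divBy]
  exact div_le_one_of_le₀ (pow_self_le A k x) zero_le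

theorem wt_divBy (A : Mat n) (c : ℕ → Fin n) (k : ℕ) (l : ℝ≥0) :
    wt (divBy A l) c k = wt A c k / l ^ k := by
  simp [wt, divBy, Finset.prod_div_distrib]

theorem wt_normalize_eq_one {A : Mat n} (h : mcgm A ≠ 0) (c : ℕ → Fin n) (k : ℕ) :
    wt (normalize A) c k = 1 ↔ wt A c k = mcgm A ^ k := by
  rw [normalize, wt_divBy, div_eq_one_iff_eq (pow_ne_zero _ h)]

theorem Bounded.pow_self_mul {A : Mat n} (hA : Bounded A) {k : ℕ} {x : Fin n}
    (h : pow A k x x = 1) (q : ℕ) : MaxAlg.pow A (k * q) x x = 1 := by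
  induction q with
  | zero => simp [pow_zero_self]
  | succ q ih =>
    refine le_antisymm (hA _ _) ?_
    have := pow_mul_le A (k * q) k x x x
    rwa [ih, h, one_mul] at this

/-! ### Karp's formula -/

/-- The greatest weight of a walk of length `k` that ends at `v`. -/
noncomputable def ending (A : Mat n) (k : ℕ) (v : Fin n) : ℝ≥0 :=
  Finset.univ.sup fun u => pow A k u v

theorem le_ending (A : Mat n) (k : ℕ) (u v : Fin n) : pow A k u v ≤ ending A k v :=
  Finset.le_sup (f := fun u => pow A k u v) (Finset.mem_univ u)

theorem exists_ending_eq (A : Mat n) (k : ℕ) (v : Fin n) : ∃ u, ending A k v = pow A k u v := by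
  obtain ⟨u, -, h⟩ := Finset.exists_mem_eq_sup Finset.univ ⟨v, Finset.mem_univ v⟩
    fun u => pow A k u v
  exact ⟨u, h⟩

theorem ending_zero (A : Mat n) (v : Fin n) : ending A 0 v = 1 := by
  refine le_antisymm (Finset.sup_le fun u _ => ?_) ?_
  · simp only [pow, one]; split_ifs <;> simp
  · simpa [pow_zero_self] using le_ending A 0 v v

theorem ending_succ (A : Mat n) (k : ℕ) (v : Fin n) :
    ending A (k + 1) v = Finset.univ.sup fun u => ending A k u * A u v := by
  apply le_antisymm
  · obtain ⟨u, hu⟩ := exists_ending_eq A (k + 1) v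
    rw [hu]
    exact mul_le fun x => (mul_le_mul_left (le_ending A k u x) _).trans
      (Finset.le_sup (f := fun u => ending A k u * A u v) (Finset.mem_univ x))
  · refine Finset.sup_le fun x _ => ?_
    obtain ⟨u, hu⟩ := exists_ending_eq A k x
    rw [hu]
    exact (le_mul _ _ _ _ _).trans (le_ending A (k + 1) u v)

theorem ending_add_le (A : Mat n) (k l : ℕ) (x v : Fin n) :
    ending A k x * pow A l x v ≤ ending A (k + l) v := by
  obtain ⟨u, hu⟩ := exists_ending_eq A k x
  rw [hu]
  exact (pow_mul_le _ _ _ _ _ _).trans (le_ending A _ u v)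

theorem ending_normalize (A : Mat n) (k : ℕ) (v : Fin n) :
    ending (normalize A) k v = ending A k v / mcgm A ^ k := by
  simp only [ending, normalize, pow_divBy]
  rw [NNReal.finset_sup_div]

/-- The contribution of the node `v` to Karp's formula. -/
noncomputable def karpNode (A : Mat n) (v : Fin n) : ℝ≥0 :=
  (Finset.range n).sup fun k => (ending A k v / ending A n v) ^ (1 / ((n - k : ℕ) : ℝ))

/-- Write D_k(v) for `ending A k v`. A best walk of length n ending at v repeats a node; removing a
closed part of length d gives D_n(v) ≤ D_{n-d}(v) λ^d, so the term k = n - d of `karpNode` is at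
least 1/λ. If no walk of length n ends at v, then `karpNode` is 0 and so is its inverse. -/
theorem inv_karpNode_le (A : Mat n) (v : Fin n) : (karpNode A v)⁻¹ ≤ mcgm A := by
  by_cases hD : ending A n v = 0
  · have : karpNode A v = 0 := by
      refine le_antisymm (Finset.sup_le fun k hk => ?_) zero_le
      rw [Finset.mem_range] at hk
      rw [hD, div_zero, rpow_inv_le_iff (by omega)]
      exact zero_le
    simp [this]
  obtain ⟨u, hu⟩ := exists_ending_eq A n v
  obtain ⟨c, h0, hn, hw⟩ := exists_walk A n u v (by rwa [← hu])
  obtain ⟨a, b, hab, hb, h⟩ := exists_repeat c (k := n) (by simp)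
  have h1 := wt_le_cut A c hab.le hb h
  rw [hw, ← hu, h0, hn] at h1
  have h2 : ending A n v ≤ ending A (n - (b - a)) v * mcgm A ^ (b - a) :=
    h1.trans (mul_le_mul' (le_ending _ _ _ _) (pow_self_le _ _ _))
  have hl : mcgm A ≠ 0 := by
    intro h
    rw [h, zero_pow (by omega), mul_zero] at h2
    exact hD (le_antisymm h2 zero_le)
  have h3 : (mcgm A)⁻¹ ≤ karpNode A v := by
    refine le_trans ?_ (Finset.le_sup (b := n - (b - a)) (Finset.mem_range.2 (by omega)))
    rw [le_rpow_inv_iff (by omega), show n - (n - (b - a)) = b - a by omega, inv_pow,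
      le_div_iff₀ (pos_iff_ne_zero.2 hD), inv_mul_le_iff₀ (pos_iff_ne_zero.2 (pow_ne_zero _ hl)),
      mul_comm]
    exact h2
  exact inv_le_of_inv_le₀ (pos_iff_ne_zero.2 hl) h3

/-- Normalize, take x on a cycle attaining λ, and let k < n maximize D_k(x). The required v is
reached from x by following a closed walk of weight 1 for n - k further steps. Any walk to v can be
continued to x, and going back to v makes the extra weight 1; comparison at x then gives D_{k'}(v) ≤
D_n(v) for all k'. -/
theorem exists_le_inv_karpNode (A : Mat n) (hl : mcgm A ≠ 0) :
    ∃ v, mcgm A ≤ (karpNode A v)⁻¹ := by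
  obtain ⟨l, c, hl1, -, hc, hw⟩ := exists_mcgm_eq A hl
  have hA := normalize_bounded A
  have hx : pow (normalize A) l (c 0) (c 0) = 1 := by
    refine le_antisymm (hA _ _) ?_
    have := wt_le_pow (normalize A) c l
    rwa [(wt_normalize_eq_one hl c l).2 hw, ← hc] at this
  set x := c 0
  obtain ⟨k, hk, hs⟩ := Finset.exists_mem_eq_sup (Finset.range n)
    ⟨0, Finset.mem_range.2 x.pos⟩ fun k => ending (normalize A) k x
  rw [Finset.mem_range] at hk
  have hmax : ∀ k', ending (normalize A) k' x ≤ ending (normalize A) k x := by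
    intro k'
    obtain ⟨u, hu⟩ := exists_ending_eq (normalize A) k' x
    obtain ⟨j, hj, hle⟩ := hA.exists_lt k' u x
    rw [hu, ← hs]
    exact hle.trans ((le_ending _ _ _ _).trans
      (Finset.le_sup (f := fun k => ending (normalize A) k x) (Finset.mem_range.2 hj)))
  have h1 := hA.pow_self_mul hx n
  have hln : n ≤ l * n := Nat.le_mul_of_pos_left _ hl1
  -- The critical cycle is repeated n times so that its length l n is at least n - k, and is cut
  -- after n - k steps.
  obtain ⟨v, hv⟩ := exists_pow_add (normalize A) (n - k) (l * n - (n - k)) x x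
  rw [show n - k + (l * n - (n - k)) = l * n by omega, h1] at hv
  have h2 : ∀ k', ending (normalize A) k' v ≤ ending (normalize A) n v := by
    intro k'
    have h3 := (ending_add_le (normalize A) k' (l * n - (n - k)) v x).trans (hmax _)
    have h4 := ending_add_le (normalize A) k (n - k) x v
    rw [show k + (n - k) = n by omega] at h4
    calc ending (normalize A) k' v
        = ending (normalize A) k' v * pow (normalize A) (l * n - (n - k)) v x *
          pow (normalize A) (n - k) x v := by
          rw [mul_assoc, mul_comm (pow _ _ v x), ← hv, mul_one]
      _ ≤ ending (normalize A) k x * pow (normalize A) (n - k) x v := by gcongr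
      _ ≤ _ := h4
  refine ⟨v, ?_⟩
  have hD : 1 ≤ ending (normalize A) n v := by simpa [ending_zero] using h2 0
  have hD' : 0 < ending A n v := by
    rw [pos_iff_ne_zero]
    intro h
    rw [ending_normalize, h, zero_div] at hD
    exact absurd hD (by simp)
  have hn : 0 < n := x.pos
  have hpos : 0 < karpNode A v := by
    refine lt_of_lt_of_le ?_ (Finset.le_sup (b := 0) (Finset.mem_range.2 hn))
    rw [ending_zero]
    exact NNReal.rpow_pos (by positivity)
  rw [le_inv_comm₀ (pos_iff_ne_zero.2 hl) hpos]
  refine Finset.sup_le fun k' hk' => ?_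
  rw [Finset.mem_range] at hk'
  have h5 := h2 k'
  rw [ending_normalize, ending_normalize, div_le_div_iff₀ (by positivity) (by positivity)] at h5
  rw [rpow_inv_le_iff (by omega), div_le_iff₀ hD', inv_pow, inv_mul_eq_div,
    le_div_iff₀ (by positivity)]
  refine le_of_mul_le_mul_right ?_ (pow_pos (pos_iff_ne_zero.2 hl) k')
  rw [mul_assoc, ← pow_add, show n - k' + k' = n by omega]
  exact h5

/-- Karp's max-min formula, with the inner minimum written as the inverse of a maximum of
reciprocals. Walks may start at any node, so strong connectivity is not needed; with 0⁻¹ = 0 the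
formula also covers λ = 0. -/
theorem karp (A : Mat n) : mcgm A = Finset.univ.sup fun v => (karpNode A v)⁻¹ := by
  apply le_antisymm
  · by_cases hl : mcgm A = 0
    · simp [hl]
    obtain ⟨v, hv⟩ := exists_le_inv_karpNode A hl
    exact hv.trans (Finset.le_sup (f := fun v => (karpNode A v)⁻¹) (Finset.mem_univ v))
  · exact Finset.sup_le fun v _ => inv_karpNode_le A v

end MaxAlg

namespace MaxAlg

variable {n : ℕ}

/-! ### Walks in subdigraphs of the critical digraph -/

/-- An edge is critical iff it closes up to a cycle of normalized weight 1, and the best return walk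
is recorded in the Kleene star. Since `critical` admits cycles of any length, the closed walk found
this way need not be made simple. -/
theorem critical_adj_iff {A : Mat n} (hl : mcgm A ≠ 0) (i j : Fin n) :
    (critical A).Adj i j ↔ 1 ≤ normalize A i j * star (normalize A) j i := by
  have hA := normalize_bounded A
  constructor
  · rintro ⟨k, c, hk, ⟨hc, -⟩, hw, e, rfl, rfl⟩
    rw [rpow_inv_eq_iff (by omega), weight_eq_wt_extend, ← wt_normalize_eq_one hl] at hw
    rw [extend_zero c, extend_last c] at hc
    rw [extend_castSucc c, extend_succ c]
    set d := extend c
    have he := e.2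
    have e1 : k = e + 1 + (k - (e + 1)) := by omega
    rw [e1, wt_add, wt, Finset.prod_range_succ, ← wt] at hw
    have h1 := wt_le_pow (normalize A) d e
    have h2 := wt_le_pow' (normalize A) d (e + 1) (k - (e + 1))
    rw [← e1, ← hc] at h2
    rw [← hw]
    calc _ ≤ pow (normalize A) e (d 0) (d e) * normalize A (d e) (d (e + 1)) *
          pow (normalize A) (k - (e + 1)) (d (e + 1)) (d 0) := by gcongr
      _ = normalize A (d e) (d (e + 1)) * (pow (normalize A) (k - (e + 1)) (d (e + 1)) (d 0) *
          pow (normalize A) e (d 0) (d e)) := by ring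
      _ ≤ _ := by
        gcongr
        exact (pow_mul_le _ _ _ _ _ _).trans (hA.pow_le_star _ _ _)
  · intro h
    obtain ⟨k, hk⟩ := hA.exists_star_eq j i
    rw [hk] at h
    have h0 : pow (normalize A) k j i ≠ 0 := by
      intro h0; rw [h0, mul_zero] at h; exact absurd h (by simp)
    obtain ⟨c, hc0, hck, hw⟩ := exists_walk _ _ _ _ h0
    rw [← hw] at h
    set d : ℕ → Fin n := fun e => if e = 0 then i else c (e - 1)
    have hd : wt (normalize A) d (k + 1) = normalize A i j * wt (normalize A) c k := by
      rw [wt, Finset.prod_range_succ', mul_comm, wt]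
      simp [d, hc0]
    have hd1 : wt (normalize A) d (k + 1) = 1 := by
      refine le_antisymm ?_ (hd ▸ h)
      refine (wt_le_pow _ _ _).trans ?_
      simp only [d, if_true, Nat.add_sub_cancel, hck]
      exact hA _ _
    have hdA := (wt_normalize_eq_one hl _ _).1 hd1
    refine ⟨k + 1, fun e => d e, by omega, ⟨by simp [d, hck], fun e => ?_⟩, ?_, ⟨0, by omega⟩, ?_, ?_⟩
    · have : wt A d (k + 1) ≠ 0 := by rw [hdA]; exact pow_ne_zero _ hl
      exact Finset.prod_ne_zero_iff.1 this e (Finset.mem_range.2 e.2)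
    · rw [rpow_inv_eq_iff (by omega), weight_eq_wt, hdA]
    · simp [d]
    · simp [d, hc0]

theorem mem_nodes {G : Digraph (Fin n)} {x : Fin n} : x ∈ nodes G ↔ ∃ j, G.Adj x j ∨ G.Adj j x := by
  simp [nodes]

/-- Each edge of a critical cycle leads back to its tail along the rest of the same cycle, all of
whose edges are critical. -/
theorem critical_admissible {A : Mat n} (hl : mcgm A ≠ 0) : Admissible A (critical A) := by
  refine ⟨le_rfl, ?_, ?_⟩
  · obtain ⟨k, c, hk, -, hc, hw⟩ := exists_mcgm_eq A hl
    refine ⟨c 0, mem_nodes.2 ⟨c 1, .inl ⟨k, fun e => c e, hk,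
      ⟨by simpa using hc, fun e => ?_⟩, ?_, ⟨0, by omega⟩, by simp, by simp⟩⟩⟩
    · have : wt A c k ≠ 0 := by rw [hw]; exact pow_ne_zero _ hl
      exact Finset.prod_ne_zero_iff.1 this e (Finset.mem_range.2 e.2)
    · rw [rpow_inv_eq_iff (by omega), weight_eq_wt, hw]
  · rintro _ _ ⟨k, c, hk, hc, hw, e, rfl, rfl⟩
    have hadj : ∀ f : Fin k, (critical A).Adj (c f.castSucc) (c f.succ) :=
      fun f => ⟨k, c, hk, hc, hw, f, rfl, rfl⟩
    have hreach : ∀ a d, a + d ≤ k → Reach (critical A) (extend c a) (extend c (a + d)) := by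
      intro a d
      induction d with
      | zero => exact fun _ => .refl
      | succ d ih =>
        intro h
        refine (ih (by omega)).tail ?_
        have := hadj ⟨a + d, by omega⟩
        rwa [extend_castSucc c, extend_succ c] at this
    have he := e.2
    have h1 := hreach (e + 1) (k - (e + 1)) (by omega)
    have h2 := hreach 0 e (by omega)
    rw [show (e : ℕ) + 1 + (k - (e + 1)) = k by omega, ← extend_last c, ← hc.1, extend_zero c] at h1
    rw [zero_add] at h2
    rw [extend_succ c, extend_castSucc c]
    exact h1.trans h2

variable {A : Mat n} {G : Digraph (Fin n)}

theorem csrS_eq (A : Mat n) (G : Digraph (Fin n)) {i j : Fin n} (h : G.Adj i j) :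
    csrS A G i j = normalize A i j := by
  simp [csrS, h, normalize, divBy]

theorem csrS_le (A : Mat n) (G : Digraph (Fin n)) (i j : Fin n) :
    csrS A G i j ≤ normalize A i j := by
  by_cases h : G.Adj i j
  · exact (csrS_eq A G h).le
  · simp [csrS, h]

theorem adj_of_csrS_ne_zero {i j : Fin n} (h : csrS A G i j ≠ 0) : G.Adj i j := by
  by_contra h'; exact h (by simp [csrS, h'])

theorem csrS_bounded (A : Mat n) (G : Digraph (Fin n)) : Bounded (csrS A G) :=
  fun k x => (pow_mono (csrS_le A G) k x x).trans (normalize_bounded A k x)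

theorem csrS_reverse (hl : mcgm A ≠ 0) (hG : G ≤ critical A) {i j : Fin n} (h : G.Adj i j) :
    ∃ k, 1 ≤ csrS A G i j * pow (normalize A) k j i := by
  have := (critical_adj_iff hl i j).1 (hG h)
  obtain ⟨k, hk⟩ := (normalize_bounded A).exists_star_eq j i
  exact ⟨k, by rwa [csrS_eq A G h, ← hk]⟩

theorem csrS_ne_zero (hl : mcgm A ≠ 0) (hG : G ≤ critical A) {i j : Fin n} (h : G.Adj i j) :
    csrS A G i j ≠ 0 := by
  obtain ⟨k, hk⟩ := csrS_reverse hl hG h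
  intro h0
  rw [h0, zero_mul] at hk
  exact absurd hk (by simp)

/-- A walk of critical edges need not lie on a single critical cycle. However, each of its edges has
a return walk in the normalized matrix with product at least 1, and these concatenate in reverse
order. -/
theorem pow_csrS_reverse (hl : mcgm A ≠ 0) (hG : G ≤ critical A) (k : ℕ) {x y : Fin n}
    (h : pow (csrS A G) k x y ≠ 0) :
    ∃ l, 1 ≤ pow (csrS A G) k x y * pow (normalize A) l y x := by
  induction k generalizing y with
  | zero =>
    have : x = y := by by_contra hxy; exact h (by simp [pow, one, hxy])
    subst this
    exact ⟨0, by simp [pow_zero_self]⟩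
  | succ k ih =>
    obtain ⟨z, hz⟩ := exists_mul_eq (pow (csrS A G) k) (csrS A G) x y
    rw [← pow] at hz
    rw [hz] at h ⊢
    obtain ⟨l, hl'⟩ := ih (left_ne_zero_of_mul h)
    obtain ⟨l', hl''⟩ := csrS_reverse hl hG (adj_of_csrS_ne_zero (right_ne_zero_of_mul h))
    refine ⟨l' + l, (one_le_mul hl' hl'').trans ?_⟩
    calc _ = pow (csrS A G) k x z * csrS A G z y *
          (pow (normalize A) l' y z * pow (normalize A) l z x) := by ring
      _ ≤ _ := by gcongr; exact pow_mul_le _ _ _ _ _ _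

/-- The upper bound is boundedness. For the lower bound, multiply the two estimates of
`pow_csrS_reverse`: the two return walks form a closed walk of weight at most 1 and may be dropped.
Thus every round trip inside G is free. -/
theorem pow_csrS_mul_eq_one (hl : mcgm A ≠ 0) (hG : G ≤ critical A) {a b : ℕ} {x y : Fin n}
    (h : pow (csrS A G) a x y ≠ 0) (h' : pow (csrS A G) b y x ≠ 0) :
    pow (csrS A G) a x y * pow (csrS A G) b y x = 1 := by
  refine le_antisymm ((pow_mul_le _ _ _ _ _ _).trans (csrS_bounded A G _ _)) ?_
  obtain ⟨l, h1⟩ := pow_csrS_reverse hl hG a h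
  obtain ⟨l', h2⟩ := pow_csrS_reverse hl hG b h'
  calc 1 ≤ _ := one_le_mul h1 h2
    _ = pow (csrS A G) a x y * pow (csrS A G) b y x *
        (pow (normalize A) l y x * pow (normalize A) l' x y) := by ring
    _ ≤ _ := mul_le_of_le_one_right'
      ((pow_mul_le _ _ _ _ _ _).trans (normalize_bounded A _ _))

theorem pow_csrS_self (hl : mcgm A ≠ 0) (hG : G ≤ critical A) {a : ℕ} {x : Fin n}
    (h : pow (csrS A G) a x x ≠ 0) : pow (csrS A G) a x x = 1 := by
  have := pow_csrS_mul_eq_one hl hG (b := 0) h (by simp [pow_zero_self])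
  rwa [pow_zero_self, mul_one] at this

theorem pow_add_ne_zero {B : Mat n} {a b : ℕ} {x y z : Fin n} (h : pow B a x y ≠ 0)
    (h' : pow B b y z ≠ 0) : pow B (a + b) x z ≠ 0 := fun h0 =>
  mul_ne_zero h h' (le_antisymm ((pow_mul_le B a b x y z).trans h0.le) zero_le)

theorem exists_pow_ne_zero (hl : mcgm A ≠ 0) (hG : G ≤ critical A) {x y : Fin n}
    (h : Reach G x y) : ∃ k, pow (csrS A G) k x y ≠ 0 := by
  induction h with
  | refl => exact ⟨0, by simp [pow_zero_self]⟩
  | tail _ h ih =>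
    obtain ⟨k, hk⟩ := ih
    exact ⟨k + 1, pow_add_ne_zero hk (by rw [pow_one']; exact csrS_ne_zero hl hG h)⟩

theorem reach_of_pow_ne_zero {k : ℕ} {x y : Fin n} (h : pow (csrS A G) k x y ≠ 0) :
    Reach G x y := by
  induction k generalizing y with
  | zero =>
    have : x = y := by by_contra hxy; exact h (by simp [pow, one, hxy])
    subst this
    exact .refl
  | succ k ih =>
    obtain ⟨z, hz⟩ := exists_mul_eq (pow (csrS A G) k) (csrS A G) x y
    rw [← pow] at hz
    rw [hz] at h
    exact (ih (left_ne_zero_of_mul h)).tail (adj_of_csrS_ne_zero (right_ne_zero_of_mul h))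

theorem CompletelyReducible.symm (h : CompletelyReducible G) {x y : Fin n} (hr : Reach G x y) :
    Reach G y x := by
  induction hr with
  | refl => exact .refl
  | tail _ hadj ih => exact (h _ _ hadj).trans ih

/-- Nodes of a completely reducible digraph can be recognized by outgoing edges alone, and the
programs test only for these. -/
theorem CompletelyReducible.exists_adj (h : CompletelyReducible G) {x : Fin n}
    (hx : x ∈ nodes G) : ∃ j, G.Adj x j := by
  obtain ⟨j, hj | hj⟩ := mem_nodes.1 hx
  · exact ⟨j, hj⟩
  · rcases Relation.ReflTransGen.cases_head (h _ _ hj) with rfl | ⟨z, hz, -⟩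
    · exact ⟨_, hj⟩
    · exact ⟨z, hz⟩

theorem mem_nodes_of_reach {x y : Fin n} (hx : x ∈ nodes G) (h : Reach G x y) : y ∈ nodes G := by
  rcases Relation.ReflTransGen.cases_tail h with rfl | ⟨z, -, hz⟩
  · exact hx
  · exact mem_nodes.2 ⟨z, .inr hz⟩

theorem CompletelyReducible.exists_closed (hl : mcgm A ≠ 0) (hG : G ≤ critical A)
    (h : CompletelyReducible G) {x : Fin n} (hx : x ∈ nodes G) :
    ∃ k, 1 ≤ k ∧ pow (csrS A G) k x x ≠ 0 := by
  obtain ⟨j, hj⟩ := h.exists_adj hx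
  obtain ⟨k, hk⟩ := exists_pow_ne_zero hl hG (h _ _ hj)
  exact ⟨1 + k, by omega, pow_add_ne_zero (by rw [pow_one']; exact csrS_ne_zero hl hG hj) hk⟩

/-- A closed walk through `p` of least positive length visits different nodes. -/
theorem length_le_card {B : Mat n} {p : Fin n} {m : ℕ} (hm : 1 ≤ m)
    (h : pow B m p p ≠ 0) (hmin : ∀ k, 1 ≤ k → k < m → pow B k p p = 0) (F : Finset (Fin n))
    (hF : ∀ k q, 1 ≤ k → k ≤ m → pow B k p q ≠ 0 → q ∈ F) : m ≤ F.card := by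
  obtain ⟨c, h0, hc, hw⟩ := exists_walk B m p p h
  rw [← hw] at h
  -- A repeated node would leave, after cutting, a shorter closed walk through p, against
  -- minimality.
  have hinj : Set.InjOn c (Set.Iio m) := by
    have key : ∀ a b, a < b → b < m → c a ≠ c b := by
      intro a b hab hb hne
      have h1 := wt_le_cut B c hab.le hb.le hne
      rw [h0, hc, hmin (m - (b - a)) (by omega) (by omega), zero_mul] at h1
      exact h (le_antisymm h1 zero_le)
    intro a ha b hb hne
    rcases lt_trichotomy a b with hab | hab | hab
    · exact (key a b hab hb hne).elim
    · exact hab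
    · exact (key b a hab ha hne.symm).elim
  have hcard : ((Finset.range m).image c).card = m := by
    rw [Finset.card_image_of_injOn (by simpa using hinj), Finset.card_range]
  rw [← hcard]
  refine Finset.card_le_card fun q hq => ?_
  obtain ⟨e, he, rfl⟩ := Finset.mem_image.1 hq
  rw [Finset.mem_range] at he
  rcases Nat.eq_zero_or_pos e with rfl | he'
  -- `hF` covers only positive exponents, so the start p is counted as the end of the walk, at
  -- exponent m.
  · exact hF m (c 0) hm le_rfl (by rw [hw] at h; rwa [h0])
  · refine hF e _ he' he.le fun h1 => h ?_
    have h2 := wt_le_pow B c e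
    rw [h0, h1] at h2
    rw [show m = e + (m - e) by omega, wt_add, le_antisymm h2 zero_le, zero_mul]

/-! ### Cyclicity -/

open scoped Classical in
-- A closed walk decomposes into simple cycles of the same component: either it is simple, or a
-- repeated node splits it into two shorter closed walks.
theorem nodeCyclicity_dvd_of_closed (h : CompletelyReducible G) {i x : Fin n} {k : ℕ}
    (hk : pow (csrS A G) k x x ≠ 0) (hx : Reach G i x) : nodeCyclicity G i ∣ k := by
  induction k using Nat.strong_induction_on generalizing x with
  | _ k ih =>
    rcases Nat.eq_zero_or_pos k with rfl | hk0
    · exact dvd_zero _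
    obtain ⟨c, h0, hc, hw⟩ := exists_walk _ k x x hk
    rw [← hw] at hk
    by_cases hinj : Function.Injective fun e : Fin k => c e
    · have hkn : k ≤ n := by simpa using Fintype.card_le_of_injective _ hinj
      refine Finset.gcd_dvd (f := id) (b := k) ?_
      rw [Finset.mem_filter]
      refine ⟨Finset.mem_Icc.2 ⟨hk0, hkn⟩, fun e => c e, ⟨?_, fun e => ?_⟩, hinj, ?_⟩
      · simp [h0, hc]
      · exact adj_of_csrS_ne_zero (A := A)
          (Finset.prod_ne_zero_iff.1 hk e (Finset.mem_range.2 e.2))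
      · simp only [Fin.val_zero, h0]
        exact ⟨hx, h.symm hx⟩
    · have : ∃ a b, a < b ∧ b < k ∧ c a = c b := by
        simp only [Function.Injective, not_forall] at hinj
        obtain ⟨a, b, hab, hne⟩ := hinj
        rcases lt_or_gt_of_ne (fun h => hne (Fin.ext h) : (a : ℕ) ≠ b) with h | h
        · exact ⟨a, b, h, b.2, hab⟩
        · exact ⟨b, a, h, a.2, hab.symm⟩
      obtain ⟨a, b, hab, hb, hne⟩ := this
      have h1 := wt_le_cut (csrS A G) c hab.le hb.le hne
      rw [h0, hc] at h1
      have h2 : pow (csrS A G) (k - (b - a)) x x * pow (csrS A G) (b - a) (c a) (c a) ≠ 0 :=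
        fun h => hk (le_antisymm (h1.trans h.le) zero_le)
      have h3 : Reach G x (c a) := by
        rw [← h0]
        refine reach_of_pow_ne_zero (A := A) (k := a) fun h4 => hk ?_
        have h5 := wt_le_pow (csrS A G) c a
        rw [h4] at h5
        rw [show k = a + (k - a) by omega, wt_add, le_antisymm h5 zero_le, zero_mul]
      have h4 := ih _ (by omega) (left_ne_zero_of_mul h2) hx
      have h5 := ih _ (by omega) (right_ne_zero_of_mul h2) (hx.trans h3)
      have := dvd_add h4 h5
      rwa [show k - (b - a) + (b - a) = k by omega] at this

theorem nodeCyclicity_ne_zero (hl : mcgm A ≠ 0) (hG : G ≤ critical A)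
    (h : CompletelyReducible G) {x : Fin n} (hx : x ∈ nodes G) : nodeCyclicity G x ≠ 0 := by
  obtain ⟨k, hk, hne⟩ := h.exists_closed hl hG hx
  have := nodeCyclicity_dvd_of_closed h hne (i := x) .refl
  intro h0
  rw [h0, zero_dvd_iff] at this
  omega

theorem cyclicity_pos (hl : mcgm A ≠ 0) (hG : G ≤ critical A)
    (h : CompletelyReducible G) : 0 < cyclicity G := by
  rw [Nat.pos_iff_ne_zero, cyclicity, Ne, Finset.lcm_eq_zero_iff]
  rintro ⟨x, hx, h0⟩
  exact nodeCyclicity_ne_zero hl hG h hx h0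

theorem nodeCyclicity_dvd_cyclicity {x : Fin n} (hx : x ∈ nodes G) :
    nodeCyclicity G x ∣ cyclicity G := Finset.dvd_lcm hx

open scoped Classical in
/-- The residues of the lengths of the closed walks through `p`. -/
theorem exists_closed_modEq (hl : mcgm A ≠ 0) (hG : G ≤ critical A)
    (h : CompletelyReducible G) {p : Fin n} (hp : p ∈ nodes G) {M : ℕ} (hM : 0 < M) {z : ℤ}
    (hz : (nodeCyclicity G p : ℤ) ∣ z) (B : ℕ) :
    ∃ l, B ≤ l ∧ pow (csrS A G) l p p = 1 ∧ (l : ℤ) ≡ z [ZMOD M] := by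
  have hS := csrS_bounded A G
  -- Integers congruent modulo M to the length of a closed walk through p. Concatenation gives sums,
  -- and repeating a closed walk M - 1 times gives negatives. Working with residues avoids any
  -- threshold of Frobenius type.
  let H : AddSubgroup ℤ :=
    { carrier := {z | ∃ l, pow (csrS A G) l p p ≠ 0 ∧ (l : ℤ) ≡ z [ZMOD M]}
      zero_mem' := ⟨0, by simp [pow_zero_self], by simp⟩
      add_mem' := by
        rintro a b ⟨l, hl1, hl2⟩ ⟨l', hl1', hl2'⟩
        exact ⟨l + l', pow_add_ne_zero hl1 hl1', by push_cast; exact hl2.add hl2'⟩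
      neg_mem' := by
        rintro a ⟨l, hl1, hl2⟩
        refine ⟨l * (M - 1), ?_, ?_⟩
        · rw [hS.pow_self_mul (pow_csrS_self hl hG hl1)]; exact one_ne_zero
        · push_cast [Nat.cast_sub hM]
          have h1 : (l : ℤ) * (M - 1) ≡ l * (0 - 1) [ZMOD M] :=
            Int.ModEq.mul_left _ (Int.ModEq.sub_right _ (by simp [Int.ModEq]))
          refine h1.trans ?_
          rw [zero_sub, mul_neg, mul_one]
          exact hl2.neg }
  have hH : ∀ {k : ℕ}, pow (csrS A G) k p p ≠ 0 → (k : ℤ) ∈ H := fun hk => ⟨_, hk, rfl⟩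
  obtain ⟨g, hg⟩ := Int.subgroup_cyclic H
  have hgH : ∀ a : ℤ, a ∈ H ↔ g ∣ a := by
    intro a; rw [hg, AddSubgroup.mem_closure_singleton]
    constructor
    · rintro ⟨c, rfl⟩; exact ⟨c, by simp [mul_comm]⟩
    · rintro ⟨c, rfl⟩; exact ⟨c, by simp [mul_comm]⟩
  -- For a simple cycle of length k in the component, a round trip from p with and without running
  -- through the cycle shows that k, the difference of the two lengths, lies in H.
  have hdvd : g ∣ (nodeCyclicity G p : ℤ) := by
    rw [← Int.natAbs_dvd_natAbs, Int.natAbs_natCast]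
    refine Finset.dvd_gcd fun k hk => ?_
    rw [Finset.mem_filter] at hk
    obtain ⟨-, c, ⟨hc, hadj⟩, -, hr⟩ := hk
    rw [id, ← Int.natAbs_natCast k, Int.natAbs_dvd_natAbs, ← hgH]
    obtain ⟨a, ha⟩ := exists_pow_ne_zero hl hG hr.1
    obtain ⟨b, hb⟩ := exists_pow_ne_zero hl hG hr.2
    have hk' : pow (csrS A G) k (c 0) (c 0) ≠ 0 := by
      have h1 := wt_le_pow (csrS A G) (extend c) k
      rw [← extend_zero c, ← extend_last c, ← hc] at h1
      refine fun h2 => ?_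
      rw [h2] at h1
      refine absurd (le_antisymm h1 zero_le) (Finset.prod_ne_zero_iff.2 fun e he => ?_)
      rw [Finset.mem_range] at he
      have := hadj ⟨e, he⟩
      rw [extend_castSucc c, extend_succ c] at this
      exact csrS_ne_zero hl hG this
    have h1 := hH (pow_add_ne_zero ha hb)
    have h2 := hH (pow_add_ne_zero (pow_add_ne_zero ha hk') hb)
    have h3 := H.sub_mem h2 h1
    push_cast at h3
    rwa [show (a + k + b - (a + b) : ℤ) = k by ring] at h3
  obtain ⟨l, hl1, hl2⟩ := (hgH z).2 (hdvd.trans hz)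
  obtain ⟨k, hk, hne⟩ := h.exists_closed hl hG hp
  -- Repeating a closed walk M B times keeps the residue modulo M and makes the length at least B.
  have hk1 := hS.pow_self_mul (pow_csrS_self hl hG hne) (M * B)
  refine ⟨l + k * (M * B), ?_, ?_, ?_⟩
  · calc B ≤ k * (M * B) := by
          rw [← mul_assoc]; exact Nat.le_mul_of_pos_left _ (Nat.mul_pos hk hM)
      _ ≤ _ := Nat.le_add_left _ _
  · exact pow_csrS_self hl hG (pow_add_ne_zero hl1 (by rw [hk1]; exact one_ne_zero))
  · refine Int.ModEq.trans ?_ hl2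
    rw [Int.modEq_iff_dvd]
    exact ⟨-(k * B), by push_cast; ring⟩

/-! ### Terms of the expansions in terms of walks through single nodes -/

/-- At p one inserts a closed walk of G, which has weight 1, of length s + t + r, where a + s and r
+ b are multiples of γ. Its part of length t plays the role of S^t, and the two ends are absorbed by
C and R. Such a length exists because the cyclicity of the component of p divides m and γ, hence t -
(a + b) and a + s, hence s + t - b. -/
theorem le_csr (hl : mcgm A ≠ 0) (hG : G ≤ critical A) (h : CompletelyReducible G)
    {p : Fin n} (hp : p ∈ nodes G) {m : ℕ} (hm : pow (csrS A G) m p p ≠ 0) {t a b : ℕ}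
    (hab : a + b ≡ t [MOD m]) (i j : Fin n) :
    pow (normalize A) a i p * pow (normalize A) b p j ≤ csr A G t i j := by
  have hγ := cyclicity_pos hl hG h
  set γ := cyclicity G with hγdef
  have hdm : nodeCyclicity G p ∣ m := nodeCyclicity_dvd_of_closed h hm .refl
  have hdγ : nodeCyclicity G p ∣ γ := nodeCyclicity_dvd_cyclicity hp
  obtain ⟨s, hs⟩ : ∃ s, a + s = γ * a :=
    ⟨γ * a - a, Nat.add_sub_cancel' (Nat.le_mul_of_pos_left _ hγ)⟩
  have hz : (nodeCyclicity G p : ℤ) ∣ (s + t - b : ℤ) := by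
    have h1 : ((nodeCyclicity G p : ℕ) : ℤ) ∣ (t : ℤ) - (a + b : ℕ) :=
      (Int.natCast_dvd_natCast.2 hdm).trans (Nat.modEq_iff_dvd.1 hab)
    have h2 : ((nodeCyclicity G p : ℕ) : ℤ) ∣ ((γ * a : ℕ) : ℤ) :=
      Int.natCast_dvd_natCast.2 (hdγ.mul_right a)
    have h3 := dvd_add h1 h2
    rw [← hs] at h3
    push_cast at h3
    rwa [show (t - (a + b) + (a + s) : ℤ) = s + t - b by ring] at h3
  obtain ⟨l, hlB, hl1, hlz⟩ := exists_closed_modEq hl hG h hp hγ hz (s + t)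
  obtain ⟨r, rfl⟩ := Nat.exists_eq_add_of_le hlB
  obtain ⟨q, hq⟩ := exists_pow_add (csrS A G) (s + t) r p p
  obtain ⟨p', hp'⟩ := exists_pow_add (csrS A G) s t p q
  rw [hp', hl1] at hq
  have hne : pow (csrS A G) s p p' * pow (csrS A G) t p' q ≠ 0 := fun h0 => by
    rw [h0, zero_mul] at hq; exact one_ne_zero hq
  have hp'n : p' ∈ nodes G := mem_nodes_of_reach hp
    (reach_of_pow_ne_zero (A := A) (left_ne_zero_of_mul hne))
  have hqn : q ∈ nodes G := mem_nodes_of_reach hp'n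
    (reach_of_pow_ne_zero (A := A) (right_ne_zero_of_mul hne))
  have hrb : ∃ d, r + b = γ * d := by
    have : (γ : ℤ) ∣ ((r + b : ℕ) : ℤ) := by
      have := hlz.symm.dvd
      push_cast at this ⊢
      rwa [show (s + t + r - (s + t - b) : ℤ) = r + b by ring] at this
    exact Int.natCast_dvd_natCast.1 this
  obtain ⟨d, hd⟩ := hrb
  have hB := (normalize_bounded A).of_pow γ
  have hC : pow (normalize A) a i p * pow (csrS A G) s p p' ≤ csrC A G i p' := by
    rw [csrC, if_pos hp'n, csrB, ← hγdef]
    refine le_trans ?_ (hB.pow_le_star a i p')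
    rw [pow_pow, ← hs]
    exact (mul_le_mul_right (pow_mono (csrS_le A G) _ _ _) _).trans (pow_mul_le _ _ _ _ _ _)
  have hR : pow (csrS A G) r q p * pow (normalize A) b p j ≤ csrR A G q j := by
    rw [csrR, if_pos hqn, csrB, ← hγdef]
    refine le_trans ?_ (hB.pow_le_star d q j)
    rw [pow_pow, ← hd]
    exact (mul_le_mul_left (pow_mono (csrS_le A G) _ _ _) _).trans (pow_mul_le _ _ _ _ _ _)
  calc pow (normalize A) a i p * pow (normalize A) b p j
      = pow (normalize A) a i p * (pow (csrS A G) s p p' * pow (csrS A G) t p' q *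
          pow (csrS A G) r q p) * pow (normalize A) b p j := by rw [← hq, mul_one]
    _ = (pow (normalize A) a i p * pow (csrS A G) s p p') * pow (csrS A G) t p' q *
          (pow (csrS A G) r q p * pow (normalize A) b p j) := by ring
    _ ≤ csrC A G i p' * pow (csrS A G) t p' q * csrR A G q j := by gcongr
    _ ≤ mul (csrC A G) (pow (csrS A G) t) i q * csrR A G q j := by gcongr; exact le_mul _ _ _ _ _
    _ ≤ _ := le_mul _ _ _ _ _

/-- All maxima and suprema in the term are attained, so it suffices to bound single walks that
consist of a piece from C, a piece of length t inside G and a piece from R. -/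
theorem csr_le {t : ℕ} {i j : Fin n} {X : ℝ≥0}
    (h : ∀ x ∈ nodes G, ∀ y a b, pow (normalize A) (cyclicity G * a) i x *
      pow (csrS A G) t x y * pow (normalize A) (cyclicity G * b) y j ≤ X) :
    csr A G t i j ≤ X := by
  have hB := (normalize_bounded A).of_pow (cyclicity G)
  obtain ⟨y, hy⟩ := exists_mul_eq (mul (csrC A G) (pow (csrS A G) t)) (csrR A G) i j
  obtain ⟨x, hx⟩ := exists_mul_eq (csrC A G) (pow (csrS A G) t) i y
  rw [csr, hy, hx, csrC, csrR]
  split_ifs with h1 h2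
  · obtain ⟨a, ha⟩ := hB.exists_star_eq i x
    obtain ⟨b, hb⟩ := hB.exists_star_eq y j
    rw [pow_pow] at ha hb
    have := h x h1 y a b
    rwa [← ha, ← hb] at this
  all_goals simp

/-- Counterpart of `le_csr`: a free detour x → p → x inside G makes the walk pass through p, and a
closed walk of G at p, of length congruent to -(γa + γb + s₁ + s₂) modulo m, corrects the total
length to t modulo m. -/
theorem walk_through_le (hl : mcgm A ≠ 0) (hG : G ≤ critical A) (h : CompletelyReducible G)
    {p x : Fin n} (hp : p ∈ nodes G) (hpx : Reach G p x) {m : ℕ} (hm : 0 < m) {t : ℕ}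
    {i j : Fin n} {X : ℝ≥0} (hX : ∀ a b, a + b ≡ t [MOD m] →
      pow (normalize A) a i p * pow (normalize A) b p j ≤ X) (y : Fin n) (a b : ℕ) :
    pow (normalize A) (cyclicity G * a) i x * pow (csrS A G) t x y *
      pow (normalize A) (cyclicity G * b) y j ≤ X := by
  set γ := cyclicity G with hγdef
  have hdγ : nodeCyclicity G p ∣ γ := nodeCyclicity_dvd_cyclicity hp
  obtain ⟨s2, hs2⟩ := exists_pow_ne_zero hl hG hpx
  obtain ⟨s1, hs1⟩ := exists_pow_ne_zero hl hG (h.symm hpx)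
  have h1 := pow_csrS_mul_eq_one hl hG hs1 hs2
  have hz : (nodeCyclicity G p : ℤ) ∣ (-(γ * a + γ * b + (s2 + s1) : ℕ) : ℤ) := by
    rw [dvd_neg]
    exact Int.natCast_dvd_natCast.2 (dvd_add (dvd_add (hdγ.mul_right a) (hdγ.mul_right b))
      (nodeCyclicity_dvd_of_closed h (pow_add_ne_zero hs2 hs1) .refl))
  obtain ⟨l, -, hl1, hlz⟩ := exists_closed_modEq hl hG h hp hm hz 0
  refine le_trans ?_ (hX (γ * a + s1 + l) (s2 + t + γ * b) ?_)
  · calc _ = pow (normalize A) (γ * a) i x * (pow (csrS A G) s1 x p * pow (csrS A G) s2 p x) *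
          pow (csrS A G) l p p * pow (csrS A G) t x y * pow (normalize A) (γ * b) y j := by
          rw [h1, hl1, mul_one, mul_one]
      _ = (pow (normalize A) (γ * a) i x * pow (csrS A G) s1 x p * pow (csrS A G) l p p) *
          (pow (csrS A G) s2 p x * pow (csrS A G) t x y * pow (normalize A) (γ * b) y j) := by
          ring
      _ ≤ (pow (normalize A) (γ * a) i x * pow (normalize A) s1 x p * pow (normalize A) l p p) *
          (pow (normalize A) s2 p x * pow (normalize A) t x y *
            pow (normalize A) (γ * b) y j) := by
          gcongr <;> exact pow_mono (csrS_le A G) _ _ _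
      _ ≤ (pow (normalize A) (γ * a + s1) i p * pow (normalize A) l p p) *
          (pow (normalize A) (s2 + t) p y * pow (normalize A) (γ * b) y j) := by
          gcongr <;> exact pow_mul_le _ _ _ _ _ _
      _ ≤ _ := mul_le_mul' (pow_mul_le _ _ _ _ _ _) (pow_mul_le _ _ _ _ _ _)
  · rw [← Int.natCast_modEq_iff, Int.modEq_iff_dvd]
    have := hlz.dvd
    push_cast at this ⊢
    convert this using 1
    ring

/-! ### The Floyd–Warshall algorithm -/

/-- `D` dominates the walks of `M` with inner nodes less than `k`. -/
def Dominates (M : Mat n) (k : ℕ) (D : Mat n) : Prop :=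
  ∀ (l : ℕ) (c : ℕ → Fin n), (∀ e, 0 < e → e < l → (c e : ℕ) < k) → wt M c l ≤ D (c 0) (c l)

theorem dominates_zero {M D : Mat n} (h : ∀ i j, M i j ≤ D i j) (h1 : ∀ i, 1 ≤ D i i) :
    Dominates M 0 D := by
  intro l c hc
  match l with
  | 0 => simpa [wt] using h1 (c 0)
  | 1 => simpa [wt] using h (c 0) (c 1)
  | l + 2 => exact absurd (hc 1 one_pos (by omega)) (by omega)

/-- A walk is split at its first and last visits to k; the part in between is closed and has weight
at most 1. Only lower bounds for `D'` are required, which is what permits updating in place. -/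
theorem Dominates.succ {M D D' : Mat n} (hM : Bounded M) {k : Fin n} (h : Dominates M k D)
    (hD : ∀ i j, D i j ≤ D' i j) (hD' : ∀ i j, D i k * D k j ≤ D' i j) :
    Dominates M (k + 1) D' := by
  classical
  intro l c hc
  by_cases hk : ∃ e, (0 < e ∧ e < l) ∧ c e = k
  · obtain ⟨a, ha, hamin⟩ : ∃ a, ((0 < a ∧ a < l) ∧ c a = k) ∧
        ∀ e, e < a → ¬ ((0 < e ∧ e < l) ∧ c e = k) :=
      ⟨Nat.find hk, Nat.find_spec hk, fun e he => Nat.find_min hk he⟩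
    obtain ⟨b, hb, hbmax⟩ := Finset.exists_max_image
      ((Finset.range l).filter fun e => 0 < e ∧ c e = k) id
      ⟨a, Finset.mem_filter.2 ⟨Finset.mem_range.2 ha.1.2, ha.1.1, ha.2⟩⟩
    simp only [Finset.mem_filter, Finset.mem_range, id] at hb hbmax
    have hab : a ≤ b := hbmax a ⟨ha.1.2, ha.1.1, ha.2⟩
    obtain ⟨d, rfl⟩ := Nat.exists_eq_add_of_le hab
    obtain ⟨r, rfl⟩ := Nat.exists_eq_add_of_le hb.1.le
    rw [wt_add, wt_add]
    have h1 : wt M c a ≤ D (c 0) k := by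
      rw [← ha.2]
      refine h a c fun e he hea => lt_of_le_of_ne ?_ ?_
      · exact Nat.lt_succ_iff.1 (hc e he (by omega))
      · exact fun h' => hamin e hea ⟨⟨he, by omega⟩, Fin.ext h'⟩
    have h2 : wt M (fun e => c (a + e)) d ≤ 1 := by
      refine (wt_le_pow' M c a d).trans ?_
      rw [ha.2, hb.2.2]
      exact hM _ _
    have h3 : wt M (fun e => c (a + d + e)) r ≤ D k (c (a + d + r)) := by
      rw [← hb.2.2]
      refine h r (fun e => c (a + d + e)) fun e he her => lt_of_le_of_ne ?_ ?_
      · exact Nat.lt_succ_iff.1 (hc _ (by omega) (by omega))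
      · intro h'
        have := hbmax (a + d + e) ⟨by omega, by omega, Fin.ext h'⟩
        omega
    calc _ ≤ D (c 0) k * 1 * D k (c (a + d + r)) := by gcongr
      _ ≤ _ := by rw [mul_one]; exact hD' _ _
  · refine (h l c fun e he hel => lt_of_le_of_ne (Nat.lt_succ_iff.1 (hc e he hel)) ?_).trans
      (hD _ _)
    exact fun h' => hk ⟨e, ⟨he, hel⟩, Fin.ext h'⟩

theorem Dominates.star_le {M D : Mat n} (h : Dominates M n D) (i j : Fin n) :
    star M i j ≤ D i j := by
  refine MaxAlg.star_le fun k => ?_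
  by_cases h0 : pow M k i j = 0
  · simp [h0]
  obtain ⟨c, rfl, rfl, hw⟩ := exists_walk M k i j h0
  rw [← hw]
  exact h k c fun e _ _ => (c e).2

end MaxAlg

namespace MaxAlg

variable {n : ℕ}

/-! ### Subroutines on arrays -/

/-- The cell `(i, j, 0)` of a real array. -/
abbrev cell (a : ℕ) (i j : NExpr) : RExpr := .get a i j (.lit 0)

/-- The assignment of `e` to the cell `(i, j, 0)` of a real array. -/
abbrev setCell (a : ℕ) (i j : NExpr) (e : RExpr) : Prog := .setReal a i j (.lit 0) e

/-- The real array number `a` contains the matrix `M`. -/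
def HasMat (s : Store) (a : ℕ) (M : Mat n) : Prop := ∀ i j : Fin n, s.real a i j 0 = M i j

theorem HasMat.congr {s s' : Store} {a : ℕ} {M : Mat n} (h : HasMat s a M)
    (hs : s'.real a = s.real a) : HasMat s' a M := fun i j => by rw [hs]; exact h i j

theorem Runs.setCell {s : Store} {a : ℕ} {i j : NExpr} {e : RExpr} {b : ℕ}
    {Q : Store → Prop} (hb : i.cost + j.cost + e.cost + 2 ≤ b)
    (h : ∀ s' : Store, s'.nat = s.nat →
      (∀ x y z, s'.real a x y z =
        if x = i.eval s ∧ y = j.eval s ∧ z = 0 then e.eval s else s.real a x y z) →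
      Q s') : Runs (MaxAlg.setCell a i j e) s b Q := by
  refine Runs.setReal (by simp only [NExpr.cost]; omega) (h _ rfl fun x y z => ?_)
  simp [Store.setReal, NExpr.eval]

/-- The supremum of the values of `f` at arguments less than `m`. -/
noncomputable def partialSup (m : ℕ) (f : Fin n → ℝ≥0) : ℝ≥0 :=
  Finset.univ.sup fun u : Fin n => if (u : ℕ) < m then f u else 0

theorem partialSup_zero (f : Fin n → ℝ≥0) : partialSup 0 f = 0 := by
  simp [partialSup]

theorem partialSup_succ {m : ℕ} (hm : m < n) (f : Fin n → ℝ≥0) :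
    partialSup (m + 1) f = max (partialSup m f) (f ⟨m, hm⟩) := by
  apply le_antisymm
  · refine Finset.sup_le fun u _ => ?_
    split_ifs with h
    · rcases Nat.lt_succ_iff_lt_or_eq.1 h with h | h
      · refine le_max_of_le_left ?_
        have := Finset.le_sup (f := fun u : Fin n => if (u : ℕ) < m then f u else 0)
          (Finset.mem_univ u)
        rwa [if_pos h] at this
      · exact le_max_of_le_right (le_of_eq (congrArg f (Fin.ext h)))
    · exact zero_le
  · refine max_le (Finset.sup_le fun u _ => ?_) ?_
    · split_ifs with h
      · have := Finset.le_sup (f := fun u : Fin n => if (u : ℕ) < m + 1 then f u else 0)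
          (Finset.mem_univ u)
        rwa [if_pos (by omega)] at this
      · exact zero_le
    · have := Finset.le_sup (f := fun u : Fin n => if (u : ℕ) < m + 1 then f u else 0)
        (Finset.mem_univ ⟨m, hm⟩)
      rwa [if_pos (by simp)] at this

theorem partialSup_self (f : Fin n → ℝ≥0) : partialSup n f = Finset.univ.sup f := by
  simp [partialSup]

/-- `X[x][y] := max_{v < n} e`, where `n` is the integer variable number `0`. -/
def supLoop (v X : ℕ) (x y : NExpr) (e : RExpr) : Prog :=
  .seq (setCell X x y .zero) (forLoop v 0 (setCell X x y (.max (cell X x y) e)))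

/-- The evaluation hypothesis on `e` may use that all cells of `X` except the target are unchanged;
hence one row of an array can be computed from another row of the same array. -/
theorem Runs.supLoop {v X : ℕ} {x y : NExpr} {e : RExpr} {s : Store} {a b : ℕ}
    (f : Fin n → ℝ≥0) (hn : s.nat 0 0 0 0 = n) (hv : v ≠ 0)
    (hx : ∀ s', Agree [v] [X] s s' → x.eval s' = a)
    (hy : ∀ s', Agree [v] [X] s s' → y.eval s' = b)
    (he : ∀ u : Fin n, ∀ s', Agree [v] [X] s s' → s'.nat v 0 0 0 = u →
      (∀ x' y' z', ¬ (x' = a ∧ y' = b ∧ z' = 0) → s'.real X x' y' z' = s.real X x' y' z') →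
      e.eval s' = f u) {c : ℕ} (hc : 3 * (x.cost + y.cost) + e.cost + 50 ≤ c) :
    Runs (MaxAlg.supLoop v X x y e) s (c * (n + 1)) fun s' =>
      ∀ x' y' z', s'.real X x' y' z' =
        if x' = a ∧ y' = b ∧ z' = 0 then Finset.univ.sup f else s.real X x' y' z' := by
  refine Runs.seq (b := (x.cost + y.cost + 3) * 1)
    (b' := (2 * (x.cost + y.cost) + e.cost + 5 + 37) * (n + 1)) (R := fun s' =>
      ∀ x' y' z', s'.real X x' y' z' =
        if x' = a ∧ y' = b ∧ z' = 0 then 0 else s.real X x' y' z') ?_ ?_ ?_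
  · refine Runs.setCell (by simp [RExpr.cost]) fun s' hnat hreal => ?_
    simpa [hx s (.refl _ _ _), hy s (.refl _ _ _), RExpr.eval] using hreal
  · intro s1 ha1 h1
    have ha1' : Agree [v] [X] s s1 := ha1.mono (by simp [Prog.natWrites]) (by simp [Prog.realWrites])
    refine Runs.forLoop (N := n) (c := 2 * (x.cost + y.cost) + e.cost + 5) (M := 1)
      (fun m s' => ∀ x' y' z', s'.real X x' y' z' =
        if x' = a ∧ y' = b ∧ z' = 0 then partialSup m f else s.real X x' y' z')
      ?_ (by simp [Prog.natWrites]) (by simp [Prog.natWrites]) hv.symm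
      (fun _ _ _ h => h) ?_ ?_ ?_ le_rfl le_rfl (by simp)
    · rw [ha1'.nat 0 (by simpa using hv.symm), hn]
    · simpa [partialSup_zero] using h1
    · intro k hk s2 ha2 hkv h2
      have ha2' : Agree [v] [X] s s2 :=
        ha1'.trans (ha2.mono (by simp [Prog.natWrites]) (by simp [Prog.realWrites]))
      refine Runs.setCell (by simp [RExpr.cost, NExpr.cost]; omega) fun s3 hnat hreal => ?_
      intro x' y' z'
      rw [hreal, hx s2 ha2', hy s2 ha2']
      split_ifs with h
      · rw [partialSup_succ hk, RExpr.eval, RExpr.eval, hx s2 ha2', hy s2 ha2',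
          he ⟨k, hk⟩ s2 ha2' hkv (fun x' y' z' h => by rw [h2, if_neg h]), h2,
          if_pos ⟨rfl, rfl, by simp [NExpr.eval]⟩]
      · rw [h2, if_neg h]
    · intro s' _ h
      simpa [partialSup_self] using h
  · have : 1 ≤ n + 1 := by omega
    calc _ ≤ (x.cost + y.cost + 3) * (n + 1) +
          (2 * (x.cost + y.cost) + e.cost + 5 + 37) * (n + 1) := by gcongr
      _ = (3 * (x.cost + y.cost) + e.cost + 45) * (n + 1) := by ring
      _ ≤ _ := by gcongr; omega

/-- `for i < n, j < n do p`, with the loop variables number `10` and `11`. -/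
def forPairs (p : Prog) : Prog := forLoop 10 0 (forLoop 11 0 p)

/-- `J` is an invariant of the whole double loop, `P i j` is what the pass at (i, j) achieves; a
pass has to keep `P` at all lexicographically earlier pairs. Each of the two nested loops adds 37 to
the constant. -/
theorem Runs.forPairs {p : Prog} {s : Store} {c c' : ℕ} (J : Store → Prop)
    (P : Fin n → Fin n → Store → Prop)
    (hn : s.nat 0 0 0 0 = n) (hp : ∀ a ∈ [0, 10, 11], a ∉ p.natWrites)
    (hP : ∀ i j s x, P i j s → P i j (s.setNat 10 0 0 0 x) ∧ P i j (s.setNat 11 0 0 0 x))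
    (hJ : ∀ s x, J s → J (s.setNat 10 0 0 0 x) ∧ J (s.setNat 11 0 0 0 x)) (h0 : J s)
    (body : ∀ i j : Fin n, ∀ s', Agree (10 :: 11 :: p.natWrites) p.realWrites s s' →
      s'.nat 10 0 0 0 = i → s'.nat 11 0 0 0 = j → J s' →
      (∀ i' j' : Fin n, i' < i ∨ i' = i ∧ j' < j → P i' j' s') →
      Runs p s' c fun s'' => J s'' ∧ P i j s'' ∧
        ∀ i' j' : Fin n, i' < i ∨ i' = i ∧ j' < j → P i' j' s'')
    (hc : c + 74 ≤ c') :
    Runs (MaxAlg.forPairs p) s (c' * (n + 1) ^ 2) fun s' => J s' ∧ ∀ i j, P i j s' := by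
  refine Runs.forLoop (N := n) (c := c + 37) (M := n + 1)
    (fun k s' => J s' ∧ ∀ i j : Fin n, (i : ℕ) < k → P i j s') hn ?_ ?_ (by decide)
    (fun k s x h => ⟨(hJ s x h.1).1, fun i j hi => (hP i j s x (h.2 i j hi)).1⟩)
    ⟨h0, fun i j h => by omega⟩
    ?_ (fun s' _ h => ⟨h.1, fun i j => h.2 i j i.2⟩) (by omega) (by omega) (by rw [pow_two])
  · simpa [MaxAlg.forLoop, Prog.natWrites] using hp 0 (by simp)
  · simpa [MaxAlg.forLoop, Prog.natWrites] using hp 10 (by simp)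
  intro i hi s1 ha1 hi1 h1
  have sub : ∀ a ∈ 10 :: (MaxAlg.forLoop 11 0 p).natWrites, a ∈ 10 :: 11 :: p.natWrites := by
    intro a; simp [MaxAlg.forLoop, Prog.natWrites]; tauto
  have ha1' : Agree (10 :: 11 :: p.natWrites) p.realWrites s s1 :=
    ha1.mono sub (by simp [MaxAlg.forLoop, Prog.realWrites])
  refine Runs.forLoop (N := n) (c := c) (M := 1)
    (fun k s' => J s' ∧ ∀ i' j' : Fin n, (i' : ℕ) < i ∨ (i' : ℕ) = i ∧ (j' : ℕ) < k → P i' j' s')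
    ?_ (hp 0 (by simp)) (hp 11 (by simp)) (by decide)
    (fun k s x h => ⟨(hJ s x h.1).2, fun i j hi => (hP i j s x (h.2 i j hi)).2⟩)
    ⟨h1.1, fun i' j' h => h1.2 i' j' (by omega)⟩
    ?_ (fun s' _ h => ⟨h.1, fun i' j' hi' => h.2 i' j' (by omega)⟩) le_rfl le_rfl (by simp)
  · rw [ha1'.nat 0 (by simpa using hp 0 (by simp)), hn]
  intro j hj s2 ha2 hj2 h2
  have h10 : s2.nat 10 0 0 0 = i := by
    rw [ha2.nat 10 (by simpa using hp 10 (by simp)), hi1]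
  rw [mul_one]
  refine (body ⟨i, hi⟩ ⟨j, hj⟩ s2 (ha1'.trans (ha2.mono (by intro a; simp; tauto)
    (List.Subset.refl _))) h10 hj2 h2.1 fun i' j' h => h2.2 i' j' ?_).mono le_rfl
      fun s3 _ h3 => ⟨h3.1, fun i' j' h => ?_⟩
  · simpa [Fin.lt_def, Fin.ext_iff] using h
  · by_cases hh : (i' : ℕ) = i ∧ (j' : ℕ) = j
    · obtain ⟨h4, h5⟩ := hh
      have e1 : i' = ⟨i, hi⟩ := Fin.ext h4
      have e2 : j' = ⟨j, hj⟩ := Fin.ext h5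
      rw [e1, e2]
      exact h3.2.1
    · refine h3.2.2 i' j' ?_
      simp only [Fin.lt_def, Fin.ext_iff]
      omega

/-- `X[i][j] := if b then e else e'` for `i, j < n`. -/
def fill (X : ℕ) (b : Test) (e e' : RExpr) : Prog :=
  forPairs (.ite b (setCell X (var 10) (var 11) e) (setCell X (var 10) (var 11) e'))

theorem Runs.fill {X : ℕ} {b : Test} {e e' : RExpr} {s : Store} {c : ℕ} (M : Mat n)
    (hn : s.nat 0 0 0 0 = n)
    (h : ∀ i j : Fin n, ∀ s', Agree [10, 11] [X] s s' → s'.nat 10 0 0 0 = i →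
      s'.nat 11 0 0 0 = j →
      (b.Holds s' → e.eval s' = M i j) ∧ (¬ b.Holds s' → e'.eval s' = M i j))
    (hc : b.cost + e.cost + e'.cost + 100 ≤ c) :
    Runs (MaxAlg.fill X b e e') s (c * (n + 1) ^ 2) fun s' => HasMat s' X M := by
  refine (Runs.forPairs (c := b.cost + e.cost + e'.cost + 20) (fun _ => True)
    (fun i j s' => s'.real X i j 0 = M i j) hn (by simp [Prog.natWrites])
    (fun _ _ _ _ h => ⟨h, h⟩) (fun _ _ h => ⟨h, h⟩) trivial ?_ (by omega)).mono le_rfl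
    fun _ _ h => h.2
  intro i j s1 ha hi hj _ hprev
  have ha' : Agree [10, 11] [X] s s1 :=
    ha.mono (by simp [Prog.natWrites]) (by simp [Prog.realWrites])
  have fin : ∀ s2 : Store, (∀ x y z, s2.real X x y z =
      if x = (i : ℕ) ∧ y = (j : ℕ) ∧ z = 0 then M i j else s1.real X x y z) →
      True ∧ s2.real X i j 0 = M i j ∧
        ∀ i' j' : Fin n, i' < i ∨ i' = i ∧ j' < j → s2.real X i' j' 0 = M i' j' := by
    intro s2 h2
    refine ⟨trivial, by simp [h2], fun i' j' h => ?_⟩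
    rw [h2]
    split_ifs with hh
    · rw [Fin.ext hh.1, Fin.ext hh.2.1]
    · exact hprev i' j' h
  refine Runs.ite (B := e.cost + e'.cost + 10) (fun hb => ?_) (fun hb => ?_) (by omega)
  · refine Runs.setCell (by simp [NExpr.cost]; omega) fun s2 _ h2 => fin s2 ?_
    simpa [NExpr.eval, hi, hj, (h i j s1 ha' hi hj).1 hb] using h2
  · refine Runs.setCell (by simp [NExpr.cost]; omega) fun s2 _ h2 => fin s2 ?_
    simpa [NExpr.eval, hi, hj, (h i j s1 ha' hi hj).2 hb] using h2

/-- Repeated multiplication of the row `0` of the array `Y` by the matrix in the array `X`; the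
results are the rows `1`, …, `l` of `Y`. -/
def iterateRows (X Y l : ℕ) : Prog :=
  forLoop 10 l (forLoop 11 0 (supLoop 12 Y (.add (var 10) (.lit 1)) (var 11)
    (.mul (cell Y (var 10) (var 12)) (cell X (var 12) (var 11)))))

/-- Stated for an arbitrary sequence `y` obeying the recursion: the start vector of ones gives the
walk weights in Karp's formula, a unit vector gives a row of the powers. -/
theorem Runs.iterateRows {X Y l L : ℕ} {s : Store} {A : Mat n} (y : ℕ → Fin n → ℝ≥0)
    (hy : ∀ k v, y (k + 1) v = Finset.univ.sup fun u => y k u * A u v)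
    (hn : s.nat 0 0 0 0 = n) (hL : s.nat l 0 0 0 = L) (hl : l ∉ [10, 11, 12]) (hXY : X ≠ Y)
    (hX : HasMat s X A) (h0 : ∀ v : Fin n, s.real Y 0 v 0 = y 0 v) :
    Runs (MaxAlg.iterateRows X Y l) s (250 * ((L + 1) * (n + 1) ^ 2)) fun s' =>
      ∀ k ≤ L, ∀ v : Fin n, s'.real Y k v 0 = y k v := by
  have hl' : l ≠ 10 ∧ l ≠ 11 ∧ l ≠ 12 := by simpa using hl
  refine Runs.forLoop (N := L) (c := 200) (M := (n + 1) ^ 2)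
    (fun m s' => ∀ k ≤ m, ∀ v : Fin n, s'.real Y k v 0 = y k v) hL ?_ ?_ hl'.1
    (fun _ _ _ h => h) ?_ ?_ (fun _ _ h => h) (Nat.one_le_pow _ _ (by omega)) (by norm_num) le_rfl
  · simp [MaxAlg.forLoop, MaxAlg.supLoop, Prog.natWrites, hl']
  · simp [MaxAlg.forLoop, MaxAlg.supLoop, Prog.natWrites]
  · intro k hk v
    obtain rfl : k = 0 := by omega
    exact h0 v
  intro k hk s1 ha1 hk1 h1
  have ha1' : Agree [10, 11, 12] [Y] s s1 := ha1.mono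
    (by simp [MaxAlg.forLoop, MaxAlg.supLoop, Prog.natWrites])
    (by simp [MaxAlg.forLoop, MaxAlg.supLoop, Prog.realWrites])
  refine Runs.forLoop (N := n) (c := 150) (M := n + 1)
    (fun m s' => (∀ v : Fin n, (v : ℕ) < m → s'.real Y (k + 1) v 0 = y (k + 1) v) ∧
      ∀ k' ≤ k, ∀ v : Fin n, s'.real Y k' v 0 = y k' v) ?_ ?_ ?_ (by decide)
    (fun _ _ _ h => h) ⟨fun v hv => by omega, h1⟩ ?_ ?_ (by omega) (by norm_num) (by rw [pow_two])
  · rw [ha1'.nat 0 (by simp), hn]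
  · simp [MaxAlg.forLoop, MaxAlg.supLoop, Prog.natWrites]
  · simp [MaxAlg.forLoop, MaxAlg.supLoop, Prog.natWrites]
  · intro v hv s2 ha2 hv2 h2
    have ha2' : Agree [11, 12] [Y] s1 s2 := ha2.mono
      (by simp [MaxAlg.forLoop, MaxAlg.supLoop, Prog.natWrites])
      (by simp [MaxAlg.forLoop, MaxAlg.supLoop, Prog.realWrites])
    have hk2 : s2.nat 10 0 0 0 = k := by rw [ha2'.nat 10 (by simp), hk1]
    have hX2 : HasMat s2 X A := hX.congr
      ((ha2'.real X (by simpa using hXY)).trans (ha1'.real X (by simpa using hXY)))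
    refine (Runs.supLoop (n := n) (a := k + 1) (b := v) (fun u => y k u * A u ⟨v, hv⟩)
      (by rw [ha2'.nat 0 (by simp), ha1'.nat 0 (by simp), hn]) (by decide) ?_ ?_ ?_ (c := 150)
      (by simp [NExpr.cost, RExpr.cost])).mono le_rfl ?_
    · intro s' ha; simp [NExpr.eval, ha.nat 10 (by simp), hk2]
    · intro s' ha; simp [NExpr.eval, ha.nat 11 (by simp), hv2]
    · intro u s' ha hu hsame
      simp only [RExpr.eval, NExpr.eval, ha.nat 10 (by simp), ha.nat 11 (by simp), hk2, hv2, hu]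
      rw [hsame _ _ _ (by omega), h2.2 k le_rfl, ha.real X (by simpa using hXY)]
      congr 1
      exact hX2 u ⟨v, hv⟩
    · intro s3 _ h3
      refine ⟨fun v' hv' => ?_, fun k' hk' v' => ?_⟩
      · rw [h3]
        split_ifs with h
        · rw [hy, show v' = ⟨v, hv⟩ from Fin.ext h.2.1]
        · exact h2.1 v' (by omega)
      · rw [h3, if_neg (by omega)]
        exact h2.2 k' hk' v'
  · intro s2 _ h2 k' hk' v
    rcases Nat.lt_succ_iff_lt_or_eq.1 (Nat.lt_succ_of_le hk') with h | rfl
    · exact h2.2 k' (by omega) v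
    · exact h2.1 v v.2

end MaxAlg

/-! ### Programs for the Kleene star and for Karp's formula -/

namespace MaxAlg

variable {n : ℕ}

/-- The Floyd–Warshall algorithm for the Kleene star, in place. -/
def floydWarshall (X : ℕ) : Prog :=
  .seq (forLoop 10 0 (setCell X (var 10) (var 10) (.max (cell X (var 10) (var 10)) .one)))
    (forLoop 12 0 (forPairs (setCell X (var 10) (var 11) (.max (cell X (var 10) (var 11))
      (.mul (cell X (var 10) (var 12)) (cell X (var 12) (var 11)))))))

/-- Two one-sided invariants: the entries never exceed the star, and they dominate the walks with
inner nodes below k. Entries only grow within a pass, so reading values that were already updated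
harms neither. -/
theorem Runs.floydWarshall {X : ℕ} {s : Store} {M : Mat n} (hM : Bounded M)
    (hn : s.nat 0 0 0 0 = n) (hX : HasMat s X M) :
    Runs (MaxAlg.floydWarshall X) s (300 * (n + 1) ^ 3) fun s' => HasMat s' X (star M) := by
  refine Runs.seq (b := 80 * (n + 1)) (b' := 200 * (n + 1) ^ 3)
    (R := fun s' => ∀ i j : Fin n, s'.real X i j 0 = if i = j then max (M i j) 1 else M i j)
    ?_ ?_ ?_
  · refine Runs.forLoop (N := n) (c := 40) (M := 1)
      (fun k s' => ∀ i j : Fin n, s'.real X i j 0 =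
        if i = j ∧ (i : ℕ) < k then max (M i j) 1 else M i j) hn (by simp [Prog.natWrites])
      (by simp [Prog.natWrites]) (by decide) (fun _ _ _ h => h) (fun i j => ?_) ?_
      (fun s' _ h i j => ?_) le_rfl (by norm_num) (by simp)
    · simpa using hX i j
    · intro k hk s1 ha hk1 h1
      refine Runs.setCell (by simp [NExpr.cost, RExpr.cost]) fun s2 _ h2 i j => ?_
      simp only [NExpr.eval, RExpr.eval, hk1] at h2
      rw [h2]
      split_ifs with h3 h4 h4
      · have e1 : i = ⟨k, hk⟩ := Fin.ext h3.1
        have e2 : j = ⟨k, hk⟩ := Fin.ext h3.2.1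
        have := h1 ⟨k, hk⟩ ⟨k, hk⟩
        simp only [lt_irrefl, and_false, if_false] at this
        rw [this, e1, e2]
      · exact absurd ⟨Fin.ext (h3.1.trans h3.2.1.symm), by omega⟩ h4
      · have h5 : (i : ℕ) < k := by
          by_contra h5
          have h6 := congrArg Fin.val h4.1
          exact h3 ⟨by omega, by omega, rfl⟩
        rw [h1, if_pos ⟨h4.1, h5⟩]
      · rw [h1, if_neg]
        exact fun h5 => h4 ⟨h5.1, by omega⟩
    · simpa using h i j
  · intro s1 ha1 h1
    refine Runs.forLoop (N := n) (c := 130) (M := (n + 1) ^ 2)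
      (fun k s' => (∀ i j : Fin n, s'.real X i j 0 ≤ star M i j) ∧
        Dominates M k fun i j => s'.real X i j 0) ?_
      (by simp [MaxAlg.forPairs, MaxAlg.forLoop, Prog.natWrites])
      (by simp [MaxAlg.forPairs, MaxAlg.forLoop, Prog.natWrites]) (by decide)
      (fun _ _ _ h => h) ⟨fun i j => ?_, dominates_zero (fun i j => ?_) (fun i => ?_)⟩ ?_ ?_
      (Nat.one_le_pow _ _ (by omega)) (by norm_num) (by rw [pow_succ' _ 2])
    · rw [ha1.nat 0 (by simp [MaxAlg.forLoop, Prog.natWrites]), hn]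
    · rw [h1]
      split_ifs with h
      · subst h; exact max_le (hM.le_star _ _) (hM.one_le_star _)
      · exact hM.le_star _ _
    · rw [h1]; split_ifs <;> simp
    · rw [h1]; simp
    · intro k hk s2 ha2 hk2 h2
      refine (Runs.forPairs (n := n) (c := 50)
        (fun s' => (∀ i j : Fin n, s'.real X i j 0 ≤ star M i j) ∧
          ∀ i j : Fin n, s2.real X i j 0 ≤ s'.real X i j 0)
        (fun i j s' => s2.real X i k 0 * s2.real X k j 0 ≤ s'.real X i j 0)
        ?_ (by simp [Prog.natWrites]) (fun _ _ _ _ h => ⟨h, h⟩) (fun _ _ h => ⟨h, h⟩)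
        ⟨h2.1, fun _ _ => le_rfl⟩ ?_ (by norm_num)).mono le_rfl ?_
      · rw [ha2.nat 0 (by simp [MaxAlg.forPairs, MaxAlg.forLoop, Prog.natWrites]),
          ha1.nat 0 (by simp [MaxAlg.forLoop, Prog.natWrites]), hn]
      · intro i j s3 ha3 hi hj hJ hprev
        have h12 : s3.nat 12 0 0 0 = k := by rw [ha3.nat 12 (by simp [Prog.natWrites]), hk2]
        refine Runs.setCell (by simp [NExpr.cost, RExpr.cost]) fun s4 _ h4 => ?_
        simp only [NExpr.eval, RExpr.eval, h12, hi, hj] at h4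
        have hmono : ∀ x y z, s3.real X x y z ≤ s4.real X x y z := by
          intro x y z
          rw [h4]
          split_ifs with h5
          · obtain ⟨rfl, rfl, rfl⟩ := h5; exact le_max_left _ _
          · exact le_rfl
        refine ⟨⟨fun i' j' => ?_, fun i' j' => (hJ.2 i' j').trans (hmono _ _ _)⟩, ?_,
          fun i' j' h => (hprev i' j' h).trans (hmono _ _ _)⟩
        · rw [h4]
          split_ifs with h5
          · have e1 : i' = i := Fin.ext h5.1
            have e2 : j' = j := Fin.ext h5.2.1
            rw [e1, e2]
            exact max_le (hJ.1 _ _) ((mul_le_mul' (hJ.1 i ⟨k, hk⟩) (hJ.1 ⟨k, hk⟩ j)).trans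
              (hM.star_mul_star _ _ _))
          · exact hJ.1 _ _
        · rw [h4, if_pos ⟨rfl, rfl, rfl⟩]
          exact le_max_of_le_right (mul_le_mul' (hJ.2 i ⟨k, hk⟩) (hJ.2 ⟨k, hk⟩ j))
      · intro s3 _ h3
        exact ⟨h3.1.1, Dominates.succ (k := ⟨k, hk⟩) hM h2.2 h3.1.2 h3.2⟩
    · intro s2 _ h2 i j
      exact le_antisymm (h2.1 i j) (h2.2.star_le i j)
  · have h1 : n + 1 ≤ (n + 1) ^ 3 := Nat.le_self_pow (by norm_num) _
    omega

theorem range_sup_eq (f : ℕ → ℝ≥0) :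
    (Finset.range n).sup f = Finset.univ.sup fun k : Fin n => f k := by
  apply le_antisymm
  · refine Finset.sup_le fun k hk => ?_
    exact Finset.le_sup (f := fun k : Fin n => f k)
      (Finset.mem_univ (⟨k, Finset.mem_range.1 hk⟩ : Fin n))
  · exact Finset.sup_le fun k _ => Finset.le_sup (Finset.mem_range.2 k.2)

theorem karpNode_eq (A : Mat n) (v : Fin n) : karpNode A v =
    Finset.univ.sup fun k : Fin n =>
      (ending A k v / ending A n v) ^ (1 / ((n - k : ℕ) : ℝ)) :=
  range_sup_eq fun k => (ending A k v / ending A n v) ^ (1 / ((n - k : ℕ) : ℝ))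

/-- Karp's algorithm: the maximum cycle geometric mean of the matrix in the array `14` is
stored in the array `9`. -/
def karpProg : Prog :=
  .seq (forLoop 10 0 (setCell 5 (.lit 0) (var 10) .one))
  (.seq (iterateRows 14 5 0)
  (.seq (setCell 9 (.lit 0) (.lit 0) .zero)
    (forLoop 10 0 (.ite (.not (.realLe (cell 5 (var 0) (var 10)) .zero))
      (.seq
        (supLoop 11 15 (.lit 0) (.lit 0) (.root
          (.div (cell 5 (var 11) (var 10)) (cell 5 (var 0) (var 10))) (.sub (var 0) (var 11))))
        (setCell 9 (.lit 0) (.lit 0)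
          (.max (cell 9 (.lit 0) (.lit 0)) (.div .one (cell 15 (.lit 0) (.lit 0))))))
      .skip))))

theorem Runs.karpProg {s : Store} {A : Mat n} (hn : s.nat 0 0 0 0 = n) (hA : HasMat s 14 A) :
    Runs MaxAlg.karpProg s (1000 * (n + 1) ^ 3) fun s' => s'.real 9 0 0 0 = mcgm A := by
  refine Runs.seq (b := 80 * (n + 1)) (b' := 900 * (n + 1) ^ 3)
    (R := fun s' => ∀ v : Fin n, s'.real 5 0 v 0 = 1) ?_ ?_ ?_
  · refine Runs.forLoop (N := n) (c := 40) (M := 1)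
      (fun k s' => ∀ v : Fin n, (v : ℕ) < k → s'.real 5 0 v 0 = 1) hn (by simp [Prog.natWrites])
      (by simp [Prog.natWrites]) (by decide) (fun _ _ _ h => h) (fun v hv => by omega) ?_
      (fun s' _ h v => h v v.2) le_rfl (by norm_num) (by simp)
    intro k hk s1 ha hk1 h1
    refine Runs.setCell (by simp [NExpr.cost, RExpr.cost]) fun s2 _ h2 v hv => ?_
    simp only [NExpr.eval, RExpr.eval, hk1] at h2
    rw [h2]
    split_ifs with h3
    · rfl
    · exact h1 v (by omega)
  · intro s1 ha1 h1
    have hn1 : s1.nat 0 0 0 0 = n := by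
      rw [ha1.nat 0 (by simp [MaxAlg.forLoop, Prog.natWrites]), hn]
    refine Runs.seq (Runs.iterateRows (ending A) (ending_succ A) hn1 hn1 (by decide)
      (by decide) (hA.congr (ha1.real 14 (by simp [MaxAlg.forLoop, Prog.realWrites])))
      (fun v => by rw [h1, ending_zero])) (b' := 400 * (n + 1) ^ 3) ?_ ?_
    rotate_left
    · rw [show (n + 1) * (n + 1) ^ 2 = (n + 1) ^ 3 by ring]; omega
    intro s2 ha2 h2
    have hn2 : s2.nat 0 0 0 0 = n := by rw [ha2.nat 0 (by decide), hn1]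
    refine Runs.seq (b := 20) (b' := 350 * (n + 1) ^ 2) (R := fun s' => s'.real 9 0 0 0 = 0 ∧
      ∀ k ≤ n, ∀ v : Fin n, s'.real 5 k v 0 = ending A k v) ?_ ?_ ?_
    · refine Runs.setReal (by simp [NExpr.cost, RExpr.cost]) ⟨?_, ?_⟩
      · simp [NExpr.eval, RExpr.eval]
      · simpa [Store.setReal_real, NExpr.eval, RExpr.eval] using h2
    · intro s3 ha3 h3
      have hn3 : s3.nat 0 0 0 0 = n := by rw [ha3.nat 0 (by decide), hn2]
      refine Runs.forLoop (N := n) (c := 300) (M := n + 1)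
        (fun k s' => s'.real 9 0 0 0 = partialSup k (fun v => (karpNode A v)⁻¹) ∧
          ∀ k ≤ n, ∀ v : Fin n, s'.real 5 k v 0 = ending A k v) hn3 (by decide) (by decide)
        (by decide) (fun _ _ _ h => h) ⟨by rw [h3.1, partialSup_zero], h3.2⟩ ?_ ?_ (by omega)
        (by norm_num) (by rw [pow_two])
      · intro v hv s4 ha4 hv4 h4
        have hn4 : s4.nat 0 0 0 0 = n := by rw [ha4.nat 0 (by decide), hn3]
        refine Runs.ite (B := 250 * (n + 1)) (fun hb => ?_) (fun hb => ?_)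
          (by simp [Test.cost, NExpr.cost, RExpr.cost]; omega)
        · refine Runs.seq (Runs.supLoop (n := n) (a := 0) (b := 0) (c := 150) (fun k =>
            (ending A k ⟨v, hv⟩ / ending A n ⟨v, hv⟩) ^ (1 / ((n - k : ℕ) : ℝ))) hn4 (by decide)
            (fun _ _ => rfl) (fun _ _ => rfl) ?_ (by simp [NExpr.cost, RExpr.cost]))
            (b' := 40) ?_ (by omega)
          · intro k s' ha hk _
            simp only [RExpr.eval, NExpr.eval, hk, ha.nat 10 (by decide), ha.nat 0 (by decide),
              hv4, hn4, ha.real 5 (by decide)]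
            rw [← h4.2 k k.2.le ⟨v, hv⟩, ← h4.2 n le_rfl ⟨v, hv⟩]
          · intro s5 ha5 h5
            rw [← karpNode_eq] at h5
            refine Runs.setReal (by simp [NExpr.cost, RExpr.cost]) ⟨?_, ?_⟩
            · rw [partialSup_succ hv]
              simp [NExpr.eval, RExpr.eval, h5, ha5.real 9 (by decide), h4.1]
            · simpa [Store.setReal_real, NExpr.eval, RExpr.eval, ha5.real 5 (by decide)]
                using h4.2
        -- No walk of length n ends at v: `karpNode` is 0, and its inverse 0 does not affect the
        -- maximum.
        · refine Runs.skip (by omega) ⟨?_, h4.2⟩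
          have h0 : ending A n ⟨v, hv⟩ = 0 := by
            simpa [Test.Holds, RExpr.eval, NExpr.eval, hn4, hv4, h4.2 n le_rfl ⟨v, hv⟩] using hb
          have h00 : karpNode A ⟨v, hv⟩ = 0 := by
            refine le_antisymm (Finset.sup_le fun k hk => ?_) zero_le
            rw [Finset.mem_range] at hk
            rw [h0, div_zero, rpow_inv_le_iff (by omega)]
            exact zero_le
          rw [partialSup_succ hv, h4.1, h00]
          simp
      · intro s' _ h
        rw [h.1, partialSup_self, ← karp]
    · have h1 : 1 ≤ (n + 1) ^ 2 := Nat.one_le_pow _ _ (by omega)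
      have h2 : (n + 1) ^ 2 ≤ (n + 1) ^ 3 := Nat.pow_le_pow_right (by omega) (by norm_num)
      omega
  · have h1 : n + 1 ≤ (n + 1) ^ 3 := Nat.le_self_pow (by norm_num) _
    omega

end MaxAlg

/-! ### Shortest closed walks and reachability inside G -/

namespace MaxAlg

variable {n : ℕ}

/-- Row `0` of the array `Y` becomes the unit vector of the node in the variable `13`. -/
def unitRow (Y : ℕ) : Prog :=
  forLoop 10 0 (.ite (.and (.natLe (var 10) (var 13)) (.natLe (var 13) (var 10)))
    (setCell Y (.lit 0) (var 10) .one) (setCell Y (.lit 0) (var 10) .zero))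

theorem Runs.unitRow {s : Store} {Y : ℕ} {p : Fin n} (A : Mat n) (hn : s.nat 0 0 0 0 = n)
    (hp : s.nat 13 0 0 0 = p) :
    Runs (MaxAlg.unitRow Y) s (100 * (n + 1)) fun s' =>
      ∀ v : Fin n, s'.real Y 0 v 0 = pow A 0 p v := by
  refine Runs.forLoop (N := n) (c := 50) (M := 1)
    (fun k s' => ∀ v : Fin n, (v : ℕ) < k → s'.real Y 0 v 0 = pow A 0 p v) hn
    (by simp [Prog.natWrites]) (by simp [Prog.natWrites]) (by decide) (fun _ _ _ h => h)
    (fun v hv => by omega) ?_ (fun s' _ h v => h v v.2) le_rfl (by norm_num) (by simp)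
  intro k hk s1 ha hk1 h1
  have h13 : s1.nat 13 0 0 0 = p := by rw [ha.nat 13 (by simp [Prog.natWrites]), hp]
  have fin : ∀ s2 : Store, (∀ x y z, s2.real Y x y z =
      if x = 0 ∧ y = k ∧ z = 0 then pow A 0 p ⟨k, hk⟩ else s1.real Y x y z) →
      ∀ v : Fin n, (v : ℕ) < k + 1 → s2.real Y 0 v 0 = pow A 0 p v := by
    intro s2 h2 v hv
    rw [h2]
    split_ifs with h3
    · rw [show v = ⟨k, hk⟩ from Fin.ext h3.2.1]
    · exact h1 v (by omega)
  refine Runs.ite (B := 20) (fun hb => ?_) (fun hb => ?_)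
    (by simp [Test.cost, NExpr.cost])
  · refine Runs.setCell (by simp [NExpr.cost, RExpr.cost]) fun s2 _ h2 => fin s2 ?_
    simp only [Test.Holds, NExpr.eval, h13, hk1] at hb
    have : p = ⟨k, hk⟩ := Fin.ext (by simp; omega)
    simpa [NExpr.eval, RExpr.eval, hk1, ← this, pow_zero_self] using h2
  · refine Runs.setCell (by simp [NExpr.cost, RExpr.cost]) fun s2 _ h2 => fin s2 ?_
    simp only [Test.Holds, NExpr.eval, h13, hk1] at hb
    have : p ≠ ⟨k, hk⟩ := fun h => hb (by rw [h]; exact ⟨le_rfl, le_rfl⟩)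
    simpa [NExpr.eval, RExpr.eval, hk1, this, pow, one] using h2

/-- The rows of the array `Y` become the rows of node `p` (variable `13`) of the powers of the
matrix in the array `X`, up to the exponent in the variable `l`. -/
def powerRows (X Y l : ℕ) : Prog := .seq (unitRow Y) (iterateRows X Y l)

theorem Runs.powerRows {X Y l L : ℕ} {s : Store} {A : Mat n} {p : Fin n}
    (hn : s.nat 0 0 0 0 = n) (hp : s.nat 13 0 0 0 = p) (hL : s.nat l 0 0 0 = L)
    (hl : l ∉ [10, 11, 12]) (hXY : X ≠ Y) (hX : HasMat s X A) :
    Runs (MaxAlg.powerRows X Y l) s (350 * ((L + 1) * (n + 1) ^ 2)) fun s' =>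
      ∀ k ≤ L, ∀ v : Fin n, s'.real Y k v 0 = pow A k p v := by
  have hl' : l ≠ 10 ∧ l ≠ 11 ∧ l ≠ 12 := by simpa using hl
  refine Runs.seq (Runs.unitRow A hn hp) (fun s1 ha h1 => Runs.iterateRows (A := A)
    (fun k v => pow A k p v) (fun k v => rfl) ?_ ?_ hl hXY (hX.congr (ha.real X ?_)) h1) ?_
  · rw [ha.nat 0 (by simp [MaxAlg.unitRow, MaxAlg.forLoop, Prog.natWrites]), hn]
  · rw [ha.nat l (by simp [MaxAlg.unitRow, MaxAlg.forLoop, Prog.natWrites, hl']), hL]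
  · simpa [MaxAlg.unitRow, MaxAlg.forLoop, Prog.realWrites] using hXY
  · have h1 : n + 1 ≤ (n + 1) ^ 2 := Nat.le_self_pow (by norm_num) _
    have h2 : 1 * (n + 1) ^ 2 ≤ (L + 1) * (n + 1) ^ 2 := Nat.mul_le_mul_right _ (by omega)
    omega

/-- For the node `p` in the variable `13` and the matrix in the array `4`, find the least
positive length of a closed walk through `p` and mark all nodes that are reachable
from `p`. -/
def findCycle : Prog :=
  .seq (powerRows 4 5 0)
  (.seq (.setNat 5 (.lit 0) (.lit 0) (.lit 0) (.lit 0))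
  (.seq (forLoop 10 0 (.ite (.and (.natLe (var 5) (.lit 0))
      (.not (.realLe (cell 5 (.add (var 10) (.lit 1)) (var 13)) .zero)))
      (.setNat 5 (.lit 0) (.lit 0) (.lit 0) (.add (var 10) (.lit 1))) .skip))
    (forPairs (.ite (.not (.realLe (cell 5 (.add (var 10) (.lit 1)) (var 11)) .zero))
      (.setNat 4 (var 11) (.lit 0) (.lit 0) (.lit 1)) .skip))))

/-- The value 0 in the integer variable 5 means that no closed walk has been found yet; this is
unambiguous because the lengths in question are positive. Marks are only added, so those of
components treated earlier survive. -/
theorem Runs.findCycle {s : Store} {A : Mat n} {p : Fin n} (hn : s.nat 0 0 0 0 = n)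
    (hp : s.nat 13 0 0 0 = p) (hA : HasMat s 4 A)
    (hex : ∃ k, 1 ≤ k ∧ k ≤ n ∧ pow A k p p ≠ 0) :
    Runs MaxAlg.findCycle s (800 * (n + 1) ^ 3) fun s' =>
      (∃ m, s'.nat 5 0 0 0 = m ∧ 1 ≤ m ∧ m ≤ n ∧ pow A m p p ≠ 0 ∧
        ∀ k, 1 ≤ k → k < m → pow A k p p = 0) ∧
      ∀ q : Fin n, ((∃ k, 1 ≤ k ∧ k ≤ n ∧ pow A k p q ≠ 0) → s'.nat 4 q 0 0 = 1) ∧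
        ((¬ ∃ k, 1 ≤ k ∧ k ≤ n ∧ pow A k p q ≠ 0) → s'.nat 4 q 0 0 = s.nat 4 q 0 0) := by
  refine Runs.seq (Runs.powerRows hn hp hn (by decide) (by decide) hA)
    (b' := 400 * (n + 1) ^ 3) ?_ (by
      rw [show (n + 1) * (n + 1) ^ 2 = (n + 1) ^ 3 by ring]; omega)
  intro s1 ha1 h1
  have hn1 : s1.nat 0 0 0 0 = n := by rw [ha1.nat 0 (by decide), hn]
  have hp1 : s1.nat 13 0 0 0 = p := by rw [ha1.nat 13 (by decide), hp]
  refine Runs.seq (b := 10) (b' := 350 * (n + 1) ^ 2)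
    (R := fun s' => s'.nat 5 0 0 0 = 0 ∧ s'.real = s1.real)
    (Runs.setNat (by simp [NExpr.cost]) ⟨by simp [NExpr.eval], rfl⟩) ?_ ?_
  rotate_left
  · have h1 : 1 ≤ (n + 1) ^ 2 := Nat.one_le_pow _ _ (by omega)
    have h2 : (n + 1) ^ 2 ≤ (n + 1) ^ 3 := Nat.pow_le_pow_right (by omega) (by norm_num)
    omega
  intro s2 ha2 h2
  have hn2 : s2.nat 0 0 0 0 = n := by rw [ha2.nat 0 (by decide), hn1]
  have hp2 : s2.nat 13 0 0 0 = p := by rw [ha2.nat 13 (by decide), hp1]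
  refine Runs.seq (b := 100 * (n + 1)) (b' := 200 * (n + 1) ^ 2)
    (R := fun s' => ∃ m, s'.nat 5 0 0 0 = m ∧ 1 ≤ m ∧ m ≤ n ∧ pow A m p p ≠ 0 ∧
        ∀ k, 1 ≤ k → k < m → pow A k p p = 0) ?_ ?_ ?_
  · refine Runs.forLoop (N := n) (c := 60) (M := 1)
      (fun k s' => (s'.nat 5 0 0 0 = 0 ∧ ∀ j, 1 ≤ j → j ≤ k → pow A j p p = 0) ∨
        ∃ m, s'.nat 5 0 0 0 = m ∧ 1 ≤ m ∧ m ≤ n ∧ pow A m p p ≠ 0 ∧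
        ∀ k, 1 ≤ k → k < m → pow A k p p = 0) hn2
      (by decide) (by decide) (by decide) ?_ (.inl ⟨h2.1, fun j _ _ => by omega⟩) ?_ ?_
      le_rfl (by norm_num) (by simp)
    · intro k s x h
      simpa [Store.setNat_nat] using h
    · intro k hk s3 ha3 hk3 h3
      have hp3 : s3.nat 13 0 0 0 = p := by rw [ha3.nat 13 (by decide), hp2]
      have hr : s3.real 5 (k + 1) p 0 = pow A (k + 1) p p := by
        rw [ha3.real 5 (by decide), h2.2, h1 (k + 1) (by omega)]
      refine Runs.ite (B := 20) (fun hb => ?_) (fun hb => ?_)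
        (by simp [Test.cost, NExpr.cost, RExpr.cost])
      · simp only [Test.Holds, NExpr.eval, RExpr.eval, hk3, hp3, hr] at hb
        refine Runs.setNat (by simp [NExpr.cost]) ?_
        rcases h3 with h3 | ⟨m, h3, h4, -⟩
        · exact .inr ⟨k + 1, by simp [NExpr.eval, hk3], by omega, by omega,
            fun h => hb.2 h.le, fun j hj hjk => h3.2 j hj (by omega)⟩
        · omega
      · simp only [Test.Holds, NExpr.eval, RExpr.eval, hk3, hp3, hr] at hb
        refine Runs.skip (by omega) ?_
        rcases h3 with h3 | h3
        · refine .inl ⟨h3.1, fun j hj hjk => ?_⟩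
          rcases Nat.lt_succ_iff_lt_or_eq.1 (Nat.lt_succ_of_le hjk) with h | rfl
          · exact h3.2 j hj (by omega)
          · by_contra h0
            exact hb ⟨by omega, fun h => h0 (le_antisymm h zero_le)⟩
        · exact .inr h3
    · rintro s' - (h | h)
      · obtain ⟨k, hk1, hk2, hk⟩ := hex
        exact (hk (h.2 k hk1 hk2)).elim
      · exact h
  · intro s3 ha3 h3
    have hn3 : s3.nat 0 0 0 0 = n := by rw [ha3.nat 0 (by decide), hn2]
    have h4 : ∀ q, s3.nat 4 q 0 0 = s.nat 4 q 0 0 := by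
      intro q
      rw [ha3.nat 4 (by decide), ha2.nat 4 (by decide), ha1.nat 4 (by decide)]
    refine Runs.mono (b := 200 * (n + 1) ^ 2) (Runs.forPairs (c := 60) (fun s' => ∀ q : Fin n,
        s'.nat 4 q 0 0 = s.nat 4 q 0 0 ∨
          (s'.nat 4 q 0 0 = 1 ∧ ∃ k, 1 ≤ k ∧ k ≤ n ∧ pow A k p q ≠ 0))
      (fun k q s' => pow A (k + 1) p q ≠ 0 → s'.nat 4 q 0 0 = 1) hn3 (by decide) ?_ ?_ ?_ ?_
      (by norm_num)) le_rfl ?_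
    · intro i j s x h
      simpa [Store.setNat_nat] using h
    · intro s x h
      simpa [Store.setNat_nat] using h
    · exact fun q => .inl (h4 q)
    · intro k q s4 ha4 hk4 hq4 hJ hP
      have hr : s4.real 5 (k + 1) q 0 = pow A (k + 1) p q := by
        rw [ha4.real 5 (by decide), ha3.real 5 (by decide), h2.2, h1 (k + 1) (by omega)]
      refine Runs.ite (B := 30) (fun hb => ?_) (fun hb => ?_)
        (by simp [Test.cost, NExpr.cost, RExpr.cost])
      · simp only [Test.Holds, NExpr.eval, RExpr.eval, hk4, hq4, hr] at hb
        have hb' : pow A (k + 1) p q ≠ 0 := fun h => hb h.le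
        refine Runs.setNat (by simp [NExpr.cost]) ?_
        simp only [NExpr.eval, hq4, Store.setNat_nat, true_and, and_true]
        refine ⟨fun q' => ?_, fun _ => by simp, fun i' j' h => ?_⟩
        · split_ifs with h
          · have e : q' = q := Fin.ext h
            exact .inr ⟨rfl, k + 1, by omega, by omega, by rwa [e]⟩
          · exact hJ q'
        · split_ifs with h'
          · exact fun _ => rfl
          · exact hP i' j' h
      · simp only [Test.Holds, NExpr.eval, RExpr.eval, hk4, hq4, hr, not_not] at hb
        exact Runs.skip (by omega) ⟨hJ, fun h => (h (le_antisymm hb zero_le)).elim, hP⟩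
    · intro s4 ha4 h5
      refine ⟨?_, fun q => ⟨?_, fun hq => ?_⟩⟩
      · rwa [ha4.nat 5 (by decide)]
      · rintro ⟨k, hk1, hk2, hk⟩
        obtain ⟨k, rfl⟩ := Nat.exists_eq_add_of_le' hk1
        exact h5.2 ⟨k, by omega⟩ q hk
      · exact (h5.1 q).resolve_right fun h => hq h.2
  · have h1 : n + 1 ≤ (n + 1) ^ 2 := Nat.le_self_pow (by norm_num) _
    omega

end MaxAlg

/-! ### Walks through one node, grouped by length modulo m -/

namespace MaxAlg

variable {n : ℕ}

/-- With the modulus `m` in the variable `5`, compute in the array `6` the rows of node `p` of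
the powers of the matrix in the array `2` up to the exponent `L = m n`, and in the array `8` the
maxima of the columns of node `p` over the residue classes of the exponents modulo `m`. The
array `3` has to contain the transposed matrix. -/
def foldPowers : Prog :=
  .seq (.setNat 6 (.lit 0) (.lit 0) (.lit 0) (.lit 0))
  (.seq (forLoop 10 5 (.setNat 6 (.lit 0) (.lit 0) (.lit 0) (.add (var 6) (var 0))))
  (.seq (powerRows 2 6 6)
  (.seq (powerRows 3 7 6)
  (.seq (forLoop 10 5 (forLoop 11 0 (setCell 8 (var 10) (var 11) .zero)))
    (forLoop 10 6 (forLoop 11 0 (setCell 8 (.mod (var 10) (var 5)) (var 11)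
      (.max (cell 8 (.mod (var 10) (var 5)) (var 11)) (cell 7 (var 10) (var 11))))))))))

/-- The machine does not multiply integers, so m n is formed by m additions. The folded columns are
described by a lower and an upper estimate instead of an exact maximum, which is all that is needed
later; the alternative 0 is what the initialization leaves. -/
theorem Runs.foldPowers {s : Store} {A : Mat n} {p : Fin n} {m : ℕ} (hn : s.nat 0 0 0 0 = n)
    (hp : s.nat 13 0 0 0 = p) (hm : s.nat 5 0 0 0 = m) (hm0 : 0 < m)
    (hA : HasMat s 2 A) (hAt : HasMat s 3 fun x y => A y x) :
    Runs MaxAlg.foldPowers s (2000 * ((m + 1) * (n + 1) ^ 3)) fun s' =>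
      s'.nat 6 0 0 0 = m * n ∧ (∀ k ≤ m * n, ∀ v : Fin n, s'.real 6 k v 0 = pow A k p v) ∧
      (∀ k < m * n, ∀ v : Fin n, pow A k v p ≤ s'.real 8 (k % m) v 0) ∧
      ∀ r < m, ∀ v : Fin n, s'.real 8 r v 0 = 0 ∨
        ∃ k, k % m = r ∧ s'.real 8 r v 0 ≤ pow A k v p := by
  have hb1 : 1 ≤ (m + 1) * (n + 1) ^ 3 := Nat.mul_pos (by omega) (Nat.pow_pos (by omega))
  have hb2 : m + 1 ≤ (m + 1) * (n + 1) ^ 3 := Nat.le_mul_of_pos_right _ (Nat.pow_pos (by omega))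
  have hb3 : (m * n + 1) * (n + 1) ^ 2 ≤ (m + 1) * (n + 1) ^ 3 := by
    -- This is where length m n becomes affordable: (m n + 1)(n + 1)² is at most (m + 1)(n + 1)³.
    rw [pow_succ' _ 2, ← mul_assoc]
    exact Nat.mul_le_mul_right _ (by nlinarith)
  have hb4 : (m + 1) * (n + 1) ^ 2 ≤ (m + 1) * (n + 1) ^ 3 :=
    Nat.mul_le_mul_left _ (Nat.pow_le_pow_right (by omega) (by norm_num))
  set B := (m + 1) * (n + 1) ^ 3
  refine Runs.seq (b := 10) (b' := 1900 * B) (R := fun s' => s'.nat 6 0 0 0 = 0)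
    (Runs.setNat (by simp [NExpr.cost]) (by simp [NExpr.eval])) (fun s1 ha1 h1 => ?_) (by omega)
  have hn1 : s1.nat 0 0 0 0 = n := by rw [ha1.nat 0 (by decide), hn]
  have hm1 : s1.nat 5 0 0 0 = m := by rw [ha1.nat 5 (by decide), hm]
  refine Runs.seq (b := 80 * (m + 1)) (b' := 1800 * B) (R := fun s' => s'.nat 6 0 0 0 = m * n)
    ?_ (fun s2 ha2 h2 => ?_) (by omega)
  · refine Runs.forLoop (N := m) (c := 30) (M := 1) (fun k s' => s'.nat 6 0 0 0 = k * n) hm1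
      (by decide) (by decide) (by decide) (fun k s x h => by simpa [Store.setNat_nat] using h)
      (by simpa using h1) ?_ (fun _ _ h => h) le_rfl (by norm_num) (by simp)
    intro k hk s2 ha2 hk2 h2
    refine Runs.setNat (by simp [NExpr.cost]) ?_
    simp [NExpr.eval, h2, ha2.nat 0 (by decide), hn1, add_mul]
  have hn2 : s2.nat 0 0 0 0 = n := by rw [ha2.nat 0 (by decide), hn1]
  have hm2 : s2.nat 5 0 0 0 = m := by rw [ha2.nat 5 (by decide), hm1]
  have hp2 : s2.nat 13 0 0 0 = p := by
    rw [ha2.nat 13 (by decide), ha1.nat 13 (by decide), hp]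
  have hA2 : HasMat s2 2 A :=
    hA.congr ((ha2.real 2 (by decide)).trans (ha1.real 2 (by decide)))
  have hAt2 : HasMat s2 3 fun x y => A y x :=
    hAt.congr ((ha2.real 3 (by decide)).trans (ha1.real 3 (by decide)))
  refine Runs.seq (Runs.powerRows hn2 hp2 h2 (by decide) (by decide) hA2)
    (b' := 1400 * B) (fun s3 ha3 h3 => ?_) (by omega)
  have hn3 : s3.nat 0 0 0 0 = n := by rw [ha3.nat 0 (by decide), hn2]
  have hm3 : s3.nat 5 0 0 0 = m := by rw [ha3.nat 5 (by decide), hm2]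
  have hp3 : s3.nat 13 0 0 0 = p := by rw [ha3.nat 13 (by decide), hp2]
  have hL3 : s3.nat 6 0 0 0 = m * n := by rw [ha3.nat 6 (by decide), h2]
  refine Runs.seq (Runs.powerRows hn3 hp3 hL3 (by decide) (by decide)
    (hAt2.congr (ha3.real 3 (by decide)))) (b' := 1000 * B) (fun s4 ha4 h4 => ?_) (by omega)
  have hn4 : s4.nat 0 0 0 0 = n := by rw [ha4.nat 0 (by decide), hn3]
  have hm4 : s4.nat 5 0 0 0 = m := by rw [ha4.nat 5 (by decide), hm3]
  have hL4 : s4.nat 6 0 0 0 = m * n := by rw [ha4.nat 6 (by decide), hL3]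
  refine Runs.seq (b := 150 * ((m + 1) * (n + 1)))
    (b' := 300 * ((m * n + 1) * (n + 1)))
    (R := fun s' => ∀ r < m, ∀ v : Fin n, s'.real 8 r v 0 = 0) ?_ (fun s5 ha5 h5 => ?_) ?_
  · refine Runs.forLoop (N := m) (c := 100) (M := n + 1)
      (fun k s' => ∀ r < k, ∀ v : Fin n, s'.real 8 r v 0 = 0) hm4 (by decide) (by decide)
      (by decide) (fun _ _ _ h => h) (fun r hr => by omega) ?_ (fun _ _ h => h) (by omega)
      (by norm_num) le_rfl
    intro k hk s5 ha5 hk5 h5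
    refine Runs.forLoop (N := n) (c := 20) (M := 1)
      (fun j s' => (∀ r < k, ∀ v : Fin n, s'.real 8 r v 0 = 0) ∧
        ∀ v : Fin n, (v : ℕ) < j → s'.real 8 k v 0 = 0)
      (by rw [ha5.nat 0 (by decide), hn4]) (by decide) (by decide)
      (by decide) (fun _ _ _ h => h) ⟨h5, fun v hv => by omega⟩ ?_ ?_ le_rfl (by norm_num)
      (by simp)
    · intro j hj s6 ha6 hj6 h6
      refine Runs.setCell (by simp [NExpr.cost, RExpr.cost]) fun s7 _ h7 => ?_
      simp only [NExpr.eval, RExpr.eval, hj6, ha6.nat 10 (by decide), hk5] at h7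
      refine ⟨fun r hr v => ?_, fun v hv => ?_⟩
      · rw [h7]; split_ifs
        · rfl
        · exact h6.1 r hr v
      · rw [h7]; split_ifs with h
        · rfl
        · exact h6.2 v (by omega)
    · intro s6 _ h6 r hr v
      rcases Nat.lt_succ_iff_lt_or_eq.1 hr with h | rfl
      · exact h6.1 r h v
      · exact h6.2 v v.2
  · have hn5 : s5.nat 0 0 0 0 = n := by rw [ha5.nat 0 (by decide), hn4]
    have hm5 : s5.nat 5 0 0 0 = m := by rw [ha5.nat 5 (by decide), hm4]
    have hL5 : s5.nat 6 0 0 0 = m * n := by rw [ha5.nat 6 (by decide), hL4]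
    have hZ : ∀ k ≤ m * n, ∀ v : Fin n, s5.real 7 k v 0 = pow A k v p := by
      intro k hk v
      rw [ha5.real 7 (by decide), h4 k hk v, pow_transpose]
    refine Runs.forLoop (N := m * n) (c := 150) (M := n + 1)
      (fun k s' => (∀ k' < k, ∀ v : Fin n, pow A k' v p ≤ s'.real 8 (k' % m) v 0) ∧
        ∀ r < m, ∀ v : Fin n, s'.real 8 r v 0 = 0 ∨
          ∃ k, k % m = r ∧ s'.real 8 r v 0 ≤ pow A k v p) hL5 (by decide) (by decide)
      (by decide) (fun _ _ _ h => h)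
      ⟨fun k hk => by omega, fun r hr v => .inl (h5 r hr v)⟩ ?_ ?_ (by omega)
      (by norm_num) le_rfl
    · intro k hk s6 ha6 hk6 h6
      refine Runs.forLoop (N := n) (c := 60) (M := 1)
        (fun j s' => ((∀ k' < k, ∀ v : Fin n, pow A k' v p ≤ s'.real 8 (k' % m) v 0) ∧
          ∀ v : Fin n, (v : ℕ) < j → pow A k v p ≤ s'.real 8 (k % m) v 0) ∧
          ∀ r < m, ∀ v : Fin n, s'.real 8 r v 0 = 0 ∨
            ∃ k, k % m = r ∧ s'.real 8 r v 0 ≤ pow A k v p)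
        (by rw [ha6.nat 0 (by decide), hn5]) (by decide) (by decide)
        (by decide) (fun _ _ _ h => h) ⟨⟨h6.1, fun v hv => by omega⟩, h6.2⟩ ?_ ?_ le_rfl
        (by norm_num) (by simp)
      · intro j hj s7 ha7 hj7 h7
        have hk7 : s7.nat 10 0 0 0 = k := by rw [ha7.nat 10 (by decide), hk6]
        have hm7 : s7.nat 5 0 0 0 = m := by
          rw [ha7.nat 5 (by decide), ha6.nat 5 (by decide), hm5]
        have hZ7 : s7.real 7 k j 0 = pow A k ⟨j, hj⟩ p := by
          rw [ha7.real 7 (by decide), ha6.real 7 (by decide)]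
          exact hZ k hk.le ⟨j, hj⟩
        refine Runs.setCell (by simp [NExpr.cost, RExpr.cost]) fun s8 _ h8 => ?_
        simp only [NExpr.eval, RExpr.eval, hj7, hk7, hm7, hZ7] at h8
        have hmono : ∀ x y z, s7.real 8 x y z ≤ s8.real 8 x y z := by
          intro x y z
          rw [h8]
          split_ifs with h
          · obtain ⟨rfl, rfl, rfl⟩ := h; exact le_max_left _ _
          · exact le_rfl
        refine ⟨⟨fun k' hk' v => (h7.1.1 k' hk' v).trans (hmono _ _ _), fun v hv => ?_⟩,
          fun r hr v => ?_⟩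
        · rcases Nat.lt_succ_iff_lt_or_eq.1 hv with h | h
          · exact (h7.1.2 v h).trans (hmono _ _ _)
          · rw [h8, if_pos ⟨rfl, h, rfl⟩, show v = ⟨j, hj⟩ from Fin.ext h]
            exact le_max_right _ _
        · rw [h8]
          split_ifs with h
          · obtain ⟨rfl, h9, -⟩ := h
            have e : v = ⟨j, hj⟩ := Fin.ext h9
            subst e
            rcases h7.2 (k % m) hr ⟨j, hj⟩ with h10 | ⟨k', hk', h10⟩
            · exact .inr ⟨k, rfl, max_le (by rw [h10]; exact zero_le) le_rfl⟩
            · rcases le_total (s7.real 8 (k % m) j 0) (pow A k ⟨j, hj⟩ p) with h | h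
              · exact .inr ⟨k, rfl, max_le h le_rfl⟩
              · exact .inr ⟨k', hk', max_le h10 (h.trans h10)⟩
          · exact h7.2 r hr v
      · intro s7 _ h7
        refine ⟨fun k' hk' v => ?_, h7.2⟩
        rcases Nat.lt_succ_iff_lt_or_eq.1 hk' with h | rfl
        · exact h7.1.1 k' h v
        · exact h7.1.2 v v.2
    · intro s6 ha6 h6
      refine ⟨by rw [ha6.nat 6 (by decide), hL5], fun k hk v => ?_, h6.1, h6.2⟩
      rw [ha6.real 6 (by decide), ha5.real 6 (by decide), ha4.real 6 (by decide), h3 k hk v]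
  · have h1 : (m + 1) * (n + 1) ≤ B := Nat.mul_le_mul_left _ (Nat.le_self_pow (by norm_num) _)
    have h2 : (m * n + 1) * (n + 1) ≤ (m * n + 1) * (n + 1) ^ 2 :=
      Nat.mul_le_mul_left _ (Nat.le_self_pow (by norm_num) _)
    omega

/-- Add the walks through the node `p` to the output. -/
def combine : Prog :=
  forLoop 12 6 (forPairs (.setReal 1 (var 2) (var 10) (var 11)
    (.max (.get 1 (var 2) (var 10) (var 11))
      (.mul (cell 8 (.mod (.add (var 1) (.sub (var 6) (var 12))) (var 5)) (var 10))
        (cell 6 (var 12) (var 11))))))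

/-- The output only grows, so the contributions of several components accumulate in the same cells,
while the upper bound `C` is preserved throughout. -/
theorem Runs.combine {s : Store} {m L t μ : ℕ} (C : Mat n) (hn : s.nat 0 0 0 0 = n)
    (ht : s.nat 1 0 0 0 = t) (hμ : s.nat 2 0 0 0 = μ) (hm : s.nat 5 0 0 0 = m)
    (hL : s.nat 6 0 0 0 = L) (hC : ∀ i j : Fin n, s.real 1 μ i j ≤ C i j)
    (hWC : ∀ k < L, ∀ i j : Fin n,
      s.real 8 ((t + (L - k)) % m) i 0 * s.real 6 k j 0 ≤ C i j) :
    Runs MaxAlg.combine s (400 * ((L + 1) * (n + 1) ^ 2)) fun s' =>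
      (∀ i j : Fin n, s'.real 1 μ i j ≤ C i j) ∧ (∀ x y z, s.real 1 x y z ≤ s'.real 1 x y z) ∧
      (∀ x y z, x ≠ μ → s'.real 1 x y z = s.real 1 x y z) ∧
      ∀ k < L, ∀ i j : Fin n,
        s.real 8 ((t + (L - k)) % m) i 0 * s.real 6 k j 0 ≤ s'.real 1 μ i j := by
  refine Runs.forLoop (N := L) (c := 300) (M := (n + 1) ^ 2)
    (fun l s' => ((∀ i j : Fin n, s'.real 1 μ i j ≤ C i j) ∧
      (∀ x y z, s.real 1 x y z ≤ s'.real 1 x y z) ∧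
      (∀ x y z, x ≠ μ → s'.real 1 x y z = s.real 1 x y z)) ∧
      ∀ k < l, ∀ i j : Fin n,
        s.real 8 ((t + (L - k)) % m) i 0 * s.real 6 k j 0 ≤ s'.real 1 μ i j)
    hL (by decide) (by decide) (by decide) (fun _ _ _ h => h)
    ⟨⟨hC, fun _ _ _ => le_rfl, fun _ _ _ _ => rfl⟩, fun k hk => by omega⟩ ?_
    (fun _ _ h => ⟨h.1.1, h.1.2.1, h.1.2.2, h.2⟩) (Nat.one_le_pow _ _ (by omega))
    (by norm_num) le_rfl
  intro k hk s1 ha1 hk1 h1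
  refine (Runs.forPairs (n := n) (c := 200)
    (fun s' => (∀ i j : Fin n, s'.real 1 μ i j ≤ C i j) ∧
      (∀ x y z, s1.real 1 x y z ≤ s'.real 1 x y z) ∧
      (∀ x y z, x ≠ μ → s'.real 1 x y z = s.real 1 x y z))
    (fun i j s' => s.real 8 ((t + (L - k)) % m) i 0 * s.real 6 k j 0 ≤ s'.real 1 μ i j)
    (by rw [ha1.nat 0 (by decide), hn]) (by decide) (fun _ _ _ _ h => ⟨h, h⟩)
    (fun _ _ h => ⟨h, h⟩) ⟨h1.1.1, fun _ _ _ => le_rfl, h1.1.2.2⟩ ?_ (by norm_num)).mono le_rfl ?_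
  · intro i j s2 ha2 hi hj hJ hP
    refine Runs.setReal (by simp [NExpr.cost, RExpr.cost]) ?_
    have e0 : s2.nat 2 0 0 0 = μ := by rw [ha2.nat 2 (by decide), ha1.nat 2 (by decide), hμ]
    have e1 : s2.nat 1 0 0 0 = t := by rw [ha2.nat 1 (by decide), ha1.nat 1 (by decide), ht]
    have e2 : s2.nat 5 0 0 0 = m := by rw [ha2.nat 5 (by decide), ha1.nat 5 (by decide), hm]
    have e3 : s2.nat 6 0 0 0 = L := by rw [ha2.nat 6 (by decide), ha1.nat 6 (by decide), hL]
    have e4 : s2.nat 12 0 0 0 = k := by rw [ha2.nat 12 (by decide), hk1]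
    have e5 : s2.real 8 = s.real 8 := by rw [ha2.real 8 (by decide), ha1.real 8 (by decide)]
    have e6 : s2.real 6 = s.real 6 := by rw [ha2.real 6 (by decide), ha1.real 6 (by decide)]
    simp only [NExpr.eval, RExpr.eval, hi, hj, e0, e1, e2, e3, e4, e5, e6]
    set w := s.real 8 ((t + (L - k)) % m) i 0 * s.real 6 k j 0 with hw
    have h3 := fun x y z => Store.setReal_real s2 1 μ i j (max (s2.real 1 μ i j) w) 1 x y z
    set s3 := s2.setReal 1 μ i j (max (s2.real 1 μ i j) w)
    simp only [true_and] at h3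
    have hmono : ∀ x y z, s2.real 1 x y z ≤ s3.real 1 x y z := by
      intro x y z
      rw [h3]
      split_ifs with h
      · obtain ⟨rfl, rfl, rfl⟩ := h; exact le_max_left _ _
      · exact le_rfl
    refine ⟨⟨fun i' j' => ?_, fun x y z => (hJ.2.1 x y z).trans (hmono _ _ _),
      fun x y z hx => ?_⟩, ?_, fun i' j' h => (hP i' j' h).trans (hmono _ _ _)⟩
    · rw [h3]
      split_ifs with h
      · rw [Fin.ext h.2.1, Fin.ext h.2.2]
        exact max_le (hJ.1 i j) (hWC k hk i j)
      · exact hJ.1 i' j'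
    · rw [h3, if_neg fun h => hx h.1]
      exact hJ.2.2 x y z hx
    · rw [h3, if_pos ⟨rfl, rfl, rfl⟩]
      exact le_max_right _ _
  · rintro s2 - ⟨⟨h2, h3, h4⟩, h5⟩
    refine ⟨⟨h2, fun x y z => (h1.1.2.1 x y z).trans (h3 x y z), h4⟩, fun k' hk' i j => ?_⟩
    rcases Nat.lt_succ_iff_lt_or_eq.1 hk' with h | rfl
    · exact (h1.2 k' h i j).trans (h3 _ _ _)
    · exact h5 i j

/-- Add the walks through the node `p` in the variable `13` to the output, and mark the
component of `p`. -/
def processNode : Prog := .seq findCycle (.seq foldPowers combine)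

/-- `le_csr` shows that nothing too large is written; `walk_through_le` and `Bounded.exists_short`
show that every walk through the component of p is accounted for. The length m is bounded by the
size of any set containing the component, so that the cost can be charged to the nodes that become
marked. -/
theorem Runs.processNode {s : Store} {A : Mat n} {G : Digraph (Fin n)} {p : Fin n} {t μ : ℕ}
    (hl : mcgm A ≠ 0) (hG : G ≤ critical A) (hR : CompletelyReducible G) (hpG : p ∈ nodes G)
    (hn : s.nat 0 0 0 0 = n) (ht : s.nat 1 0 0 0 = t) (hμ : s.nat 2 0 0 0 = μ)
    (hp : s.nat 13 0 0 0 = p) (hA : HasMat s 2 (normalize A))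
    (hAt : HasMat s 3 fun x y => normalize A y x) (hS : HasMat s 4 (csrS A G))
    (hout : ∀ i j : Fin n, s.real 1 μ i j ≤ csr A G t i j) :
    ∃ m, (∀ F : Finset (Fin n), (∀ q, Reach G p q → q ∈ F) → m ≤ F.card) ∧ 1 ≤ m ∧
    Runs MaxAlg.processNode s (8000 * (m * (n + 1) ^ 3)) fun s' =>
      (∀ i j : Fin n, s'.real 1 μ i j ≤ csr A G t i j) ∧
      (∀ x y z, s.real 1 x y z ≤ s'.real 1 x y z) ∧
      (∀ x y z, x ≠ μ → s'.real 1 x y z = s.real 1 x y z) ∧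
      (∀ x, Reach G p x → ∀ i j y a b, pow (normalize A) (cyclicity G * a) i x *
        pow (csrS A G) t x y * pow (normalize A) (cyclicity G * b) y j ≤ s'.real 1 μ i j) ∧
      ∀ q : Fin n, (Reach G p q → s'.nat 4 q 0 0 = 1) ∧
        (¬ Reach G p q → s'.nat 4 q 0 0 = s.nat 4 q 0 0) := by
  have hN := normalize_bounded A
  have hSb := csrS_bounded A G
  have hclosed : ∃ m, 1 ≤ m ∧ pow (csrS A G) m p p ≠ 0 := hR.exists_closed hl hG hpG
  classical
  obtain ⟨m, ⟨hm1, hm2⟩, hmin⟩ : ∃ m, (1 ≤ m ∧ pow (csrS A G) m p p ≠ 0) ∧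
      ∀ k, k < m → ¬ (1 ≤ k ∧ pow (csrS A G) k p p ≠ 0) :=
    ⟨Nat.find hclosed, Nat.find_spec hclosed, fun k hk => Nat.find_min hclosed hk⟩
  have hcard : ∀ F : Finset (Fin n), (∀ q, Reach G p q → q ∈ F) → m ≤ F.card := fun F hF =>
    length_le_card hm1 hm2 (fun k hk hkm => by_contra fun h => hmin k hkm ⟨hk, h⟩) F
      fun k q _ _ h => hF q (reach_of_pow_ne_zero h)
  have hmn : m ≤ n := by simpa using hcard Finset.univ fun _ _ => Finset.mem_univ _
  -- Walks can be shortened below n. If the shortened walk has length 0, then q = p, and the closed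
  -- walk of length m serves instead.
  have hreach : ∀ q, (∃ k, 1 ≤ k ∧ k ≤ n ∧ pow (csrS A G) k p q ≠ 0) ↔ Reach G p q := by
    refine fun q => ⟨fun ⟨k, _, _, h⟩ => reach_of_pow_ne_zero h, fun h => ?_⟩
    obtain ⟨k, hk⟩ := exists_pow_ne_zero hl hG h
    obtain ⟨k', hk', hle⟩ := hSb.exists_lt k p q
    rcases Nat.eq_zero_or_pos k' with rfl | h0
    · have hpq : p = q := by
        by_contra hpq
        refine hk (le_antisymm (hle.trans ?_) zero_le)
        simp [pow, one, hpq]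
      subst hpq
      exact ⟨m, hm1, hmn, hm2⟩
    · exact ⟨k', h0, hk'.le, fun h => hk (le_antisymm (hle.trans h.le) zero_le)⟩
  refine ⟨m, hcard, hm1, ?_⟩
  have hb1 : (n + 1) ^ 3 ≤ m * (n + 1) ^ 3 := Nat.le_mul_of_pos_left _ hm1
  have hb2 : (m + 1) * (n + 1) ^ 3 ≤ 2 * (m * (n + 1) ^ 3) := by rw [add_mul]; omega
  have hb3 : (m * n + 1) * (n + 1) ^ 2 ≤ (m + 1) * (n + 1) ^ 3 := by
    rw [pow_succ' _ 2, ← mul_assoc]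
    exact Nat.mul_le_mul_right _ (by nlinarith)
  refine Runs.seq (Runs.findCycle hn hp hS ⟨m, hm1, hmn, hm2⟩) (b' := 7000 * (m * (n + 1) ^ 3))
    ?_ (by omega)
  rintro s1 ha1 ⟨⟨m', hm'1, hm'2, -, hm'3, hm'4⟩, hmark⟩
  have hmm : m' = m := by
    rcases lt_trichotomy m' m with h | h | h
    · exact absurd ⟨hm'2, hm'3⟩ (hmin m' h)
    · exact h
    · exact absurd (hm'4 m hm1 h) hm2
  subst hmm
  have hn1 : s1.nat 0 0 0 0 = n := by rw [ha1.nat 0 (by decide), hn]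
  have hp1 : s1.nat 13 0 0 0 = p := by rw [ha1.nat 13 (by decide), hp]
  refine Runs.seq (Runs.foldPowers hn1 hp1 hm'1 hm1 (hA.congr (ha1.real 2 (by decide)))
    (hAt.congr (ha1.real 3 (by decide)))) (b' := 1000 * (m' * (n + 1) ^ 3)) ?_ (by omega)
  rintro s2 ha2 ⟨hL2, hY, hW, hW'⟩
  have ho2 : s2.real 1 = s.real 1 := by rw [ha2.real 1 (by decide), ha1.real 1 (by decide)]
  -- As m' n is 0 modulo m', adding m' n - k subtracts k from t without leaving the natural numbers.
  have hmod : ∀ k ≤ m' * n, ∀ a, (t + (m' * n - k)) % m' = a % m' ↔ a + k ≡ t [MOD m'] := by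
    intro k hk a
    have h1 : t + (m' * n - k) + k ≡ t [MOD m'] := by
      rw [show t + (m' * n - k) + k = t + m' * n by omega]
      simp [Nat.ModEq]
    constructor
    · intro h
      exact (Nat.ModEq.add_right k (Nat.ModEq.symm h)).trans h1
    · intro h
      exact Nat.ModEq.add_right_cancel' k (h1.trans h.symm)
  refine (Runs.combine (n := n) (csr A G t) (by rw [ha2.nat 0 (by decide), hn1])
    (t := t) (μ := μ) (m := m') (L := m' * n) ?_ ?_ ?_ hL2 ?_ ?_).mono (by omega) ?_
  · rw [ha2.nat 1 (by decide), ha1.nat 1 (by decide), ht]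
  · rw [ha2.nat 2 (by decide), ha1.nat 2 (by decide), hμ]
  · rw [ha2.nat 5 (by decide), hm'1]
  · rw [ho2]; exact hout
  · intro k hk i j
    rw [hY k hk.le j]
    rcases hW' _ (Nat.mod_lt (t + (m' * n - k)) hm1) i with h | ⟨a, ha, h⟩
    · rw [h, zero_mul]; exact zero_le
    · exact (mul_le_mul_left h _).trans
        (le_csr hl hG hR hpG hm2 ((hmod k hk.le a).1 ha.symm) i j)
  · rintro s3 ha3 ⟨h1, h2, h3, h4⟩
    rw [ho2] at h2 h3
    refine ⟨h1, h2, h3, fun x hx i j y a b => ?_, fun q => ?_⟩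
    · refine walk_through_le hl hG hR hpG hx hm1 (fun a b hab => ?_) y a b
      obtain ⟨a', ha', hamod, hale⟩ := hN.exists_short hm1 a i p
      obtain ⟨b', hb', hbmod, hble⟩ := hN.exists_short hm1 b p j
      rw [mul_comm n] at ha' hb'
      refine (mul_le_mul' hale hble).trans (le_trans ?_ (h4 b' hb' i j))
      have h5 : a' + b' ≡ t [MOD m'] := (Nat.ModEq.add hamod hbmod).trans hab
      rw [(hmod b' hb'.le a').2 h5, hY b' hb'.le j]
      gcongr
      exact hW a' ha' i
    · rw [ha3.nat 4 (by decide), ha2.nat 4 (by decide)]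
      refine ⟨fun h => (hmark q).1 ((hreach q).2 h), fun h => (hmark q).2 (mt (hreach q).1 h)⟩

end MaxAlg

/-! ### One term of an expansion -/

namespace MaxAlg

variable {n : ℕ}

open scoped Classical in
/-- The incidence matrix of `G` is stored in the part `μ` of the integer array number `a`. -/
def HasInc (s : Store) (a μ : ℕ) (G : Digraph (Fin n)) : Prop :=
  ∀ i j : Fin n, s.nat a μ i j = if G.Adj i j then 1 else 0

theorem HasInc.one_le_iff {s : Store} {a μ : ℕ} {G : Digraph (Fin n)} (h : HasInc s a μ G)
    (i j : Fin n) : 1 ≤ s.nat a μ i j ↔ G.Adj i j := by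
  rw [h i j]; split_ifs <;> simp_all

theorem HasInc.congr {s s' : Store} {a μ : ℕ} {G : Digraph (Fin n)} (h : HasInc s a μ G)
    (hs : s'.nat a = s.nat a) : HasInc s' a μ G := fun i j => by rw [hs]; exact h i j

/-- The test that always holds. -/
abbrev always : Test := .natLe (.lit 0) (.lit 0)

/-- Mark all nodes that have no outgoing edge in the digraph in the part `μ` of the integer
array `3`, where `μ` is the variable `2`. -/
def initMarks : Prog :=
  forLoop 10 0 (.seq (.setNat 4 (var 10) (.lit 0) (.lit 0) (.lit 1))
    (forLoop 11 0 (.ite (.natLe (.lit 1) (.get 3 (var 2) (var 10) (var 11)))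
      (.setNat 4 (var 10) (.lit 0) (.lit 0) (.lit 0)) .skip)))

/-- For completely reducible G the nodes left unmarked are exactly the nodes of G, so the potential
of the next loop starts at their number. -/
theorem Runs.initMarks {s : Store} {G : Digraph (Fin n)} {μ : ℕ} (hn : s.nat 0 0 0 0 = n)
    (hμ : s.nat 2 0 0 0 = μ) (hG : HasInc s 3 μ G) :
    Runs MaxAlg.initMarks s (200 * (n + 1) ^ 2) fun s' =>
      ∀ q : Fin n, (s'.nat 4 q 0 0 = 0 ↔ ∃ j, G.Adj q j) := by
  refine Runs.forLoop (N := n) (c := 150) (M := n + 1)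
    (fun k s' => ∀ q : Fin n, (q : ℕ) < k → (s'.nat 4 q 0 0 = 0 ↔ ∃ j, G.Adj q j)) hn (by decide)
    (by decide) (by decide) (fun k s x h => by simpa [Store.setNat_nat] using h)
    (fun q hq => by omega) ?_ (fun s' _ h q => h q q.2) (by omega) (by norm_num) (by rw [pow_two])
  intro k hk s1 ha1 hk1 h1
  refine Runs.seq (b := 20) (b' := 100 * (n + 1)) (R := fun s' => s'.nat 4 k 0 0 = 1 ∧
    ∀ q : Fin n, (q : ℕ) < k → (s'.nat 4 q 0 0 = 0 ↔ ∃ j, G.Adj q j)) ?_ ?_ (by omega)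
  · refine Runs.setNat (by simp [NExpr.cost]) ?_
    simp only [NExpr.eval, hk1, Store.setNat_nat_self, true_and]
    intro q hq
    rw [Store.setNat_nat, if_neg (by omega)]
    exact h1 q hq
  · rintro s2 ha2 ⟨h2, h3⟩
    have hk2 : s2.nat 10 0 0 0 = k := by rw [ha2.nat 10 (by decide), hk1]
    refine Runs.forLoop (N := n) (c := 50) (M := 1)
      (fun j s' => (s'.nat 4 k 0 0 = 0 ↔ ∃ i : Fin n, (i : ℕ) < j ∧ G.Adj ⟨k, hk⟩ i) ∧
        ∀ q : Fin n, (q : ℕ) < k → (s'.nat 4 q 0 0 = 0 ↔ ∃ j, G.Adj q j))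
      (by rw [ha2.nat 0 (by decide), ha1.nat 0 (by decide), hn]) (by decide) (by decide)
      (by decide) (fun k s x h => by simpa [Store.setNat_nat] using h) ⟨?_, h3⟩ ?_ ?_ le_rfl
      (by norm_num) (by simp)
    · simp [h2]
    · rintro j hj s3 ha3 hj3 ⟨h4, h5⟩
      have hk3 : s3.nat 10 0 0 0 = k := by rw [ha3.nat 10 (by decide), hk2]
      have hμ3 : s3.nat 2 0 0 0 = μ := by
        rw [ha3.nat 2 (by decide), ha2.nat 2 (by decide), ha1.nat 2 (by decide), hμ]
      have hG3 := ((hG.congr (ha1.nat 3 (by decide))).congr (ha2.nat 3 (by decide))).congr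
        (ha3.nat 3 (by decide))
      have hadj := hG3.one_le_iff ⟨k, hk⟩ ⟨j, hj⟩
      refine Runs.ite (B := 20) (fun hb => ?_) (fun hb => ?_) (by simp [Test.cost, NExpr.cost])
      · simp only [Test.Holds, NExpr.eval, hk3, hj3, hμ3] at hb
        refine Runs.setNat (by simp [NExpr.cost]) ?_
        simp only [NExpr.eval, hk3, Store.setNat_nat_self, true_iff]
        refine ⟨⟨⟨j, hj⟩, by simp, hadj.1 hb⟩, fun q hq => ?_⟩
        rw [Store.setNat_nat, if_neg (by omega)]
        exact h5 q hq
      · simp only [Test.Holds, NExpr.eval, hk3, hj3, hμ3] at hb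
        refine Runs.skip (by norm_num) ⟨h4.trans ⟨?_, ?_⟩, h5⟩
        · rintro ⟨i, hi, h⟩
          exact ⟨i, by omega, h⟩
        · rintro ⟨i, hi, h⟩
          refine ⟨i, lt_of_le_of_ne (Nat.lt_succ_iff.1 hi) fun h' => hb (hadj.2 ?_), h⟩
          rwa [show (⟨j, hj⟩ : Fin n) = i from Fin.ext h'.symm]
    · rintro s3 - ⟨h4, h5⟩ q hq
      rcases Nat.lt_succ_iff_lt_or_eq.1 hq with h | h
      · exact h5 q h
      · obtain rfl : q = ⟨k, hk⟩ := Fin.ext h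
        simpa using h4

/-- Process all nodes that are not marked when their turn comes. -/
def processNodes : Prog :=
  forLoop 13 0 (.ite (.natLe (.get 4 (var 13) (.lit 0) (.lit 0)) (.lit 0)) processNode .skip)

/-- Computation of one term, from the normalized matrix in the array `2` and the digraph. -/
def termProg : Prog :=
  .seq (fill 3 always (cell 2 (var 11) (var 10)) .zero)
  (.seq (fill 4 (.natLe (.lit 1) (.get 3 (var 2) (var 10) (var 11)))
    (cell 2 (var 10) (var 11)) .zero)
  (.seq initMarks
  (.seq (forPairs (.setReal 1 (var 2) (var 10) (var 11) .zero)) processNodes)))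

theorem always_holds (s : Store) : always.Holds s := le_rfl

/-- The number of nodes that are not marked. -/
def unmarked (n : ℕ) (s : Store) : ℕ :=
  (Finset.univ.filter fun q : Fin n => s.nat 4 q 0 0 = 0).card

/-- Amortized bound: a call at p costs 8000 m (n + 1)³, with m at most the number of nodes it marks,
so the unmarked nodes serve as potential. Within G the marked set is closed under reachability;
hence the component of an unmarked p is entirely unmarked and is paid for only once. -/
theorem Runs.processNodes {s : Store} {A : Mat n} {G : Digraph (Fin n)} {t μ : ℕ}
    (hl : mcgm A ≠ 0) (hG : G ≤ critical A) (hR : CompletelyReducible G)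
    (hn : s.nat 0 0 0 0 = n) (ht : s.nat 1 0 0 0 = t) (hμ : s.nat 2 0 0 0 = μ)
    (hA : HasMat s 2 (normalize A)) (hAt : HasMat s 3 fun x y => normalize A y x)
    (hS : HasMat s 4 (csrS A G)) (hmark : ∀ q : Fin n, s.nat 4 q 0 0 = 0 ↔ q ∈ nodes G)
    (hout : ∀ i j : Fin n, s.real 1 μ i j = 0) :
    Runs MaxAlg.processNodes s (100 * (n + 1) + 8000 * (n + 1) ^ 3 * (nodes G).card) fun s' =>
      (∀ i j : Fin n, s'.real 1 μ i j = csr A G t i j) ∧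
      (∀ x y z, x ≠ μ → s'.real 1 x y z = s.real 1 x y z) := by
  have hφ0 : unmarked n s = (nodes G).card := by
    unfold unmarked; congr 1; ext q; simp [hmark]
  refine (Runs.forLoop_potential (N := n) (b := 30)
    (fun k s' => ((∀ i j : Fin n, s'.real 1 μ i j ≤ csr A G t i j) ∧
      (∀ x y z, x ≠ μ → s'.real 1 x y z = s.real 1 x y z)) ∧
      (∀ x ∈ nodes G, s'.nat 4 x 0 0 ≠ 0 → ∀ i j y a b,
        pow (normalize A) (cyclicity G * a) i x * pow (csrS A G) t x y *
          pow (normalize A) (cyclicity G * b) y j ≤ s'.real 1 μ i j) ∧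
      (∀ q : Fin n, (q : ℕ) < k → s'.nat 4 q 0 0 ≠ 0) ∧
      (∀ q ∈ nodes G, ∀ q', Reach G q q' → s'.nat 4 q 0 0 ≠ 0 → s'.nat 4 q' 0 0 ≠ 0) ∧
      ∀ q : Fin n, q ∉ nodes G → s'.nat 4 q 0 0 ≠ 0)
    (fun s' => 8000 * (n + 1) ^ 3 * unmarked n s') hn (by decide) (by decide) (by decide)
    ?_ ?_ ?_ ?_).mono ?_ ?_
  · intro k s x h
    simpa [Store.setNat_nat] using h
  · intro s x
    simp [unmarked, Store.setNat_nat]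
  · refine ⟨⟨fun i j => by rw [hout]; exact zero_le, fun _ _ _ _ => rfl⟩,
      fun x hx h => (h ((hmark x).2 hx)).elim, fun q hq => by omega,
      fun q hq _ _ h => (h ((hmark q).2 hq)).elim, fun q hq h => hq ((hmark q).1 h)⟩
  · rintro k hk s1 ha1 hk1 ⟨⟨h1, h2⟩, h3, h4, h5, h6⟩
    by_cases hb : s1.nat 4 k 0 0 = 0
    · set p : Fin n := ⟨k, hk⟩
      have hp : p ∈ nodes G := by
        by_contra h; exact h6 p h hb
      obtain ⟨m, hm, hm1, hrun⟩ := Runs.processNode (s := s1) (p := p) (μ := μ) (t := t) hl hG hR hp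
        (by rw [ha1.nat 0 (by decide), hn]) (by rw [ha1.nat 1 (by decide), ht])
        (by rw [ha1.nat 2 (by decide), hμ]) hk1 (hA.congr (ha1.real 2 (by decide)))
        (hAt.congr (ha1.real 3 (by decide))) (hS.congr (ha1.real 4 (by decide))) h1
      refine ⟨8000 * (m * (n + 1) ^ 3) + 30, Runs.ite (fun _ => hrun) (fun h => ?_)
        (by simp [Test.cost, NExpr.cost]; omega) |>.mono le_rfl ?_⟩
      · exact (h (by simp [Test.Holds, NExpr.eval, hk1, hb])).elim
      · rintro s2 - ⟨h7, h8, h9, h10, h11⟩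
        have hmono : ∀ q : Fin n, s1.nat 4 q 0 0 ≠ 0 → s2.nat 4 q 0 0 ≠ 0 := by
          intro q hq
          by_cases h : Reach G p q
          · rw [(h11 q).1 h]; exact one_ne_zero
          · rwa [(h11 q).2 h]
        refine ⟨⟨⟨h7, fun x y z hx => (h9 x y z hx).trans (h2 x y z hx)⟩,
          fun x hx hx2 i j y a b => ?_, fun q hq => ?_, fun q hq q' hqq' hq2 => ?_,
          fun q hq => hmono q (h6 q hq)⟩, ?_⟩
        · by_cases h : Reach G p x
          · exact h10 x h i j y a b
          · rw [(h11 x).2 h] at hx2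
            exact (h3 x hx hx2 i j y a b).trans (h8 _ _ _)
        · rcases Nat.lt_succ_iff_lt_or_eq.1 hq with h | h
          · exact hmono q (h4 q h)
          · obtain rfl : q = p := Fin.ext h
            rw [(h11 p).1 .refl]; exact one_ne_zero
        · by_cases h : Reach G p q
          · rw [(h11 q').1 (h.trans hqq')]; exact one_ne_zero
          · rw [(h11 q).2 h] at hq2
            exact hmono q' (h5 q hq q' hqq' hq2)
        · have hsub : (Finset.univ.filter fun q : Fin n => s2.nat 4 q 0 0 = 0) ⊆
              Finset.univ.filter fun q : Fin n => s1.nat 4 q 0 0 = 0 := by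
            intro q hq
            simp only [Finset.mem_filter, Finset.mem_univ, true_and] at hq ⊢
            by_contra h
            exact hmono q h hq
          -- The newly marked nodes contain the whole component of p, hence number at least m.
          have hle := hm ((Finset.univ.filter fun q : Fin n => s1.nat 4 q 0 0 = 0) \
            Finset.univ.filter fun q : Fin n => s2.nat 4 q 0 0 = 0) (by
              intro q hq
              simp only [Finset.mem_sdiff, Finset.mem_filter, Finset.mem_univ, true_and]
              refine ⟨?_, by rw [(h11 q).1 hq]; exact one_ne_zero⟩
              by_contra h
              exact h5 q (mem_nodes_of_reach hp hq) p (hR.symm hq) h hb)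
          rw [Finset.card_sdiff_of_subset hsub] at hle
          have hle2 := Finset.card_le_card hsub
          have : m + unmarked n s2 ≤ unmarked n s1 := by unfold unmarked; omega
          have := Nat.mul_le_mul_left (8000 * (n + 1) ^ 3) this
          rw [mul_add] at this
          rw [← mul_assoc, mul_right_comm]
          omega
    · refine ⟨30, Runs.ite (B := 1) (fun h => ?_) (fun _ => Runs.skip le_rfl ?_)
        (by simp [Test.cost, NExpr.cost])⟩
      · exact (hb (by simpa [Test.Holds, NExpr.eval, hk1] using h)).elim
      · refine ⟨⟨⟨h1, h2⟩, h3, fun q hq => ?_, h5, h6⟩, le_rfl⟩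
        rcases Nat.lt_succ_iff_lt_or_eq.1 hq with h | h
        · exact h4 q h
        · rwa [h]
  · rw [hφ0]; omega
  · rintro s' - ⟨⟨h1, h2⟩, h3, h4, -, -⟩
    exact ⟨fun i j => le_antisymm (h1 i j) (csr_le fun x hx y a b => h3 x hx (h4 x x.2) i j y a b),
      h2⟩

theorem Runs.termProg {s : Store} {A : Mat n} {G : Digraph (Fin n)} {t μ : ℕ}
    (hl : mcgm A ≠ 0) (hG : Admissible A G)
    (hn : s.nat 0 0 0 0 = n) (ht : s.nat 1 0 0 0 = t) (hμ : s.nat 2 0 0 0 = μ)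
    (hA : HasMat s 2 (normalize A)) (hinc : HasInc s 3 μ G) :
    Runs MaxAlg.termProg s (10000 * (n + 1) ^ 3 * (nodes G).card) fun s' =>
      (∀ i j : Fin n, s'.real 1 μ i j = csr A G t i j) ∧
      (∀ x y z, x ≠ μ → s'.real 1 x y z = s.real 1 x y z) := by
  obtain ⟨hG1, hG2, hG3⟩ := hG
  have hcard : 1 ≤ (nodes G).card := Finset.card_pos.2 hG2
  have hb1 : (n + 1) ^ 2 ≤ (n + 1) ^ 3 := Nat.pow_le_pow_right (by omega) (by norm_num)
  have hb2 : n + 1 ≤ (n + 1) ^ 3 := Nat.le_self_pow (by norm_num) _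
  have hb3 : (n + 1) ^ 3 ≤ (n + 1) ^ 3 * (nodes G).card := Nat.le_mul_of_pos_right _ hcard
  rw [mul_assoc]
  set B := (n + 1) ^ 3 * (nodes G).card with hB
  refine Runs.seq (Runs.fill (c := 150) (fun x y => normalize A y x) hn
    (fun i j s' ha hi hj => ⟨fun _ => ?_, fun h => (h (always_holds s')).elim⟩)
    (by simp [Test.cost, NExpr.cost, RExpr.cost])) (b' := 9500 * B) (fun s1 ha1 h1 => ?_) (by omega)
  · simp only [RExpr.eval, NExpr.eval, hi, hj, ha.real 2 (by decide)]
    exact hA j i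
  have hn1 : s1.nat 0 0 0 0 = n := by rw [ha1.nat 0 (by decide), hn]
  have hA1 : HasMat s1 2 (normalize A) := hA.congr (ha1.real 2 (by decide))
  have hinc1 : HasInc s1 3 μ G := hinc.congr (ha1.nat 3 (by decide))
  have hμ1 : s1.nat 2 0 0 0 = μ := by rw [ha1.nat 2 (by decide), hμ]
  refine Runs.seq (Runs.fill (c := 150) (csrS A G) hn1
    (fun i j s' ha hi hj => ?_)
    (by simp [Test.cost, NExpr.cost, RExpr.cost])) (b' := 9200 * B) (fun s2 ha2 h2 => ?_) (by omega)
  · have := hinc1.one_le_iff i j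
    simp only [Test.Holds, RExpr.eval, NExpr.eval, hi, hj, ha.real 2 (by decide),
      ha.nat 3 (by decide), ha.nat 2 (by decide), hμ1, this]
    exact ⟨fun h => by rw [csrS_eq A G h]; exact hA1 i j, fun h => by simp [csrS, h]⟩
  have hn2 : s2.nat 0 0 0 0 = n := by rw [ha2.nat 0 (by decide), hn1]
  have hμ2 : s2.nat 2 0 0 0 = μ := by rw [ha2.nat 2 (by decide), hμ1]
  refine Runs.seq (Runs.initMarks hn2 hμ2 (hinc1.congr (ha2.nat 3 (by decide))))
    (b' := 9000 * B) (fun s3 ha3 h3 => ?_) (by omega)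
  have hn3 : s3.nat 0 0 0 0 = n := by rw [ha3.nat 0 (by decide), hn2]
  have hμ3 : s3.nat 2 0 0 0 = μ := by rw [ha3.nat 2 (by decide), hμ2]
  have ho3 : s3.real 1 = s.real 1 := by
    rw [ha3.real 1 (by decide), ha2.real 1 (by decide), ha1.real 1 (by decide)]
  refine Runs.seq (Runs.forPairs (n := n) (c := 50) (c' := 150)
    (fun s' => ∀ x y z, x ≠ μ → s'.real 1 x y z = s.real 1 x y z)
    (fun i j s' => s'.real 1 μ i j = 0) hn3 (by decide) (fun _ _ _ _ h => ⟨h, h⟩)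
    (fun _ _ h => ⟨h, h⟩) (fun _ _ _ _ => by rw [ho3]) ?_ (by norm_num))
    (b' := 8500 * B) (fun s4 ha4 h4 => ?_) (by omega)
  · intro i j s4 ha4 hi hj hJ hP
    refine Runs.setReal (by simp [NExpr.cost, RExpr.cost]) ?_
    simp only [NExpr.eval, RExpr.eval, hi, hj, ha4.nat 2 (by decide), hμ3, Store.setReal_real,
      true_and]
    refine ⟨fun x y z hx => by rw [if_neg fun h => hx h.1]; exact hJ x y z hx, by simp,
      fun i' j' h => ?_⟩
    split_ifs
    · rfl
    · exact hP i' j' h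
  · refine (Runs.processNodes (t := t) (μ := μ) hl hG1 hG3 (by rw [ha4.nat 0 (by decide), hn3])
      ?_ (by rw [ha4.nat 2 (by decide), hμ3]) ?_ ?_ ?_ ?_ h4.2).mono ?_ ?_
    · rw [ha4.nat 1 (by decide), ha3.nat 1 (by decide), ha2.nat 1 (by decide),
        ha1.nat 1 (by decide), ht]
    · exact ((hA1.congr (ha2.real 2 (by decide))).congr (ha3.real 2 (by decide))).congr
        (ha4.real 2 (by decide))
    · exact ((h1.congr (ha2.real 3 (by decide))).congr (ha3.real 3 (by decide))).congr
        (ha4.real 3 (by decide))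
    · exact (h2.congr (ha3.real 4 (by decide))).congr (ha4.real 4 (by decide))
    · intro q
      rw [ha4.nat 4 (by decide), h3 q]
      exact ⟨fun ⟨j, hj⟩ => mem_nodes.2 ⟨j, .inl hj⟩, fun h => hG3.exists_adj h⟩
    · rw [mul_assoc, ← hB]; omega
    · rintro s5 - ⟨h5, h6⟩
      exact ⟨h5, fun x y z hx => (h6 x y z hx).trans (h4.1 x y z hx)⟩

end MaxAlg

namespace MaxAlg

variable {n : ℕ}

/-! ### The main loop -/

/-- The numbers of the nodes in `K` are marked by ones in the real array `11`. -/
def HasNodes (s : Store) (K : Finset (Fin n)) : Prop :=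
  ∀ i : Fin n, s.real 11 i 0 0 = if i ∈ K then 1 else 0

theorem HasNodes.congr {s s' : Store} {K : Finset (Fin n)} (h : HasNodes s K)
    (hs : s'.real 11 = s.real 11) : HasNodes s' K := fun i => by rw [hs]; exact h i

/-- Computation of the maximum cycle geometric mean of the matrix that is restricted to the
remaining nodes. -/
def lambdaProg : Prog :=
  .seq (fill 14 always (.mul (cell 0 (var 10) (var 11))
    (.mul (cell 11 (var 10) (.lit 0)) (cell 11 (var 11) (.lit 0)))) .zero) karpProg

theorem Runs.lambdaProg {s : Store} {A : Mat n} {K : Finset (Fin n)} (hn : s.nat 0 0 0 0 = n)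
    (hA : HasMat s 0 A) (hK : HasNodes s K) :
    Runs MaxAlg.lambdaProg s (1500 * (n + 1) ^ 3) fun s' =>
      HasMat s' 14 (restrict A K) ∧ s'.real 9 0 0 0 = mcgm (restrict A K) := by
  have hb1 : (n + 1) ^ 2 ≤ (n + 1) ^ 3 := Nat.pow_le_pow_right (by omega) (by norm_num)
  refine Runs.seq (Runs.fill (c := 200) (restrict A K) hn
    (fun i j s' ha hi hj => ⟨fun _ => ?_, fun h => (h (always_holds s')).elim⟩)
    (by simp [Test.cost, NExpr.cost, RExpr.cost])) (b' := 1000 * (n + 1) ^ 3)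
    (fun s1 ha1 h1 => ?_) (by omega)
  · simp only [RExpr.eval, NExpr.eval, hi, hj, ha.real 0 (by decide), ha.real 11 (by decide),
      hA i j, hK i, hK j, restrict]
    by_cases h1 : i ∈ K <;> by_cases h2 : j ∈ K <;> simp [h1, h2]
  · refine (Runs.karpProg (by rw [ha1.nat 0 (by decide), hn]) h1).mono le_rfl fun s2 ha2 h2 => ?_
    exact ⟨h1.congr (ha2.real 14 (by decide)), h2⟩

/-- One step of an expansion, where `sel` selects the digraph and removes nodes. -/
def stepProg (sel : Prog) : Prog :=
  .seq (fill 2 always (.div (cell 14 (var 10) (var 11)) (cell 9 (.lit 0) (.lit 0))) .zero)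
  (.seq sel
  (.seq termProg
  (.seq (.setNat 2 (.lit 0) (.lit 0) (.lit 0) (.add (var 2) (.lit 1))) lambdaProg)))

/-- Computation of all terms. -/
def expansionProg (sel : Prog) : Prog :=
  .seq (.setNat 2 (.lit 0) (.lit 0) (.lit 0) (.lit 0))
  (.seq (forLoop 10 0 (setCell 11 (var 10) (.lit 0) .one))
  (.seq lambdaProg
    (.loop (.not (.realLe (cell 9 (.lit 0) (.lit 0)) .zero)) (stepProg sel))))

/-- The contents of the memory before step `μ` of an expansion with node sets `K` and digraphs
`G`; the array `13` contains an auxiliary matrix. -/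
structure Ready (A : Mat n) (R : Mat n) (K : ℕ → Finset (Fin n)) (G : ℕ → Digraph (Fin n))
    (t μ : ℕ) (s : Store) : Prop where
  size : s.nat 0 0 0 0 = n
  exponent : s.nat 1 0 0 0 = t
  step : s.nat 2 0 0 0 = μ
  matrix : HasMat s 0 A
  aux : HasMat s 13 R
  nodes : HasNodes s (K μ)
  history : ∀ ν < μ, HasInc s 3 ν (G ν)

/-- The program `sel` carries out the selections in an expansion with node sets `K` and
digraphs `G`. -/
def Selects (sel : Prog) (κ : ℕ) (A : Mat n) (R : Mat n) (K : ℕ → Finset (Fin n))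
    (G : ℕ → Digraph (Fin n)) (t : ℕ) : Prop :=
  ∀ (μ : ℕ) (s : Store), (∀ ν ≤ μ, mcgm (restrict A (K ν)) ≠ 0) → μ ≤ n → Ready A R K G t μ s →
    HasMat s 2 (normalize (restrict A (K μ))) →
    Runs sel s (κ * (n + 1) ^ 3) fun s' => HasNodes s' (K (μ + 1)) ∧ ∀ ν ≤ μ, HasInc s' 3 ν (G ν)

/-- A selection program does not change the input, the output and the normalized matrix. -/
structure Conservative (sel : Prog) : Prop where
  nat : ∀ a ∈ [0, 1, 2], a ∉ sel.natWrites
  real : ∀ a ∈ [0, 1, 2, 13], a ∉ sel.realWrites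

/-- Critical edges carry nonzero entries, and the restricted matrix vanishes outside K × K.
Consequently the digraphs of successive steps have disjoint node sets. -/
theorem nodes_subset {A : Mat n} {K : Finset (Fin n)} {G : Digraph (Fin n)}
    (hl : mcgm (restrict A K) ≠ 0) (hG : G ≤ critical (restrict A K)) : nodes G ⊆ K := by
  have key : ∀ i j, G.Adj i j → i ∈ K ∧ j ∈ K := by
    intro i j h
    have := csrS_ne_zero hl hG h
    rw [csrS_eq _ _ h] at this
    by_contra h'
    exact this (by simp [normalize, divBy, restrict, h'])
  intro i hi
  obtain ⟨j, hj | hj⟩ := mem_nodes.1 hi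
  · exact (key _ _ hj).1
  · exact (key _ _ hj).2

section Driver

variable {sel : Prog} {κ : ℕ} {A R : Mat n} {K : ℕ → Finset (Fin n)} {G : ℕ → Digraph (Fin n)}
  {t : ℕ}

/-- Selection, normalization and the next λ are cubic; since G μ is nonempty, they fit into the same
bound proportional to its number of nodes. -/
theorem Runs.stepProg {μ : ℕ} {s : Store} (hsel : Selects sel κ A R K G t) (hc : Conservative sel)
    (hl : ∀ ν ≤ μ, mcgm (restrict A (K ν)) ≠ 0) (hμ : μ ≤ n)
    (hG : Admissible (restrict A (K μ)) (G μ)) (hs : Ready A R K G t μ s)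
    (h14 : HasMat s 14 (restrict A (K μ))) (h9 : s.real 9 0 0 0 = mcgm (restrict A (K μ)))
    (hout : ∀ ν < μ, ∀ i j : Fin n, s.real 1 ν i j = csr (restrict A (K ν)) (G ν) t i j) :
    Runs (MaxAlg.stepProg sel) s ((κ + 12000) * (n + 1) ^ 3 * (MaxAlg.nodes (G μ)).card) fun s' =>
      Ready A R K G t (μ + 1) s' ∧ HasMat s' 14 (restrict A (K (μ + 1))) ∧
      s'.real 9 0 0 0 = mcgm (restrict A (K (μ + 1))) ∧
      ∀ ν < μ + 1, ∀ i j : Fin n, s'.real 1 ν i j = csr (restrict A (K ν)) (G ν) t i j := by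
  have hb1 : (n + 1) ^ 2 ≤ (n + 1) ^ 3 := Nat.pow_le_pow_right (by omega) (by norm_num)
  have hb2 : 1 ≤ (n + 1) ^ 3 := Nat.one_le_pow _ _ (by omega)
  have hb3 : (n + 1) ^ 3 ≤ (n + 1) ^ 3 * (MaxAlg.nodes (G μ)).card :=
    Nat.le_mul_of_pos_right _ (Finset.card_pos.2 hG.2.1)
  have hb4 := Nat.mul_le_mul_left κ hb3
  rw [mul_assoc, add_mul]
  set B := (n + 1) ^ 3 * (MaxAlg.nodes (G μ)).card with hB
  refine Runs.seq (Runs.fill (c := 150) (normalize (restrict A (K μ))) hs.size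
    (fun i j s' ha hi hj => ⟨fun _ => ?_, fun h => (h (always_holds s')).elim⟩)
    (by simp [Test.cost, NExpr.cost, RExpr.cost])) (b' := κ * B + 11800 * B)
    (fun s1 ha1 h1 => ?_) (by omega)
  · simp only [RExpr.eval, NExpr.eval, hi, hj, ha.real 14 (by decide), ha.real 9 (by decide),
      h14 i j, h9, normalize, divBy]
  have hs1 : Ready A R K G t μ s1 :=
    ⟨by rw [ha1.nat 0 (by decide), hs.size], by rw [ha1.nat 1 (by decide), hs.exponent],
      by rw [ha1.nat 2 (by decide), hs.step], hs.matrix.congr (ha1.real 0 (by decide)),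
      hs.aux.congr (ha1.real 13 (by decide)), hs.nodes.congr (ha1.real 11 (by decide)),
      fun ν hν => (hs.history ν hν).congr (ha1.nat 3 (by decide))⟩
  refine Runs.seq (hsel μ s1 hl hμ hs1 h1) (b' := 11800 * B) ?_ (by omega)
  rintro s2 ha2 ⟨h2, h3⟩
  have e0 := ha2.nat 0 (hc.nat 0 (by simp))
  have e1 := ha2.nat 1 (hc.nat 1 (by simp))
  have e2 := ha2.nat 2 (hc.nat 2 (by simp))
  have r0 := ha2.real 0 (hc.real 0 (by simp))
  have r1 := ha2.real 1 (hc.real 1 (by simp))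
  have r2 := ha2.real 2 (hc.real 2 (by simp))
  have r13 := ha2.real 13 (hc.real 13 (by simp))
  refine Runs.seq (Runs.termProg (t := t) (μ := μ) (hl μ le_rfl) hG (by rw [e0, hs1.size])
    (by rw [e1, hs1.exponent]) (by rw [e2, hs1.step]) (h1.congr r2) (h3 μ le_rfl))
    (b' := 1800 * B) ?_ (by rw [mul_assoc, ← hB]; omega)
  rintro s3 ha3 ⟨h4, h5⟩
  refine Runs.seq (b := 20) (b' := 1500 * (n + 1) ^ 3) (R := fun s' => s'.real = s3.real ∧
    s'.nat 2 0 0 0 = μ + 1 ∧ ∀ a, a ≠ 2 → s'.nat a = s3.nat a)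
    (Runs.setNat (by simp [NExpr.cost]) ⟨rfl, ?_, fun a ha => Store.setNat_nat_of_ne _ ha _ _ _ _⟩)
    ?_ (by omega)
  · simp [NExpr.eval, ha3.nat 2 (by decide), e2, hs1.step]
  rintro s4 ha4 ⟨h6, h7, h8⟩
  have hs4 : Ready A R K G t (μ + 1) s4 := by
    refine ⟨?_, ?_, h7, ?_, ?_, ?_, fun ν hν => ?_⟩
    · rw [h8 0 (by decide), ha3.nat 0 (by decide), e0, hs1.size]
    · rw [h8 1 (by decide), ha3.nat 1 (by decide), e1, hs1.exponent]
    · exact hs1.matrix.congr (by rw [h6, ha3.real 0 (by decide), r0])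
    · exact hs1.aux.congr (by rw [h6, ha3.real 13 (by decide), r13])
    · exact h2.congr (by rw [h6, ha3.real 11 (by decide)])
    · exact (h3 ν (by omega)).congr (by rw [h8 3 (by decide), ha3.nat 3 (by decide)])
  refine (Runs.lambdaProg hs4.size hs4.matrix hs4.nodes).mono le_rfl ?_
  rintro s5 ha5 ⟨h9', h10⟩
  refine ⟨⟨?_, ?_, ?_, ?_, ?_, ?_, fun ν hν => ?_⟩, h9', h10, fun ν hν i j => ?_⟩
  · rw [ha5.nat 0 (by decide), hs4.size]
  · rw [ha5.nat 1 (by decide), hs4.exponent]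
  · rw [ha5.nat 2 (by decide), hs4.step]
  · exact hs4.matrix.congr (ha5.real 0 (by decide))
  · exact hs4.aux.congr (ha5.real 13 (by decide))
  · exact hs4.nodes.congr (ha5.real 11 (by decide))
  · exact (hs4.history ν hν).congr (ha5.nat 3 (by decide))
  · rw [ha5.real 1 (by decide), h6]
    rcases Nat.lt_succ_iff_lt_or_eq.1 hν with h | rfl
    · rw [h5 ν i j (by omega), r1, ha1.real 1 (by decide), hout ν h i j]
    · exact h4 i j

/-- Induction on the number of remaining nodes. A step costs a cubic amount per node of G μ and
removes at least these nodes, so the costs sum to a cubic amount times the initial number. The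
condition |K μ| + μ ≤ n keeps the number of steps below n + 1, as the selections require. -/
theorem Runs.expansionLoop (hsel : Selects sel κ A R K G t) (hc : Conservative sel)
    (hG : ∀ μ, (∀ ν ≤ μ, mcgm (restrict A (K ν)) ≠ 0) → Admissible (restrict A (K μ)) (G μ))
    (hK : ∀ μ, K (μ + 1) ⊆ K μ \ MaxAlg.nodes (G μ)) (d : ℕ) :
    ∀ (μ : ℕ) (s : Store), (K μ).card = d → (K μ).card + μ ≤ n →
    (∀ ν < μ, mcgm (restrict A (K ν)) ≠ 0) →
    Ready A R K G t μ s → HasMat s 14 (restrict A (K μ)) →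
    s.real 9 0 0 0 = mcgm (restrict A (K μ)) →
    (∀ ν < μ, ∀ i j : Fin n, s.real 1 ν i j = csr (restrict A (K ν)) (G ν) t i j) →
    Runs (.loop (.not (.realLe (cell 9 (.lit 0) (.lit 0)) .zero)) (MaxAlg.stepProg sel)) s
      ((κ + 12020) * (n + 1) ^ 3 * d + 20) fun s' =>
      ∃ m, s'.nat 2 0 0 0 = m ∧ (∀ ν < m, mcgm (restrict A (K ν)) ≠ 0) ∧
        mcgm (restrict A (K m)) = 0 ∧
        ∀ ν < m, ∀ i j : Fin n, s'.real 1 ν i j = csr (restrict A (K ν)) (G ν) t i j := by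
  induction d using Nat.strong_induction_on with
  | _ d ih =>
    intro μ s hd hdn hl hs h14 h9 hout
    by_cases h0 : mcgm (restrict A (K μ)) = 0
    · refine ⟨_, s, .loop_false ?_, ?_, μ, hs.step, hl, h0, hout⟩
      · simp [Test.Holds, RExpr.eval, NExpr.eval, h9, h0]
      · simp [Test.cost, RExpr.cost, NExpr.cost]
    · have hl' : ∀ ν ≤ μ, mcgm (restrict A (K ν)) ≠ 0 := by
        intro ν hν
        rcases lt_or_eq_of_le hν with h | rfl
        · exact hl ν h
        · exact h0
      have hadm := hG μ hl'
      have hsub := nodes_subset h0 hadm.1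
      have hpos := Finset.card_pos.2 hadm.2.1
      have hcard : (K (μ + 1)).card + (MaxAlg.nodes (G μ)).card ≤ d := by
        have h1 := Finset.card_le_card (hK μ)
        rw [Finset.card_sdiff_of_subset hsub] at h1
        have h2 := Finset.card_le_card hsub
        omega
      obtain ⟨T, s1, he, hT, h1, h2, h3, h4⟩ := Runs.stepProg hsel hc hl' (by omega) hadm hs h14 h9
        hout
      obtain ⟨T', s2, he', hT', hq⟩ := ih _ (by omega) (μ + 1) s1 rfl (by omega)
        (fun ν hν => hl' ν (by omega)) h1 h2 h3 h4
      refine ⟨_, s2, .loop_true ?_ he he', ?_, hq⟩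
      · simpa [Test.Holds, RExpr.eval, NExpr.eval, h9] using h0
      · have h5 := Nat.mul_le_mul_left ((κ + 12020) * (n + 1) ^ 3) hcard
        have h6 : 20 ≤ 20 * ((n + 1) ^ 3 * (MaxAlg.nodes (G μ)).card) :=
          Nat.le_mul_of_pos_right _ (Nat.mul_pos (Nat.pow_pos (by omega)) hpos)
        have h7 : (κ + 12020) * (n + 1) ^ 3 * (MaxAlg.nodes (G μ)).card =
            (κ + 12000) * (n + 1) ^ 3 * (MaxAlg.nodes (G μ)).card +
              20 * ((n + 1) ^ 3 * (MaxAlg.nodes (G μ)).card) := by ring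
        rw [mul_add, h7] at h5
        simp only [Test.cost, RExpr.cost, NExpr.cost]
        omega

theorem Runs.expansionProg {s : Store} (hsel : Selects sel κ A R K G t) (hc : Conservative sel)
    (hG : ∀ μ, (∀ ν ≤ μ, mcgm (restrict A (K ν)) ≠ 0) → Admissible (restrict A (K μ)) (G μ))
    (hK : ∀ μ, K (μ + 1) ⊆ K μ \ MaxAlg.nodes (G μ)) (hK0 : K 0 = Finset.univ)
    (hs : HoldsInput s A t) (h13 : HasMat s 13 R) :
    Runs (MaxAlg.expansionProg sel) s ((κ + 14000) * (n + 1) ^ 4) fun s' =>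
      ∃ m, s'.nat 2 0 0 0 = m ∧ (∀ ν < m, mcgm (restrict A (K ν)) ≠ 0) ∧
        mcgm (restrict A (K m)) = 0 ∧
        ∀ ν < m, ∀ i j : Fin n, s'.real 1 ν i j = csr (restrict A (K ν)) (G ν) t i j := by
  obtain ⟨⟨hn, hA⟩, ht⟩ := hs
  have hb1 : 1 ≤ (n + 1) ^ 3 := Nat.one_le_pow _ _ (by omega)
  have hb2 : n + 1 ≤ (n + 1) ^ 3 := Nat.le_self_pow (by norm_num) _
  have hb3 : (n + 1) ^ 3 ≤ (n + 1) ^ 4 := Nat.pow_le_pow_right (by omega) (by norm_num)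
  have hb4 : (κ + 12020) * (n + 1) ^ 3 * n ≤ κ * (n + 1) ^ 4 + 12020 * (n + 1) ^ 4 := by
    rw [← add_mul, pow_succ _ 3, ← mul_assoc]
    exact Nat.mul_le_mul_left _ (by omega)
  rw [add_mul]
  refine Runs.seq (b := 10) (b' := κ * (n + 1) ^ 4 + 13900 * (n + 1) ^ 4)
    (R := fun s' => s'.nat 2 0 0 0 = 0)
    (Runs.setNat (by simp [NExpr.cost]) (by simp [NExpr.eval])) (fun s1 ha1 h1 => ?_) (by omega)
  have hn1 : s1.nat 0 0 0 0 = n := by rw [ha1.nat 0 (by decide), hn]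
  refine Runs.seq (b := 80 * (n + 1)) (b' := κ * (n + 1) ^ 4 + 13800 * (n + 1) ^ 4)
    (R := fun s' => ∀ i : Fin n, s'.real 11 i 0 0 = 1) ?_ (fun s2 ha2 h2 => ?_) (by omega)
  · refine Runs.forLoop (N := n) (c := 40) (M := 1)
      (fun k s' => ∀ v : Fin n, (v : ℕ) < k → s'.real 11 v 0 0 = 1) hn1 (by decide)
      (by decide) (by decide) (fun _ _ _ h => h) (fun v hv => by omega) ?_
      (fun s' _ h v => h v v.2) le_rfl (by norm_num) (by simp)
    intro k hk s1 ha hk1 h1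
    refine Runs.setCell (by simp [NExpr.cost, RExpr.cost]) fun s2 _ h2 v hv => ?_
    simp only [NExpr.eval, RExpr.eval, hk1] at h2
    rw [h2]
    split_ifs with h3
    · rfl
    · exact h1 v (by omega)
  have hs2 : Ready A R K G t 0 s2 := by
    refine ⟨?_, ?_, ?_, ?_, ?_, fun i => by simp [h2, hK0], fun ν hν => by omega⟩
    · rw [ha2.nat 0 (by decide), hn1]
    · rw [ha2.nat 1 (by decide), ha1.nat 1 (by decide), ht]
    · rw [ha2.nat 2 (by decide), h1]
    · intro i j; rw [ha2.real 0 (by decide), ha1.real 0 (by decide)]; exact hA i j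
    · exact (h13.congr (ha1.real 13 (by decide))).congr (ha2.real 13 (by decide))
  refine Runs.seq (Runs.lambdaProg hs2.size hs2.matrix hs2.nodes)
    (b' := (κ + 12020) * (n + 1) ^ 3 * n + 20) ?_ (by omega)
  rintro s3 ha3 ⟨h3, h4⟩
  have hcard : (K 0).card = n := by rw [hK0, Finset.card_univ, Fintype.card_fin]
  refine Runs.expansionLoop hsel hc hG hK n 0 s3 hcard (by omega) (fun ν hν => by omega)
    ⟨?_, ?_, ?_, ?_, ?_, ?_, fun ν hν => by omega⟩ h3 h4 (fun ν hν => by omega)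
  · rw [ha3.nat 0 (by decide), hs2.size]
  · rw [ha3.nat 1 (by decide), hs2.exponent]
  · rw [ha3.nat 2 (by decide), hs2.step]
  · exact hs2.matrix.congr (ha3.real 0 (by decide))
  · exact hs2.aux.congr (ha3.real 13 (by decide))
  · exact hs2.nodes.congr (ha3.real 11 (by decide))

end Driver

/-- A quartic bound in `n + 1` is of the required form. -/
theorem quartic_le (c n : ℕ) :
    ((c * (n + 1) ^ 4 : ℕ) : ℝ) ≤ (32 * c : ℝ) * ((n : ℝ) ^ 4 * Real.log n + 1) := by
  have hc : (0 : ℝ) ≤ c := Nat.cast_nonneg c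
  -- For n ≥ 2, n + 1 ≤ 2n and log n ≥ 1/2 give the factor 2⁴ · 2 = 32. For n ≤ 1 the logarithm is 0
  -- (by convention at n = 0), and the summand 1 suffices.
  rcases Nat.lt_or_ge n 2 with hn | hn
  · interval_cases n
    · norm_num; nlinarith
    · norm_num; nlinarith
  · have h2 : (2 : ℝ) ≤ n := by exact_mod_cast hn
    have hlog : (1 / 2 : ℝ) ≤ Real.log n := by
      have h1 := Real.log_two_gt_d9
      have h3 := Real.log_le_log (by norm_num) h2
      linarith
    have h4 : ((n : ℝ) + 1) ^ 4 ≤ (2 * n) ^ 4 := by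
      apply pow_le_pow_left₀ <;> linarith
    push_cast
    calc (c : ℝ) * ((n : ℝ) + 1) ^ 4 ≤ c * (2 * n) ^ 4 := by gcongr
      _ = 32 * c * ((n : ℝ) ^ 4 * (1 / 2)) := by ring
      _ ≤ 32 * c * ((n : ℝ) ^ 4 * Real.log n) := by gcongr
      _ ≤ _ := by gcongr; linarith

end MaxAlg

namespace MaxAlg

variable {n : ℕ}

/-! ### Nachtigall expansions -/

/-- Call of the selection program `Q` on the arrays with numbers at least `30`. -/
def callSelection (Q : Prog) : Prog :=
  .seq (.setNat 30 (.lit 0) (.lit 0) (.lit 0) (var 0))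
  (.seq (fill 30 always (cell 0 (var 10) (var 11)) .zero)
  (.seq (.setNat 31 (.lit 0) (.lit 0) (.lit 0) (var 2))
  (.seq (forLoop 12 2 (forPairs
    (.setNat 32 (var 12) (var 10) (var 11) (.get 3 (var 12) (var 10) (var 11)))))
  (.seq (Q.shift 30)
    (forPairs (.seq
      (.setNat 3 (var 2) (var 10) (var 11) (.get 33 (var 10) (var 11) (.lit 0)))
      (.ite (.natLe (.lit 1) (.get 33 (var 10) (var 11) (.lit 0)))
        (setCell 11 (var 10) (.lit 0) .zero) .skip)))))))

theorem callSelection_conservative (Q : Prog) : Conservative (callSelection Q) := by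
  have h1 : ∀ a, a < 30 → a ∉ (Q.shift 30).natWrites := fun a ha h =>
    absurd (Prog.shift_natWrites 30 Q h) (by omega)
  have h2 : ∀ a, a < 30 → a ∉ (Q.shift 30).realWrites := fun a ha h =>
    absurd (Prog.shift_realWrites 30 Q h) (by omega)
  constructor
  · simp [callSelection, fill, forPairs, forLoop, Prog.natWrites, h1]
  · simp [callSelection, fill, forPairs, forLoop, Prog.realWrites, h2]

open scoped Classical in
/-- The nodes that do not belong to the digraphs in the list. -/
noncomputable def remaining (h : List (Digraph (Fin n))) : Finset (Fin n) :=
  Finset.univ.filter fun i => ∀ G ∈ h, i ∉ nodes G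

theorem mem_remaining {h : List (Digraph (Fin n))} {i : Fin n} :
    i ∈ remaining h ↔ ∀ G ∈ h, i ∉ nodes G := by simp [remaining]

/-- The first `k` digraphs that are selected by a rule. -/
def selections (σ : Rule) (A : Mat n) : ℕ → List (Digraph (Fin n))
  | 0 => []
  | k + 1 => selections σ A k ++ [σ n A (selections σ A k)]

theorem selections_length (σ : Rule) (A : Mat n) (k : ℕ) : (selections σ A k).length = k := by
  induction k with
  | zero => rfl
  | succ k ih => simp [selections, ih]

theorem selections_take (σ : Rule) (A : Mat n) {k m : ℕ} (h : k ≤ m) :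
    (selections σ A m).take k = selections σ A k := by
  induction m with
  | zero =>
    obtain rfl : k = 0 := by omega
    rfl
  | succ m ih =>
    rcases Nat.lt_succ_iff_lt_or_eq.1 (Nat.lt_succ_of_le h) with h' | rfl
    · rw [selections, List.take_append_of_le_length (by rw [selections_length]; omega),
        ih (by omega)]
    · exact List.take_of_length_le (by rw [selections_length])

theorem selections_get (σ : Rule) (A : Mat n) {k m : ℕ} (h : k < (selections σ A m).length) :
    (selections σ A m)[k] = σ n A (selections σ A k) := by
  have hk : k < m := by rwa [selections_length] at h
  have h1 : k < (selections σ A (k + 1)).length := by rw [selections_length]; omega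
  have h2 : (selections σ A m)[k] = (selections σ A (k + 1))[k] := by
    have := selections_take σ A (show k + 1 ≤ m by omega)
    simp only [← this, List.getElem_take]
  rw [h2]
  simp [selections, List.getElem_append_right, selections_length]

theorem selected_selections (σ : Rule) (A : Mat n) (m : ℕ)
    (h : ∀ k < m, mcgm (restrict A (remaining (selections σ A k))) ≠ 0) :
    Selected σ A (selections σ A m) := by
  intro k hk
  have hk' : k < m := by rwa [selections_length] at hk
  rw [selections_get, selections_take σ A hk'.le]
  exact ⟨h k hk', rfl⟩

/-- The history is copied in O(μ n²) operations, which is cubic because μ ≤ n. The callee's memory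
consists of the arrays from 30 on; only its input cells have to be prepared, since `hQ` assumes
nothing about the others. Nonzero λ at all steps up to μ guarantees that the rule is consulted only
on histories for which it is specified. -/
theorem callSelection_selects {σ : Rule} (hσ : IsSelectionRule σ) {Q : Prog} {κ : ℕ}
    (hQ : ∀ (n : ℕ) (A : Mat n) (h : List (Digraph (Fin n))),
      Selected σ A h → mcgm (residual A h) ≠ 0 → ∀ s : Store, HoldsHistory s A h →
        ∃ (T : ℕ) (s' : Store), Exec Q s T s' ∧ T ≤ κ * n ^ 3 ∧ HoldsDigraph s' (σ n A h))
    (A R : Mat n) (t : ℕ) :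
    Selects (callSelection Q) (κ + 1000) A R (fun k => remaining (selections σ A k))
      (fun k => σ n A (selections σ A k)) t := by
  intro μ s hl hμn hs _
  have q1 : ∀ a, a < 30 → a ∉ (Q.shift 30).natWrites := fun a ha h =>
    absurd (Prog.shift_natWrites 30 Q h) (by omega)
  have q2 : ∀ a, a < 30 → a ∉ (Q.shift 30).realWrites := fun a ha h =>
    absurd (Prog.shift_realWrites 30 Q h) (by omega)
  have hb0 : 1 ≤ (n + 1) ^ 3 := Nat.one_le_pow _ _ (by omega)
  have hb1 : (n + 1) ^ 2 ≤ (n + 1) ^ 3 := Nat.pow_le_pow_right (by omega) (by norm_num)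
  have hb2 : (μ + 1) * (n + 1) ^ 2 ≤ (n + 1) ^ 3 := by
    rw [pow_succ' _ 2]; exact Nat.mul_le_mul_right _ (by omega)
  have hb3 : κ * n ^ 3 ≤ κ * (n + 1) ^ 3 :=
    Nat.mul_le_mul_left _ (Nat.pow_le_pow_left (by omega) _)
  rw [add_mul]
  set B := (n + 1) ^ 3
  refine Runs.seq (b := 20) (b' := κ * B + 900 * B) (R := fun s' => s'.nat 30 0 0 0 = n)
    (Runs.setNat (by simp [NExpr.cost]) (by simp [NExpr.eval, hs.size])) (fun s1 ha1 h1 => ?_)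
    (by omega)
  have hn1 : s1.nat 0 0 0 0 = n := by rw [ha1.nat 0 (by decide), hs.size]
  refine Runs.seq (Runs.fill (c := 150) A hn1
    (fun i j s' ha hi hj => ⟨fun _ => ?_, fun h => (h (always_holds s')).elim⟩)
    (by simp [Test.cost, NExpr.cost, RExpr.cost])) (b' := κ * B + 700 * B)
    (fun s2 ha2 h2 => ?_) (by omega)
  · simp only [RExpr.eval, NExpr.eval, hi, hj, ha.real 0 (by decide), ha1.real 0 (by decide)]
    exact hs.matrix i j
  have hn2 : s2.nat 0 0 0 0 = n := by rw [ha2.nat 0 (by decide), hn1]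
  have hμ2 : s2.nat 2 0 0 0 = μ := by rw [ha2.nat 2 (by decide), ha1.nat 2 (by decide), hs.step]
  refine Runs.seq (b := 20) (b' := κ * B + 600 * B) (R := fun s' => s'.nat 31 0 0 0 = μ)
    (Runs.setNat (by simp [NExpr.cost]) (by simp [NExpr.eval, hμ2])) (fun s3 ha3 h3 => ?_)
    (by omega)
  have hn3 : s3.nat 0 0 0 0 = n := by rw [ha3.nat 0 (by decide), hn2]
  have hμ3 : s3.nat 2 0 0 0 = μ := by rw [ha3.nat 2 (by decide), hμ2]
  have hh3 : s3.nat 3 = s.nat 3 := by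
    rw [ha3.nat 3 (by decide), ha2.nat 3 (by decide), ha1.nat 3 (by decide)]
  refine Runs.seq (b := 250 * ((μ + 1) * (n + 1) ^ 2)) (b' := κ * B + 300 * B)
    (R := fun s' => ∀ ν < μ, ∀ i j : Fin n, s'.nat 32 ν i j = s.nat 3 ν i j) ?_
    (fun s4 ha4 h4 => ?_) (by omega)
  · refine Runs.forLoop (N := μ) (c := 200) (M := (n + 1) ^ 2)
      (fun k s' => ∀ ν < k, ∀ i j : Fin n, s'.nat 32 ν i j = s.nat 3 ν i j) hμ3 (by decide)
      (by decide) (by decide) (fun k s x h => by simpa [Store.setNat_nat] using h)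
      (fun ν hν => by omega) ?_ (fun _ _ h => h) (Nat.one_le_pow _ _ (by omega))
      (by norm_num) le_rfl
    intro k hk s4 ha4 hk4 h4
    refine (Runs.forPairs (n := n) (c := 100)
      (fun s' => ∀ ν < k, ∀ i j : Fin n, s'.nat 32 ν i j = s.nat 3 ν i j)
      (fun i j s' => s'.nat 32 k i j = s.nat 3 k i j) (by rw [ha4.nat 0 (by decide), hn3])
      (by decide) (fun i j s x h => by simpa [Store.setNat_nat] using h)
      (fun s x h => by simpa [Store.setNat_nat] using h) h4 ?_ (by norm_num)).mono le_rfl ?_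
    · intro i j s5 ha5 hi hj hJ hP
      refine Runs.setNat (by simp [NExpr.cost]) ?_
      simp only [NExpr.eval, hi, hj, ha5.nat 12 (by decide), hk4, ha5.nat 3 (by decide),
        ha4.nat 3 (by decide), hh3, Store.setNat_nat, true_and]
      refine ⟨fun ν hν i' j' => ?_, by simp, fun i' j' h => ?_⟩
      · rw [if_neg (by omega)]; exact hJ ν hν i' j'
      · split_ifs with h'
        · rw [h'.1, h'.2]
        · exact hP i' j' h
    · rintro s5 - ⟨h5, h6⟩ ν hν
      rcases Nat.lt_succ_iff_lt_or_eq.1 hν with h | rfl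
      · exact h5 ν h
      · exact h6
  have hist : HoldsHistory (s4.drop 30) A (selections σ A μ) := by
    refine ⟨⟨?_, fun i j => ?_⟩, ?_, fun ν i j => ?_⟩
    · simp only [Store.drop]
      rw [ha4.nat _ (by decide), ha3.nat _ (by decide), ha2.nat _ (by decide)]
      exact h1
    · simp only [Store.drop]
      rw [ha4.real _ (by decide), ha3.real _ (by decide)]
      exact h2 i j
    · simp only [Store.drop]
      rw [ha4.nat _ (by decide), selections_length]
      exact h3
    · have hν : (ν : ℕ) < μ := ν.2.trans_eq (selections_length σ A μ)
      refine (h4 ν hν i j).trans ?_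
      rw [hs.history ν hν i j]
      rw [Fin.getElem_fin, selections_get σ A ν.2]
  have hl1 : mcgm (residual A (selections σ A μ)) ≠ 0 := hl μ le_rfl
  have hsel : Selected σ A (selections σ A μ) :=
    selected_selections σ A μ fun k hk => hl k hk.le
  have hadm := hσ n A _ hsel hl1
  obtain ⟨T, sq, he, hT, hd⟩ := hQ n A _ hsel hl1 _ hist
  obtain ⟨s5, he5, h5⟩ := he.shift 30 s4 rfl
  have ha5 := he5.agree
  set G := σ n A (selections σ A μ) with hG
  have hd5 : ∀ i j : Fin n, (1 ≤ s5.nat 33 i j 0 ↔ G.Adj i j) ∧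
      (G.Adj i j → s5.nat 33 i j 0 = 1) ∧ (¬ G.Adj i j → s5.nat 33 i j 0 = 0) := by
    intro i j
    have h6 := hd i j
    rw [← h5] at h6
    have h7 : s5.nat 33 i j 0 = (s5.drop 30).nat 3 i j 0 := rfl
    rw [h7, h6]
    by_cases h : G.Adj i j <;> simp [h]
  refine Runs.seq (b := κ * B) (b' := 300 * B) (R := fun s' => s' = s5)
    ⟨T, s5, he5, by omega, rfl⟩ ?_ le_rfl
  rintro s5' - rfl
  have hn5 : s5'.nat 0 0 0 0 = n := by
    rw [ha5.nat 0 (q1 0 (by norm_num)), ha4.nat 0 (by decide), hn3]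
  have hμ5 : s5'.nat 2 0 0 0 = μ := by
    rw [ha5.nat 2 (q1 2 (by norm_num)), ha4.nat 2 (by decide), hμ3]
  have hh5 : s5'.nat 3 = s.nat 3 := by
    rw [ha5.nat 3 (q1 3 (by norm_num)), ha4.nat 3 (by decide), hh3]
  have hK5 : HasNodes s5' (remaining (selections σ A μ)) := hs.nodes.congr (by
    rw [ha5.real 11 (q2 11 (by norm_num)), ha4.real 11 (by decide), ha3.real 11 (by decide),
      ha2.real 11 (by decide), ha1.real 11 (by decide)])
  refine (Runs.forPairs (n := n) (c := 150) (c' := 300)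
    (fun s' => (∀ ν < μ, HasInc s' 3 ν (σ n A (selections σ A ν))) ∧
      ∀ i : Fin n, s'.real 11 i 0 0 = s5'.real 11 i 0 0 ∨
        (s'.real 11 i 0 0 = 0 ∧ ∃ j, G.Adj i j))
    (fun i j s' => s'.nat 3 μ i j = s5'.nat 33 i j 0 ∧ (G.Adj i j → s'.real 11 i 0 0 = 0)) hn5
    (by decide) (fun i j s x h => by simpa [Store.setNat_nat] using h)
    (fun s x h => by simpa [Store.setNat_nat, HasInc] using h)
    ⟨fun ν hν => (hs.history ν hν).congr hh5, fun i => .inl rfl⟩ ?_ (by norm_num)).mono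
    (Nat.mul_le_mul_left _ hb1) ?_
  · rintro i j s6 ha6 hi hj ⟨hJ1, hJ2⟩ hP
    have e2 : s6.nat 2 0 0 0 = μ := by rw [ha6.nat 2 (by decide), hμ5]
    have e33 : s6.nat 33 = s5'.nat 33 := ha6.nat 33 (by decide)
    refine Runs.seq (b := 50) (b' := 90) (R := fun s' => s'.real = s6.real ∧
      ∀ x y z, s'.nat 3 x y z = if x = μ ∧ y = i ∧ z = j then s5'.nat 33 i j 0 else
        s6.nat 3 x y z) ?_ ?_ (by norm_num)
    · refine Runs.setNat (by simp [NExpr.cost]) ⟨rfl, fun x y z => ?_⟩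
      simp [NExpr.eval, hi, hj, e2, e33, Store.setNat_nat]
    rintro s7 ha7 ⟨h7, h8⟩
    have hi7 : s7.nat 10 0 0 0 = i := by rw [ha7.nat 10 (by decide), hi]
    have hj7 : s7.nat 11 0 0 0 = j := by rw [ha7.nat 11 (by decide), hj]
    have e33' : s7.nat 33 = s5'.nat 33 := by rw [ha7.nat 33 (by decide), e33]
    have g1 : ∀ ν < μ, HasInc s7 3 ν (σ n A (selections σ A ν)) := by
      intro ν hν x y
      rw [h8, if_neg (by omega)]
      exact hJ1 ν hν x y
    have g2 : ∀ i' j' : Fin n, i' < i ∨ i' = i ∧ j' < j → s7.nat 3 μ i' j' = s5'.nat 33 i' j' 0 := by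
      intro i' j' h
      rw [h8]
      split_ifs with h'
      · rw [h'.2.1, h'.2.2]
      · exact (hP i' j' h).1
    have g3 : s7.nat 3 μ i j = s5'.nat 33 i j 0 := by rw [h8, if_pos ⟨rfl, rfl, rfl⟩]
    refine Runs.ite (B := 40) (fun hb => ?_) (fun hb => ?_) (by simp [Test.cost, NExpr.cost])
    · simp only [Test.Holds, NExpr.eval, hi7, hj7, e33', (hd5 i j).1] at hb
      refine Runs.setCell (by simp [NExpr.cost, RExpr.cost]) fun s8 hnat8 h9 => ?_
      simp only [NExpr.eval, RExpr.eval, hi7, h7] at h9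
      rw [hnat8]
      refine ⟨⟨fun ν hν => (g1 ν hν).congr (congrFun hnat8 3), fun i' => ?_⟩,
        ⟨g3, fun _ => by rw [h9, if_pos ⟨rfl, rfl, rfl⟩]⟩, fun i' j' h => ⟨g2 i' j' h, fun h' => ?_⟩⟩
      · rw [h9]
        split_ifs with h
        · exact .inr ⟨rfl, j, by rwa [Fin.ext h.1]⟩
        · exact hJ2 i'
      · rw [h9]
        split_ifs
        · rfl
        · exact (hP i' j' h).2 h'
    · simp only [Test.Holds, NExpr.eval, hi7, hj7, e33', (hd5 i j).1] at hb
      refine Runs.skip (by norm_num) ⟨⟨g1, fun i' => ?_⟩, ⟨g3, fun h => (hb h).elim⟩,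
        fun i' j' h => ⟨g2 i' j' h, fun h' => ?_⟩⟩
      · rw [h7]; exact hJ2 i'
      · rw [h7]; exact (hP i' j' h).2 h'
  · rintro s6 - ⟨⟨h6, h7⟩, h8⟩
    constructor
    · intro i
      have hiff : i ∈ remaining (selections σ A (μ + 1)) ↔
          i ∈ remaining (selections σ A μ) ∧ ¬ ∃ j, G.Adj i j := by
        rw [mem_remaining, mem_remaining, selections, ← hG]
        simp only [List.mem_append, List.mem_singleton]
        have hnode : i ∈ nodes G ↔ ∃ j, G.Adj i j :=
          ⟨fun h => hadm.2.2.exists_adj h, fun ⟨j, hj⟩ => mem_nodes.2 ⟨j, .inl hj⟩⟩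
        rw [← hnode]
        constructor
        · exact fun h => ⟨fun H hH => h H (.inl hH), h G (.inr rfl)⟩
        · rintro ⟨h9, h10⟩ H (hH | rfl)
          · exact h9 H hH
          · exact h10
      by_cases h : ∃ j, G.Adj i j
      · obtain ⟨j, hj⟩ := h
        rw [(h8 i j).2 hj, if_neg fun h => (hiff.1 h).2 ⟨j, hj⟩]
      · rw [(h7 i).resolve_right fun h' => h h'.2, hK5 i]
        by_cases h' : i ∈ remaining (selections σ A μ)
        · rw [if_pos h', if_pos (hiff.2 ⟨h', h⟩)]
        · rw [if_neg h', if_neg fun h'' => h' (hiff.1 h'').1]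
    · intro ν hν
      rcases lt_or_eq_of_le hν with h | rfl
      · exact h6 ν h
      · intro i j
        rw [(h8 i j).1]
        split_ifs with h
        · exact (hd5 i j).2.1 h
        · exact (hd5 i j).2.2 h

theorem solvesNachtigall {σ : Rule} (hσ : IsSelectionRule σ) (hQ : CubicSelection σ) :
    ∃ (P : Prog) (c : ℝ), SolvesNachtigall σ P fun n => c * ((n : ℝ) ^ 4 * Real.log n + 1) := by
  obtain ⟨Q, κ, hQ⟩ := hQ
  refine ⟨expansionProg (callSelection Q), 32 * ((κ + 1000 + 14000 : ℕ) : ℝ),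
    fun n A t s hs => ?_⟩
  -- No auxiliary matrix is needed here, so whatever the real array 13 contains is taken for it.
  obtain ⟨T, s', he, hT, m, hm, hl, h0, hout⟩ := Runs.expansionProg
    (callSelection_selects hσ hQ A (fun i j => s.real 13 i j 0) t) (callSelection_conservative Q)
    (fun μ hl => hσ n A _ (selected_selections σ A μ fun k hk => hl k hk.le) (hl μ le_rfl))
    (fun μ i hi => by
      rw [mem_remaining, selections] at hi
      rw [Finset.mem_sdiff, mem_remaining]
      exact ⟨fun G hG => hi G (List.mem_append_left _ hG), hi _ (by simp)⟩)
    (by ext i; simp [mem_remaining, selections]) hs (fun i j => rfl)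
  refine ⟨T, s', selections σ A m, he, (Nat.cast_le.2 hT).trans (quartic_le _ n),
    ⟨selected_selections σ A m hl, h0⟩, by rw [hm, selections_length], fun μ i j => ?_⟩
  have hμ : (μ : ℕ) < m := μ.2.trans_eq (selections_length σ A m)
  rw [hout μ hμ i j]
  simp only [Fin.getElem_fin, selections_get, selections_take σ A hμ.le]
  rfl

end MaxAlg

namespace MaxAlg

variable {n : ℕ}

/-! ### The ultimate expansion -/

open scoped Classical in
/-- The indicator matrix of the digraph of `A`. -/
noncomputable def indicator (A : Mat n) : Mat n := fun i j => if A i j ≤ 0 then 0 else 1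

theorem pow_indicator_le (A : Mat n) (k : ℕ) (i j : Fin n) : pow (indicator A) k i j ≤ 1 := by
  induction k generalizing j with
  | zero => simp only [pow, one]; split_ifs <;> simp
  | succ k ih =>
    refine mul_le fun x => mul_le_one' (ih x) ?_
    simp only [indicator]; split_ifs <;> simp

theorem indicator_bounded (A : Mat n) : Bounded (indicator A) := fun k x => pow_indicator_le A k x x

theorem indicator_ne_zero {A : Mat n} {i j : Fin n} : indicator A i j ≠ 0 ↔ A i j ≠ 0 := by
  simp [indicator]

/-- Reachability is a Kleene star of a 0/1 matrix, which is bounded without normalization; one run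
of Floyd–Warshall therefore determines all strongly connected components of D(A). -/
theorem star_indicator_ne_zero (A : Mat n) (i j : Fin n) :
    star (indicator A) i j ≠ 0 ↔ Reach (support A) i j := by
  have hb := indicator_bounded A
  constructor
  · intro h
    obtain ⟨k, hk⟩ := hb.exists_star_eq i j
    rw [hk] at h
    obtain ⟨c, rfl, rfl, hw⟩ := exists_walk _ _ _ _ h
    rw [← hw] at h
    clear hk hw
    induction k with
    | zero => exact .refl
    | succ k ih =>
      rw [wt, Finset.prod_range_succ] at h
      exact (ih (left_ne_zero_of_mul h)).tail (indicator_ne_zero.1 (right_ne_zero_of_mul h))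
  · intro h
    have : ∃ k, pow (indicator A) k i j ≠ 0 := by
      induction h with
      | refl => exact ⟨0, by simp [pow_zero_self]⟩
      | tail _ h ih =>
        obtain ⟨k, hk⟩ := ih
        exact ⟨k + 1, pow_add_ne_zero hk (by rw [pow_one']; exact indicator_ne_zero.2 h)⟩
    obtain ⟨k, hk⟩ := this
    exact fun h0 => hk (le_antisymm ((hb.pow_le_star k i j).trans h0.le) zero_le)

/-- Computation of the reachability relation of the digraph of the input matrix. -/
def reachProg : Prog :=
  .seq (fill 13 (.realLe (cell 0 (var 10) (var 11)) .zero) .zero .one) (floydWarshall 13)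

theorem Runs.reachProg {s : Store} {A : Mat n} (hn : s.nat 0 0 0 0 = n) (hA : HasMat s 0 A) :
    Runs MaxAlg.reachProg s (500 * (n + 1) ^ 3) fun s' => HasMat s' 13 (star (indicator A)) := by
  have hb1 : (n + 1) ^ 2 ≤ (n + 1) ^ 3 := Nat.pow_le_pow_right (by omega) (by norm_num)
  refine Runs.seq (Runs.fill (c := 150) (indicator A) hn (fun i j s' ha hi hj => ?_)
    (by simp [Test.cost, NExpr.cost, RExpr.cost])) (b' := 300 * (n + 1) ^ 3)
    (fun s1 ha1 h1 => ?_) (by omega)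
  · simp only [Test.Holds, RExpr.eval, NExpr.eval, hi, hj, ha.real 0 (by decide), hA i j,
      indicator]
    exact ⟨fun h => by rw [if_pos h], fun h => by rw [if_neg h]⟩
  · exact Runs.floydWarshall (indicator_bounded A) (by rw [ha1.nat 0 (by decide), hn]) h1

/-- Selection of the critical digraph, and removal of all components that meet it. -/
def selectCritical : Prog :=
  .seq (fill 12 always (cell 2 (var 10) (var 11)) .zero)
  (.seq (floydWarshall 12)
  (.seq (forPairs (.ite (.realLe .one (.mul (cell 2 (var 10) (var 11)) (cell 12 (var 11) (var 10))))
      (.setNat 3 (var 2) (var 10) (var 11) (.lit 1))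
      (.setNat 3 (var 2) (var 10) (var 11) (.lit 0))))
    (forLoop 12 0 (forPairs (.ite (.and (.natLe (.lit 1) (.get 3 (var 2) (var 12) (var 10)))
        (.and (.not (.realLe (cell 13 (var 11) (var 12)) .zero))
          (.not (.realLe (cell 13 (var 12) (var 11)) .zero))))
      (setCell 11 (var 11) (.lit 0) .zero) .skip)))))

theorem selectCritical_conservative : Conservative selectCritical := by
  constructor <;> decide

theorem mem_ultNodes_succ (A : Mat n) (k : ℕ) (i : Fin n) :
    i ∈ ultNodes A (k + 1) ↔ i ∈ ultNodes A k ∧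
      ¬ ∃ j ∈ nodes (critical (ultMat A k)), SameComp (support A) i j := by
  simp [ultNodes, ultMat]

/-- Criticality of edges is tested with `critical_adj_iff` on the current normalized matrix. The
components to be removed are those of the original D(A), so their reachability matrix is computed
once in advance and kept as the auxiliary matrix. -/
theorem selectCritical_selects (A : Mat n) (t : ℕ) :
    Selects selectCritical 1500 A (star (indicator A)) (ultNodes A)
      (fun k => critical (ultMat A k)) t := by
  intro μ s hl hμn hs h2
  have hl1 : mcgm (ultMat A μ) ≠ 0 := hl μ le_rfl
  have hb1 : (n + 1) ^ 2 ≤ (n + 1) ^ 3 := Nat.pow_le_pow_right (by omega) (by norm_num)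
  set M := normalize (ultMat A μ) with hM
  set G := critical (ultMat A μ) with hG
  have hadm : Admissible (ultMat A μ) G := critical_admissible hl1
  refine Runs.seq (Runs.fill (c := 150) M hs.size
    (fun i j s' ha hi hj => ⟨fun _ => ?_, fun h => (h (always_holds s')).elim⟩)
    (by simp [Test.cost, NExpr.cost, RExpr.cost])) (b' := 1300 * (n + 1) ^ 3)
    (fun s1 ha1 h1 => ?_) (by omega)
  · simp only [RExpr.eval, NExpr.eval, hi, hj, ha.real 2 (by decide)]
    exact h2 i j
  have hn1 : s1.nat 0 0 0 0 = n := by rw [ha1.nat 0 (by decide), hs.size]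
  refine Runs.seq (Runs.floydWarshall (normalize_bounded _) hn1 h1) (b' := 1000 * (n + 1) ^ 3)
    (fun s2 ha2 h3 => ?_) (by omega)
  have hn2 : s2.nat 0 0 0 0 = n := by rw [ha2.nat 0 (by decide), hn1]
  have hμ2 : s2.nat 2 0 0 0 = μ := by rw [ha2.nat 2 (by decide), ha1.nat 2 (by decide), hs.step]
  have hM2 : HasMat s2 2 M := HasMat.congr h2
    (by rw [ha2.real 2 (by decide), ha1.real 2 (by decide)])
  refine Runs.seq (b := 200 * (n + 1) ^ 2) (b' := 700 * (n + 1) ^ 3)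
    (R := fun s' => ∀ ν ≤ μ, HasInc s' 3 ν (critical (ultMat A ν))) ?_ (fun s3 ha3 h4 => ?_)
    (by omega)
  · refine (Runs.forPairs (n := n) (c := 80)
      (fun s' => ∀ ν < μ, HasInc s' 3 ν (critical (ultMat A ν)))
      (fun i j s' => (G.Adj i j → s'.nat 3 μ i j = 1) ∧ (¬ G.Adj i j → s'.nat 3 μ i j = 0)) hn2
      (by decide) (fun i j s x h => by simpa [Store.setNat_nat] using h)
      (fun s x h => by simpa [Store.setNat_nat, HasInc] using h)
      (fun ν hν => (hs.history ν hν).congr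
        (by rw [ha2.nat 3 (by decide), ha1.nat 3 (by decide)])) ?_ (by norm_num)).mono le_rfl ?_
    · intro i j s3 ha3 hi hj hJ hP
      have hadj : G.Adj i j ↔ 1 ≤ s3.real 2 i j 0 * s3.real 12 j i 0 := by
        rw [critical_adj_iff hl1, ha3.real 2 (by decide), ha3.real 12 (by decide), hM2 i j, h3 j i]
      have fin : ∀ v, (G.Adj i j → v = 1) → (¬ G.Adj i j → v = 0) →
          Runs (.setNat 3 (var 2) (var 10) (var 11) (.lit v)) s3 40 fun s'' =>
            (∀ ν < μ, HasInc s'' 3 ν (critical (ultMat A ν))) ∧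
            ((G.Adj i j → s''.nat 3 μ i j = 1) ∧ (¬ G.Adj i j → s''.nat 3 μ i j = 0)) ∧
            ∀ i' j' : Fin n, i' < i ∨ i' = i ∧ j' < j →
              (G.Adj i' j' → s''.nat 3 μ i' j' = 1) ∧ (¬ G.Adj i' j' → s''.nat 3 μ i' j' = 0) := by
        intro v hv1 hv0
        refine Runs.setNat (by simp [NExpr.cost]) ?_
        have e : ∀ x y z, (s3.setNat 3 μ i j v).nat 3 x y z =
            if x = μ ∧ y = i ∧ z = j then v else s3.nat 3 x y z := by
          simp [Store.setNat_nat]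
        simp only [NExpr.eval, ha3.nat 2 (by decide), hμ2, hi, hj]
        refine ⟨fun ν hν x y => ?_, ?_, fun i' j' h => ?_⟩
        · rw [e, if_neg (by omega)]; exact hJ ν hν x y
        · rw [e, if_pos ⟨rfl, rfl, rfl⟩]; exact ⟨hv1, hv0⟩
        · rw [e]
          split_ifs with h'
          · rw [Fin.ext h'.2.1, Fin.ext h'.2.2]; exact ⟨hv1, hv0⟩
          · exact hP i' j' h
      refine Runs.ite (B := 40) (fun hb => ?_) (fun hb => ?_)
        (by simp [Test.cost, NExpr.cost, RExpr.cost])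
      · simp only [Test.Holds, NExpr.eval, RExpr.eval, hi, hj, ← hadj] at hb
        exact fin 1 (fun _ => rfl) (fun h => (h hb).elim)
      · simp only [Test.Holds, NExpr.eval, RExpr.eval, hi, hj, ← hadj] at hb
        exact fin 0 (fun h => (hb h).elim) (fun _ => rfl)
    · rintro s3 - ⟨h4, h5⟩ ν hν
      rcases lt_or_eq_of_le hν with h | rfl
      · exact h4 ν h
      · intro i j
        split_ifs with h
        · exact (h5 i j).1 h
        · exact (h5 i j).2 h
  have hn3 : s3.nat 0 0 0 0 = n := by rw [ha3.nat 0 (by decide), hn2]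
  have hμ3 : s3.nat 2 0 0 0 = μ := by rw [ha3.nat 2 (by decide), hμ2]
  have hR3 : HasMat s3 13 (star (indicator A)) := hs.aux.congr (by
    rw [ha3.real 13 (by decide), ha2.real 13 (by decide), ha1.real 13 (by decide)])
  have hK3 : HasNodes s3 (ultNodes A μ) := hs.nodes.congr (by
    rw [ha3.real 11 (by decide), ha2.real 11 (by decide), ha1.real 11 (by decide)])
  refine (Runs.forLoop (N := n) (c := 300) (M := (n + 1) ^ 2) (c' := 700) (M' := (n + 1) ^ 3)
    (fun k s' => ∀ i : Fin n,
      (s'.real 11 i 0 0 = s3.real 11 i 0 0 ∨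
        (s'.real 11 i 0 0 = 0 ∧ ∃ j ∈ nodes G, SameComp (support A) i j)) ∧
      ((∃ j ∈ nodes G, (j : ℕ) < k ∧ SameComp (support A) i j) → s'.real 11 i 0 0 = 0))
    hn3 (by decide) (by decide) (by decide) (fun _ _ _ h => h)
    (fun i => ⟨.inl rfl, fun ⟨j, _, hj, _⟩ => by omega⟩) ?_ (fun s4 ha4 h5 => ?_)
    (Nat.one_le_pow _ _ (by omega)) (by norm_num) (by rw [pow_succ' _ 2]))
  · intro k hk s4 ha4 hk4 h5
    refine (Runs.forPairs (n := n) (c := 200)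
      (fun s' => ∀ i : Fin n,
        (s'.real 11 i 0 0 = s3.real 11 i 0 0 ∨
          (s'.real 11 i 0 0 = 0 ∧ ∃ j ∈ nodes G, SameComp (support A) i j)) ∧
        ((∃ j ∈ nodes G, (j : ℕ) < k ∧ SameComp (support A) i j) → s'.real 11 i 0 0 = 0))
      (fun l i s' => G.Adj ⟨k, hk⟩ l → SameComp (support A) i ⟨k, hk⟩ → s'.real 11 i 0 0 = 0)
      (by rw [ha4.nat 0 (by decide), hn3]) (by decide) (fun _ _ _ _ h => ⟨h, h⟩)
      (fun _ _ h => ⟨h, h⟩) h5 ?_ (by norm_num)).mono le_rfl ?_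
    · intro l i s5 ha5 hl5 hi5 hJ hP
      have hinc : HasInc s5 3 μ G := (h4 μ le_rfl).congr
        (by rw [ha5.nat 3 (by decide), ha4.nat 3 (by decide)])
      have hR5 : HasMat s5 13 (star (indicator A)) := hR3.congr
        (by rw [ha5.real 13 (by decide), ha4.real 13 (by decide)])
      have hk5 : s5.nat 12 0 0 0 = k := by rw [ha5.nat 12 (by decide), hk4]
      have hμ5 : s5.nat 2 0 0 0 = μ := by rw [ha5.nat 2 (by decide), ha4.nat 2 (by decide), hμ3]
      have hcond : (1 ≤ s5.nat 3 μ k l ∧ ¬ s5.real 13 i k 0 ≤ 0 ∧ ¬ s5.real 13 k i 0 ≤ 0) ↔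
          G.Adj ⟨k, hk⟩ l ∧ SameComp (support A) i ⟨k, hk⟩ := by
        have e1 := hinc.one_le_iff ⟨k, hk⟩ l
        have e2 := hR5 i ⟨k, hk⟩
        have e3 := hR5 ⟨k, hk⟩ i
        simp only at e1 e2 e3
        rw [e1, e2, e3, nonpos_iff_eq_zero, nonpos_iff_eq_zero, ← Ne, ← Ne,
          star_indicator_ne_zero, star_indicator_ne_zero, SameComp]
      refine Runs.ite (B := 40) (fun hb => ?_) (fun hb => ?_)
        (by simp [Test.cost, NExpr.cost, RExpr.cost])
      · simp only [Test.Holds, NExpr.eval, RExpr.eval, hl5, hi5, hk5, hμ5, hcond] at hb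
        refine Runs.setCell (by simp [NExpr.cost, RExpr.cost]) fun s6 _ h6 => ?_
        simp only [NExpr.eval, RExpr.eval, hi5] at h6
        have hz : ∀ i' : Fin n, s5.real 11 i' 0 0 = 0 → s6.real 11 i' 0 0 = 0 := by
          intro i' h
          rw [h6]; split_ifs
          · rfl
          · exact h
        refine ⟨fun i' => ⟨?_, fun h => hz i' ((hJ i').2 h)⟩,
          fun _ _ => by rw [h6, if_pos ⟨rfl, rfl, rfl⟩],
          fun l' i' h h7 h8 => hz i' (hP l' i' h h7 h8)⟩
        rw [h6]
        split_ifs with h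
        · rw [Fin.ext h.1]
          exact .inr ⟨rfl, _, mem_nodes.2 ⟨l, .inl hb.1⟩, hb.2⟩
        · exact (hJ i').1
      · simp only [Test.Holds, NExpr.eval, RExpr.eval, hl5, hi5, hk5, hμ5, hcond] at hb
        exact Runs.skip (by norm_num) ⟨hJ, fun h7 h8 => (hb ⟨h7, h8⟩).elim, hP⟩
    · rintro s5 - ⟨h6, h7⟩ i
      refine ⟨(h6 i).1, ?_⟩
      rintro ⟨j, hj, hjk, hij⟩
      rcases Nat.lt_succ_iff_lt_or_eq.1 hjk with h | h
      · exact (h6 i).2 ⟨j, hj, h, hij⟩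
      · obtain rfl : j = ⟨k, hk⟩ := Fin.ext h
        -- The program notices a critical node only through an outgoing critical edge, which exists
        -- by complete reducibility.
        obtain ⟨l, hl'⟩ := hadm.2.2.exists_adj hj
        exact h7 l i hl' hij
  · refine ⟨fun i => ?_, fun ν hν => (h4 ν hν).congr (ha4.nat 3 (by decide))⟩
    obtain ⟨h6, h7⟩ := h5 i
    have hiff := mem_ultNodes_succ A μ i
    by_cases h : ∃ j ∈ nodes G, SameComp (support A) i j
    · obtain ⟨j, hj, hij⟩ := h
      rw [h7 ⟨j, hj, j.2, hij⟩, if_neg fun h => (hiff.1 h).2 ⟨j, hj, hij⟩]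
    · rw [h6.resolve_right fun h' => h h'.2, hK3 i]
      by_cases h' : i ∈ ultNodes A μ
      · rw [if_pos h', if_pos (hiff.2 ⟨h', h⟩)]
      · rw [if_neg h', if_neg fun h'' => h' (hiff.1 h'').1]

theorem solvesUltimate :
    ∃ (P : Prog) (c : ℝ), SolvesUltimate P fun n => c * ((n : ℝ) ^ 4 * Real.log n + 1) := by
  refine ⟨.seq reachProg (expansionProg selectCritical), 32 * ((16000 : ℕ) : ℝ),
    fun n A t s hs => ?_⟩
  have hb3 : (n + 1) ^ 3 ≤ (n + 1) ^ 4 := Nat.pow_le_pow_right (by omega) (by norm_num)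
  have hrun : Runs (.seq reachProg (expansionProg selectCritical)) s (16000 * (n + 1) ^ 4)
      fun s' => ∃ m, s'.nat 2 0 0 0 = m ∧ (∀ ν < m, mcgm (ultMat A ν) ≠ 0) ∧
        mcgm (ultMat A m) = 0 ∧
        ∀ ν < m, ∀ i j : Fin n, s'.real 1 ν i j = ultTerm A ν t i j := by
    refine Runs.seq (Runs.reachProg hs.1.1 hs.1.2) (fun s1 ha1 h1 => Runs.expansionProg
      (selectCritical_selects A t) selectCritical_conservative
      (fun μ hl => critical_admissible (hl μ le_rfl)) (fun μ i hi => ?_) rfl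
      ⟨⟨?_, fun i j => ?_⟩, ?_⟩ h1) (by omega)
    -- A critical node belongs to its own component of D(A), so all critical nodes are removed.
    · obtain ⟨h1, h2⟩ := (mem_ultNodes_succ A μ i).1 hi
      exact Finset.mem_sdiff.2 ⟨h1, fun h => h2 ⟨i, h, .refl, .refl⟩⟩
    · rw [ha1.nat 0 (by decide), hs.1.1]
    · rw [ha1.real 0 (by decide), hs.1.2]
    · rw [ha1.nat 1 (by decide), hs.2]
  obtain ⟨T, s', he, hT, m, hm, hl, h0, hout⟩ := hrun
  exact ⟨T, s', m, he, (Nat.cast_le.2 hT).trans (quartic_le _ n), hl, h0, hm,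
    fun μ i j => hout μ μ.2 i j⟩

end MaxAlg

theorem theorem6p1 :
    (∀ σ : MaxAlg.Rule, MaxAlg.IsSelectionRule σ → MaxAlg.CubicSelection σ →
      ∃ (P : MaxAlg.Prog) (c : ℝ),
        MaxAlg.SolvesNachtigall σ P fun n => c * ((n : ℝ) ^ 4 * Real.log n + 1)) ∧
    (∃ (P : MaxAlg.Prog) (c : ℝ),
      MaxAlg.SolvesUltimate P fun n => c * ((n : ℝ) ^ 4 * Real.log n + 1)) :=
  ⟨fun _ hσ hQ => MaxAlg.solvesNachtigall hσ hQ, MaxAlg.solvesUltimate⟩
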